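/- Conventions. Let $T=(\mathbb R/\mathbb Z)^2$, and let $\Delta$ be a non-degenerate triangle with vertices $v_0,v_1,v_2\in\mathbb Z^2$. The lattice points on $\partial\Delta$ divide $\partial\Delta$ into *edges*; each edge $e$ has a primitive outward normal vector $m(e)\in\mathbb Z^2$. An *arrangement associated with* $\Delta$ is an unordered collection of oriented lines on $T$ (images of straight lines of $\mathbb R^2$), one for each edge $e$, with direction $m(e)$ and arbitrary position; these form the quotient of the torus $(\mathbb R/\mathbb Z)^{\#\text{edges}}$ by the permutations of lines of equal direction. It is *simple* if no three lines meet in a point. *Cells* are the connected components of the complement of the lines. A cell is *white* (*black*) if the direction of the line agrees with (is opposite to) the counterclockwise boundary orientation of the cell on each of its edges, and *colored* if it is white or black. An arrangement is *admissible* if every edge of every cell bounds a colored cell. The bicolored graph $\mathfrak D(\mathcal A)$ of an admissible simple arrangement $\mathcal A$ has the centers of gravity of the white (black) cells as white (black) nodes; the nodes of two colored cells sharing a vertex are joined by a straight segment, one for each shared vertex (cells and segments being taken in $\mathbb R^2$ and projected to $T$). The *linear Hanany–Vegh algorithm* picks one arrangement from each connected component of the space of simple arrangements associated with $\Delta$;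 its output is the set of graphs $\mathfrak D(\mathcal A)$ for the picked arrangements $\mathcal A$ that are admissible. **Theorem 1.3.** Let $W(x,y)=\sum_{i=0}^{2}x^{a_i}y^{b_i}$, where $v_i=(a_i,b_i)$, and let $$\mathcal C=\Big\{\tfrac1{2\pi}(\arg x,\arg y)\in T \;:\; x,y\in\mathbb C^\times,\ W(x,y)=0\Big\}$$ be the coamoeba of $W^{-1}(0)$. For every choice of representatives the output of the linear Hanany–Vegh algorithm for $\Delta$ consists of exactly one bicolored graph (with finitely many nodes and edges, embedded in $T$), and up to isotopy on $T$ (a deformation through injective continuous maps, respecting colors and edges at its end) this graph does not depend on the choice. For a suitable choice of the representatives, this graph is a subset of $\mathcal C$ and a strong deformation retract of $\mathcal C$. -/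

import Mathlib

noncomputable section

namespace HananyVegh

/-! ## The torus -/

/-- The real torus `T = M_ℝ / M = (ℝ / ℤ)²`. -/
abbrev Torus : Type := UnitAddCircle × UnitAddCircle

/-- The universal covering `M_ℝ = ℝ² → T`. -/
def proj (x : ℝ × ℝ) : Torus := ((x.1 : UnitAddCircle), (x.2 : UnitAddCircle))

theorem continuous_proj : Continuous proj :=
  ((AddCircle.continuous_mk' 1).comp continuous_fst).prodMk
    ((AddCircle.continuous_mk' 1).comp continuous_snd)

/-- The image in the torus of the straight segment from `a` to `b`. -/
def segmentPath (a b : ℝ × ℝ) : C(unitInterval, Torus) where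
  toFun t := proj (AffineMap.lineMap a b (t : ℝ))
  continuous_toFun := continuous_proj.comp
    (AffineMap.lineMap_continuous.comp continuous_subtype_val)

/-! ## Bicolored graphs on the torus -/

/-- The data of a graph on the torus with two sets of nodes; the edges are parametrised paths. -/
@[ext]
structure ColoredGraph where
  black : Set Torus
  white : Set Torus
  edges : Set C(unitInterval, Torus)

namespace ColoredGraph

/-- The set of all nodes. -/
def nodes (G : ColoredGraph) : Set Torus := G.black ∪ G.white

/-- The subset of the torus covered by the nodes and the edges. -/
def support (G : ColoredGraph) : Set Torus := G.nodes ∪ ⋃ e ∈ G.edges, Set.range e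

/-- The open part `e((0,1))` of an edge. -/
def openEdge (e : C(unitInterval, Torus)) : Set Torus := e '' Set.Ioo 0 1

/-- The data form an embedded bicolored graph: finitely many nodes, black and white nodes are
distinct, finitely many edges, each edge joins a black and a white node, does not
meet a node in its interior and does not cross itself, and different edges do not meet
in interior points. -/
structure IsBicoloredGraph (G : ColoredGraph) : Prop where
  finite_black : G.black.Finite
  finite_white : G.white.Finite
  disjoint_colors : Disjoint G.black G.white
  finite_edges : G.edges.Finite
  bipartite : ∀ e ∈ G.edges,
    (e 0 ∈ G.black ∧ e 1 ∈ G.white) ∨ (e 0 ∈ G.white ∧ e 1 ∈ G.black)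
  open_edge_nodes : ∀ e ∈ G.edges, Disjoint (openEdge e) G.nodes
  simple_edge : ∀ e ∈ G.edges, Set.InjOn e (Set.Ioo 0 1)
  disjoint_edges : ∀ e ∈ G.edges, ∀ e' ∈ G.edges, e ≠ e' → Disjoint (openEdge e) (openEdge e')

/-- `G` and `G'` are isotopic on the torus: the inclusion of `G` can be deformed through
injective continuous maps into the torus to a map onto `G'` that
respects black nodes, white nodes and edges. -/
def Isotopic (G G' : ColoredGraph) : Prop :=
  ∃ F : C(unitInterval × G.support, Torus),
    (∀ x : G.support, F (0, x) = x) ∧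
    (∀ t : unitInterval, Function.Injective fun x : G.support => F (t, x)) ∧
    {p | ∃ x : G.support, (x : Torus) ∈ G.black ∧ F (1, x) = p} = G'.black ∧
    {p | ∃ x : G.support, (x : Torus) ∈ G.white ∧ F (1, x) = p} = G'.white ∧
    {s | ∃ e ∈ G.edges, s = {p | ∃ x : G.support, (x : Torus) ∈ Set.range e ∧ F (1, x) = p}} =
      {s | ∃ e' ∈ G'.edges, s = Set.range e'}

end ColoredGraph

/-! ## Oriented line arrangements

Cells, edges and vertices are described on the universal covering `ℝ²` of the torus. All objects
are then invariant under the translations by `ℤ²`. -/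

/-- An oriented line on the torus: a primitive tangent vector and a position. -/
structure OrientedLine where
  slope : ℤ × ℤ
  primitive : IsCoprime slope.1 slope.2
  offset : UnitAddCircle

namespace OrientedLine

/-- `det (slope, x)`. It is constant on straight lines in the direction of the slope
and increases to the left of this direction. -/
def height (L : OrientedLine) (x : ℝ × ℝ) : ℝ := L.slope.1 * x.2 - L.slope.2 * x.1

/-- The straight line in `ℝ²` at height `s`. -/
def level (L : OrientedLine) (s : ℝ) : Set (ℝ × ℝ) := {x | L.height x = s}

/-- The line at height `s` lies above `L`. -/
def IsLift (L : OrientedLine) (s : ℝ) : Prop := (s : UnitAddCircle) = L.offset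

/-- The preimage of the line in `ℝ²`, a union of parallel lines. -/
def preimage (L : OrientedLine) : Set (ℝ × ℝ) := {x | L.IsLift (L.height x)}

end OrientedLine

section Arrangement

variable {ι : Type} (A : ι → OrientedLine)

/-- No three lines of the arrangement meet in a point. -/
def IsSimple : Prop :=
  ∀ i j k : ι, i ≠ j → j ≠ k → i ≠ k →
    (A i).preimage ∩ (A j).preimage ∩ (A k).preimage = ∅

/-- A vertex: an intersection point of two lines of the arrangement. -/
def IsVertex (v : ℝ × ℝ) : Prop :=
  ∃ i j : ι, i ≠ j ∧ v ∈ (A i).preimage ∧ v ∈ (A j).preimage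

/-- A cell: a connected component of the complement of the union of the lines. -/
def IsCell (C : Set (ℝ × ℝ)) : Prop :=
  ∃ x ∈ (⋃ i, (A i).preimage)ᶜ, C = connectedComponentIn (⋃ i, (A i).preimage)ᶜ x

/-- `E` is an edge of the cell `C`: the non-empty intersection of the boundary of `C` with
a straight line above a line of the arrangement. (As `C` is a convex polygon in the plane,
this intersection is connected.) -/
def IsEdgeOf (C E : Set (ℝ × ℝ)) : Prop :=
  ∃ i s, (A i).IsLift s ∧ E = frontier C ∩ (A i).level s ∧ E.Nonempty

/-- A cell is white if the orientation of the line agrees on each edge with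
the boundary orientation of the cell, that is, if the cell is on the left of the line. -/
def IsWhite (C : Set (ℝ × ℝ)) : Prop :=
  IsCell A C ∧ ∀ i s, (A i).IsLift s → (frontier C ∩ (A i).level s).Nonempty →
    ∀ x ∈ C, s < (A i).height x

/-- A cell is black if the orientation of the line is opposite on each edge to
the boundary orientation of the cell, that is, if the cell is on the right of the line. -/
def IsBlack (C : Set (ℝ × ℝ)) : Prop :=
  IsCell A C ∧ ∀ i s, (A i).IsLift s → (frontier C ∩ (A i).level s).Nonempty →
    ∀ x ∈ C, (A i).height x < s

/-- Every edge of the arrangement bounds a colored cell. -/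
def IsAdmissible : Prop :=
  ∀ C E, IsCell A C → IsEdgeOf A C E →
    ∃ C', (IsWhite A C' ∨ IsBlack A C') ∧ IsEdgeOf A C' E

/-- The center of gravity of a planar region. -/
def centerOfGravity (C : Set (ℝ × ℝ)) : ℝ × ℝ := ⨍ x in C, x

/-- The bicolored graph of an (admissible, simple) arrangement: the nodes are the centers of
gravity of the colored cells, and the nodes of two cells that share a vertex are joined by a
straight segment. (In an admissible simple arrangement two colored cells that share a vertex have
different colors. Edges are parametrised from black to white.) -/
def graphOf : ColoredGraph where
  black := {p | ∃ C, IsBlack A C ∧ p = proj (centerOfGravity C)}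
  white := {p | ∃ C, IsWhite A C ∧ p = proj (centerOfGravity C)}
  edges := {e | ∃ B C v, IsBlack A B ∧ IsWhite A C ∧ IsVertex A v ∧
    v ∈ frontier B ∧ v ∈ frontier C ∧
    e = segmentPath (centerOfGravity B) (centerOfGravity C)}

end Arrangement

/-! ## Lattice triangles -/

/-- A non-degenerate triangle with vertices in `N = ℤ²`. -/
structure LatticeTriangle where
  vertex : Fin 3 → ℤ × ℤ
  nondegenerate :
    ((vertex 1).1 - (vertex 0).1) * ((vertex 2).2 - (vertex 0).2) -
      ((vertex 1).2 - (vertex 0).2) * ((vertex 2).1 - (vertex 0).1) ≠ 0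

namespace LatticeTriangle

variable (Δ : LatticeTriangle)

/-- Twice the signed area: positive if the vertices `0`, `1`, `2` are in
counterclockwise order. -/
def signedArea : ℤ :=
  ((Δ.vertex 1).1 - (Δ.vertex 0).1) * ((Δ.vertex 2).2 - (Δ.vertex 0).2) -
    ((Δ.vertex 1).2 - (Δ.vertex 0).2) * ((Δ.vertex 2).1 - (Δ.vertex 0).1)

/-- The side opposite to the vertex `i`, as a vector from the vertex `i + 1` to
the vertex `i + 2`. -/
def side (i : Fin 3) : ℤ × ℤ := Δ.vertex (i + 2) - Δ.vertex (i + 1)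

/-- The lattice length of a side. -/
def latticeLength (i : Fin 3) : ℕ := Int.gcd (Δ.side i).1 (Δ.side i).2

/-- The edges of the triangle: the components of the boundary minus the lattice points. The
lattice points divide the `i`-th side into `latticeLength i` such edges. -/
abbrev Edge : Type := Σ i : Fin 3, Fin (Δ.latticeLength i)

/-- The primitive outward normal vector of the `i`-th side: the side
vector, rotated clockwise by a right angle if the vertices are in counterclockwise order
and counterclockwise otherwise, divided by the lattice length. -/
def normal (i : Fin 3) : ℤ × ℤ :=
  (Δ.signedArea.sign * ((Δ.side i).2 / Δ.latticeLength i),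
    -(Δ.signedArea.sign * ((Δ.side i).1 / Δ.latticeLength i)))

theorem side_ne_zero (i : Fin 3) : (Δ.side i).1 ≠ 0 ∨ (Δ.side i).2 ≠ 0 := by
  by_contra! h
  obtain ⟨h1, h2⟩ := h
  apply Δ.nondegenerate
  fin_cases i
  · have e1 : (Δ.vertex 2).1 - (Δ.vertex 1).1 = 0 := h1
    have e2 : (Δ.vertex 2).2 - (Δ.vertex 1).2 = 0 := h2
    rw [sub_eq_zero.1 e1, sub_eq_zero.1 e2]
    ring
  · have e1 : (Δ.vertex 0).1 - (Δ.vertex 2).1 = 0 := h1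
    have e2 : (Δ.vertex 0).2 - (Δ.vertex 2).2 = 0 := h2
    rw [sub_eq_zero.1 e1, sub_eq_zero.1 e2]
    ring
  · have e1 : (Δ.vertex 1).1 - (Δ.vertex 0).1 = 0 := h1
    have e2 : (Δ.vertex 1).2 - (Δ.vertex 0).2 = 0 := h2
    rw [e1, e2]
    ring

theorem isCoprime_normal (i : Fin 3) : IsCoprime (Δ.normal i).1 (Δ.normal i).2 := by
  have hg : 0 < Int.gcd (Δ.side i).1 (Δ.side i).2 := by
    rcases Δ.side_ne_zero i with h | h
    · exact Int.gcd_pos_of_ne_zero_left _ h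
    · exact Int.gcd_pos_of_ne_zero_right _ h
  have hc : IsCoprime ((Δ.side i).2 / (Δ.latticeLength i : ℤ))
      ((Δ.side i).1 / (Δ.latticeLength i : ℤ)) := by
    rw [isCoprime_comm, Int.isCoprime_iff_gcd_eq_one]
    exact Int.gcd_div_gcd_div_gcd hg
  have hu : IsUnit Δ.signedArea.sign := by
    rcases lt_or_gt_of_ne Δ.nondegenerate with h | h
    · exact Int.isUnit_iff.2 (Or.inr (Int.sign_eq_neg_one_of_neg h))
    · exact Int.isUnit_iff.2 (Or.inl (Int.sign_eq_one_of_pos h))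
  change IsCoprime (Δ.signedArea.sign * _) (-(Δ.signedArea.sign * _))
  exact ((isCoprime_mul_unit_left hu _ _).2 hc).neg_right

/-! ## The linear Hanany–Vegh algorithm -/

/-- The arrangement associated with the triangle, one line for each edge in the direction of the
outward normal vector, with given positions. The positions form a real torus. -/
def arrangement (c : Δ.Edge → UnitAddCircle) (e : Δ.Edge) : OrientedLine where
  slope := Δ.normal e.1
  primitive := Δ.isCoprime_normal e.1
  offset := c e

/-- The positions of the simple arrangements. -/
def simpleArrangements : Set (Δ.Edge → UnitAddCircle) := {c | IsSimple (Δ.arrangement c)}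

/-- The simple arrangements `c` and `c'` lie in the same connected component
of the space of simple arrangements. As an arrangement is an unordered collection of
lines, this space is the quotient of `simpleArrangements` by the permutations of
the lines with the same slope. -/
def SameComponent (c c' : Δ.Edge → UnitAddCircle) : Prop :=
  ∃ σ : Equiv.Perm Δ.Edge, (∀ e, Δ.normal (σ e).1 = Δ.normal e.1) ∧
    c' ∘ σ ∈ connectedComponentIn Δ.simpleArrangements c

/-- `V` contains exactly one arrangement from each connected component of the space
of simple arrangements. -/
def IsRepresentativeSystem (V : Set (Δ.Edge → UnitAddCircle)) : Prop :=
  V ⊆ Δ.simpleArrangements ∧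
    ∀ c ∈ Δ.simpleArrangements, ∃! c', c' ∈ V ∧ Δ.SameComponent c c'

/-- The output of the linear Hanany–Vegh algorithm for the representatives `V`: the
graphs of the admissible arrangements in `V`. -/
def output (V : Set (Δ.Edge → UnitAddCircle)) : Set ColoredGraph :=
  {G | ∃ c ∈ V, IsAdmissible (Δ.arrangement c) ∧ G = graphOf (Δ.arrangement c)}

/-- The sum of the monomials at the vertices, as a function on `(ℂˣ)²`. -/
def W (p : ℂˣ × ℂˣ) : ℂ :=
  ∑ i : Fin 3, ((p.1 : ℂ) ^ (Δ.vertex i).1 * (p.2 : ℂ) ^ (Δ.vertex i).2)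

end LatticeTriangle

/-! ## Coamoebas and deformation retracts -/

/-- The argument map `(ℂˣ)² → (ℝ / ℤ)²`. -/
def argMap (p : ℂˣ × ℂˣ) : Torus :=
  proj (Complex.arg p.1 / (2 * Real.pi), Complex.arg p.2 / (2 * Real.pi))

/-- The coamoeba of the zero locus of a function on `(ℂˣ)²`. -/
def coamoeba (f : ℂˣ × ℂˣ → ℂ) : Set Torus := argMap '' {p | f p = 0}

/-- `S` is a (strong) deformation retract of the subspace `X`. -/
def IsDeformationRetract (S X : Set Torus) : Prop :=
  S ⊆ X ∧ ∃ H : C(unitInterval × X, X),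
    (∀ x, H (0, x) = x) ∧ (∀ x, (H (1, x) : Torus) ∈ S) ∧
    ∀ (t : unitInterval) (x : X), (x : Torus) ∈ S → H (t, x) = x

end HananyVegh

end

noncomputable section

/-! ### Points of the circle and the torus modulo integers -/

namespace HananyVegh

/-! Pairing with the sides of the triangle gives three coordinates of sum zero on the plane
(`coord`). In them the lifts of the lines of the `i`-th direction are levels of the `i`-th
coordinate, and they can be listed in increasing order as `level η i n`, an integer plus a periodic
deviation. Three lines, one in each direction, meet exactly when their levels have sum zero, so the
combinatorics of a simple arrangement lies in the signs of these sums.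

Given lines `a`, `b` of the first two directions, let `κ a b` be the last index `d` of the third for
which the sum is negative. Admissibility forces the cell to the left of both lines at their crossing
to be white, and hence `κ` drops by at least one when `a` or `b` grows by one. By periodicity the
average drop is exactly one, so every drop is, and the sign depends only on `a + b + d`
(`exists_levelSum_neg_iff`). After a renumbering the sums are negative for index sum 0 and positive
for index sum 1 (`IsGood`). Conversely, such an arrangement is simple and admissible: its cells are
white triangles, black triangles, and uncolored cells each of whose edges bounds a triangle. Up to
periodicity `IsGood` consists of finitely many strict linear inequalities, so it defines an open
convex set. No sum vanishes in a simple arrangement, so limits of good arrangements that are simple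
are good. Modulo permutations, the good arrangements are therefore exactly one component
(`isOpen_goodArrangements`, `exists_isClosed_goodArrangements`,
`sameComponent_of_mem_goodArrangements`), and the output is one graph.

The center of gravity of a colored triangle is the projection along the diagonal of the point of
three-space whose coordinates are the three levels. The graph is thus the projection of a staircase
of axis-parallel segments. No point of the staircase exceeds another one in all three coordinates,
so the projection is injective (`samePoint_of_edgePoint_eq`), whatever the good deviations are.
Linear interpolation of deviations is then an isotopy (`isotopic_latticeGraph`).

Non-degeneracy allows arbitrary ratios of the absolute values of the three monomials. So a point is
in the coamoeba exactly when the three unit vectors given by the arguments have a vanishing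
combination with positive weights. The differences of the arguments are the coordinates times `2π`,
up to a common sign. Hence the coamoeba consists of the open colored triangles of an equidistant
arrangement together with their vertices. Each triangle retracts to the tripod from its center to
its vertices; these maps fix the vertices, so they glue, and the tripods form the graph of this
arrangement (`isDeformationRetract_equidistant`). -/

theorem unitAddCircle_coe_eq_coe_iff (a b : ℝ) :
    (a : UnitAddCircle) = (b : UnitAddCircle) ↔ ∃ z : ℤ, a = b + z := by
  rw [← sub_eq_zero, ← AddCircle.coe_sub, AddCircle.coe_eq_zero_iff]
  constructor
  · rintro ⟨z, hz⟩
    refine ⟨z, ?_⟩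
    simp only [zsmul_eq_mul, mul_one] at hz
    linarith
  · rintro ⟨z, hz⟩
    refine ⟨z, ?_⟩
    simp only [zsmul_eq_mul, mul_one]
    linarith

/-- The inclusion of the integral points of the plane. -/
def intPoint (m : ℤ × ℤ) : ℝ × ℝ := ((m.1 : ℝ), (m.2 : ℝ))

theorem proj_eq_proj_iff (x y : ℝ × ℝ) : proj x = proj y ↔ ∃ m : ℤ × ℤ, x = y + intPoint m := by
  unfold proj
  rw [Prod.mk.injEq, unitAddCircle_coe_eq_coe_iff, unitAddCircle_coe_eq_coe_iff]
  constructor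
  · rintro ⟨⟨a, ha⟩, ⟨b, hb⟩⟩
    exact ⟨(a, b), Prod.ext ha hb⟩
  · rintro ⟨m, rfl⟩
    exact ⟨⟨m.1, rfl⟩, ⟨m.2, rfl⟩⟩

theorem proj_surjective : Function.Surjective proj := by
  rintro ⟨a, b⟩
  obtain ⟨x, rfl⟩ := QuotientAddGroup.mk_surjective a
  obtain ⟨y, rfl⟩ := QuotientAddGroup.mk_surjective b
  exact ⟨(x, y), rfl⟩

/-! ### Coordinates of sum zero given by the sides -/

namespace LatticeTriangle

variable (Δ : LatticeTriangle)

theorem latticeLength_pos (i : Fin 3) : 0 < Δ.latticeLength i := by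
  rcases Δ.side_ne_zero i with h | h
  · exact Int.gcd_pos_of_ne_zero_left _ h
  · exact Int.gcd_pos_of_ne_zero_right _ h

theorem latticeLength_pos_int (i : Fin 3) : (0 : ℤ) < Δ.latticeLength i := by
  exact_mod_cast Δ.latticeLength_pos i

theorem latticeLength_pos_real (i : Fin 3) : (0 : ℝ) < Δ.latticeLength i := by
  exact_mod_cast Δ.latticeLength_pos i

theorem latticeLength_mul_normal_fst (i : Fin 3) :
    (Δ.latticeLength i : ℤ) * (Δ.normal i).1 = Δ.signedArea.sign * (Δ.side i).2 := by
  have h : (Δ.latticeLength i : ℤ) ∣ (Δ.side i).2 := Int.gcd_dvd_right _ _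
  change (Δ.latticeLength i : ℤ) * (Δ.signedArea.sign * ((Δ.side i).2 / Δ.latticeLength i)) = _
  rw [mul_left_comm, Int.mul_ediv_cancel' h]

theorem latticeLength_mul_normal_snd (i : Fin 3) :
    (Δ.latticeLength i : ℤ) * (Δ.normal i).2 = -(Δ.signedArea.sign * (Δ.side i).1) := by
  have h : (Δ.latticeLength i : ℤ) ∣ (Δ.side i).1 := Int.gcd_dvd_left _ _
  change (Δ.latticeLength i : ℤ) * (-(Δ.signedArea.sign * ((Δ.side i).1 / Δ.latticeLength i))) = _
  rw [mul_neg, mul_left_comm, Int.mul_ediv_cancel' h]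

theorem signedArea_ne_zero : Δ.signedArea ≠ 0 := Δ.nondegenerate

theorem sign_mul_sign : Δ.signedArea.sign * Δ.signedArea.sign = 1 := by
  rcases lt_or_gt_of_ne Δ.signedArea_ne_zero with h | h
  · rw [Int.sign_eq_neg_one_of_neg h]; rfl
  · rw [Int.sign_eq_one_of_pos h]; rfl

theorem sign_mul_sign_real : (Δ.signedArea.sign : ℝ) * (Δ.signedArea.sign : ℝ) = 1 := by
  exact_mod_cast Δ.sign_mul_sign

/-- The linear coordinates of the plane given by the sides of the triangle; the `i`-th coordinate is
the height over lines in the direction of the `i`-th normal, multiplied by the lattice length. -/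
def coord : (ℝ × ℝ) →ₗ[ℝ] (Fin 3 → ℝ) where
  toFun x i := Δ.signedArea.sign * ((Δ.side i).1 * x.1 + (Δ.side i).2 * x.2)
  map_add' x y := by
    ext i; simp only [Prod.fst_add, Prod.snd_add, Pi.add_apply]; ring
  map_smul' r x := by
    ext i; simp only [Prod.smul_fst, Prod.smul_snd, smul_eq_mul, RingHom.id_apply, Pi.smul_apply]
    ring

theorem coord_apply (x : ℝ × ℝ) (i : Fin 3) :
    Δ.coord x i = Δ.signedArea.sign * ((Δ.side i).1 * x.1 + (Δ.side i).2 * x.2) := rfl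

/-- The coordinates of an integral point are integers. -/
def intCoord (m : ℤ × ℤ) (i : Fin 3) : ℤ :=
  Δ.signedArea.sign * ((Δ.side i).1 * m.1 + (Δ.side i).2 * m.2)

theorem coord_intPoint (m : ℤ × ℤ) (i : Fin 3) : Δ.coord (intPoint m) i = Δ.intCoord m i := by
  simp [coord_apply, intPoint, intCoord]

theorem latticeLength_dvd_intCoord (m : ℤ × ℤ) (i : Fin 3) :
    (Δ.latticeLength i : ℤ) ∣ Δ.intCoord m i := by
  refine Dvd.dvd.mul_left (dvd_add ?_ ?_) _
  · exact Dvd.dvd.mul_right (Int.gcd_dvd_left _ _) _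
  · exact Dvd.dvd.mul_right (Int.gcd_dvd_right _ _) _

theorem latticeLength_mul_height (c : Δ.Edge → UnitAddCircle) (e : Δ.Edge) (x : ℝ × ℝ) :
    Δ.latticeLength e.1 * (Δ.arrangement c e).height x = Δ.coord x e.1 := by
  have h1 : (Δ.latticeLength e.1 : ℝ) * (Δ.normal e.1).1 = Δ.signedArea.sign * (Δ.side e.1).2 := by
    exact_mod_cast Δ.latticeLength_mul_normal_fst e.1
  have h2 : (Δ.latticeLength e.1 : ℝ) * (Δ.normal e.1).2 =
      -(Δ.signedArea.sign * (Δ.side e.1).1) := by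
    exact_mod_cast Δ.latticeLength_mul_normal_snd e.1
  change (Δ.latticeLength e.1 : ℝ) * ((Δ.normal e.1).1 * x.2 - (Δ.normal e.1).2 * x.1) = _
  rw [coord_apply, mul_sub, ← mul_assoc, ← mul_assoc, h1, h2]
  ring

theorem side_sum_fst : (Δ.side 0).1 + (Δ.side 1).1 + (Δ.side 2).1 = 0 := by
  change ((Δ.vertex 2).1 - (Δ.vertex 1).1) + ((Δ.vertex 0).1 - (Δ.vertex 2).1) +
    ((Δ.vertex 1).1 - (Δ.vertex 0).1) = 0
  ring

theorem side_sum_snd : (Δ.side 0).2 + (Δ.side 1).2 + (Δ.side 2).2 = 0 := by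
  change ((Δ.vertex 2).2 - (Δ.vertex 1).2) + ((Δ.vertex 0).2 - (Δ.vertex 2).2) +
    ((Δ.vertex 1).2 - (Δ.vertex 0).2) = 0
  ring

theorem side_det : (Δ.side 1).1 * (Δ.side 2).2 - (Δ.side 1).2 * (Δ.side 2).1 = Δ.signedArea := by
  change ((Δ.vertex 0).1 - (Δ.vertex 2).1) * ((Δ.vertex 1).2 - (Δ.vertex 0).2) -
    ((Δ.vertex 0).2 - (Δ.vertex 2).2) * ((Δ.vertex 1).1 - (Δ.vertex 0).1) = _
  unfold signedArea
  ring

theorem intCoord_sum (m : ℤ × ℤ) : Δ.intCoord m 0 + Δ.intCoord m 1 + Δ.intCoord m 2 = 0 := by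
  simp only [intCoord]
  linear_combination Δ.signedArea.sign * m.1 * Δ.side_sum_fst +
    Δ.signedArea.sign * m.2 * Δ.side_sum_snd

theorem coord_sum (x : ℝ × ℝ) : Δ.coord x 0 + Δ.coord x 1 + Δ.coord x 2 = 0 := by
  have h1 : ((Δ.side 0).1 : ℝ) + (Δ.side 1).1 + (Δ.side 2).1 = 0 := by
    exact_mod_cast Δ.side_sum_fst
  have h2 : ((Δ.side 0).2 : ℝ) + (Δ.side 1).2 + (Δ.side 2).2 = 0 := by
    exact_mod_cast Δ.side_sum_snd
  simp only [coord_apply]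
  linear_combination Δ.signedArea.sign * x.1 * h1 + Δ.signedArea.sign * x.2 * h2

/-- The point of the plane with given coordinates of sum zero. -/
def recon : (Fin 3 → ℝ) →ₗ[ℝ] (ℝ × ℝ) where
  toFun y := (Δ.signedArea.sign * (y 1 * (Δ.side 2).2 - y 2 * (Δ.side 1).2) / Δ.signedArea,
    Δ.signedArea.sign * (y 2 * (Δ.side 1).1 - y 1 * (Δ.side 2).1) / Δ.signedArea)
  map_add' x y := by
    ext <;> simp only [Pi.add_apply, Prod.fst_add, Prod.snd_add] <;> ring
  map_smul' r x := by
    ext <;> simp only [Pi.smul_apply, Prod.smul_fst, Prod.smul_snd, smul_eq_mul,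
      RingHom.id_apply] <;> ring

theorem coord_recon (y : Fin 3 → ℝ) (hy : y 0 + y 1 + y 2 = 0) : Δ.coord (Δ.recon y) = y := by
  have hA : (Δ.signedArea : ℝ) ≠ 0 := by exact_mod_cast Δ.signedArea_ne_zero
  have hs := Δ.sign_mul_sign_real
  have hd : ((Δ.side 1).1 : ℝ) * (Δ.side 2).2 - (Δ.side 1).2 * (Δ.side 2).1 = Δ.signedArea := by
    exact_mod_cast Δ.side_det
  have h1 : Δ.coord (Δ.recon y) 1 = y 1 := by
    simp only [coord_apply, recon, LinearMap.coe_mk, AddHom.coe_mk]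
    field_simp
    linear_combination y 1 * Δ.signedArea * hs + (Δ.signedArea.sign : ℝ) ^ 2 * y 1 * hd
  have h2 : Δ.coord (Δ.recon y) 2 = y 2 := by
    simp only [coord_apply, recon, LinearMap.coe_mk, AddHom.coe_mk]
    field_simp
    linear_combination y 2 * Δ.signedArea * hs + (Δ.signedArea.sign : ℝ) ^ 2 * y 2 * hd
  have h0 := Δ.coord_sum (Δ.recon y)
  ext i
  fin_cases i
  · change Δ.coord (Δ.recon y) 0 = y 0
    linarith
  · exact h1
  · exact h2

theorem recon_coord (x : ℝ × ℝ) : Δ.recon (Δ.coord x) = x := by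
  have hA : (Δ.signedArea : ℝ) ≠ 0 := by exact_mod_cast Δ.signedArea_ne_zero
  have hs := Δ.sign_mul_sign_real
  have hd : ((Δ.side 1).1 : ℝ) * (Δ.side 2).2 - (Δ.side 1).2 * (Δ.side 2).1 = Δ.signedArea := by
    exact_mod_cast Δ.side_det
  ext
  · simp only [coord_apply, recon, LinearMap.coe_mk, AddHom.coe_mk]
    field_simp
    linear_combination x.1 * Δ.signedArea * hs + (Δ.signedArea.sign : ℝ) ^ 2 * x.1 * hd
  · simp only [coord_apply, recon, LinearMap.coe_mk, AddHom.coe_mk]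
    field_simp
    linear_combination x.2 * Δ.signedArea * hs + (Δ.signedArea.sign : ℝ) ^ 2 * x.2 * hd

theorem coord_injective : Function.Injective Δ.coord := fun x y h => by
  rw [← Δ.recon_coord x, h, Δ.recon_coord]

theorem exists_coord_eq (y : Fin 3 → ℝ) (hy : y 0 + y 1 + y 2 = 0) : ∃ x, Δ.coord x = y :=
  ⟨_, Δ.coord_recon y hy⟩

theorem continuous_coord : Continuous Δ.coord := LinearMap.continuous_of_finiteDimensional _

theorem continuous_coord_apply (i : Fin 3) : Continuous fun x => Δ.coord x i :=
  (continuous_apply i).comp Δ.continuous_coord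

theorem continuous_recon : Continuous Δ.recon := LinearMap.continuous_of_finiteDimensional _

theorem exists_coord_pair {i j : Fin 3} (hij : i ≠ j) (a b : ℝ) :
    ∃ x, Δ.coord x i = a ∧ Δ.coord x j = b := by
  fin_cases i <;> fin_cases j <;> first | exact absurd rfl hij | skip
  · exact (Δ.exists_coord_eq ![a, b, -a - b] (by
    simp only [Matrix.cons_val]; ring)).imp fun x h => by simp [h]
  · exact (Δ.exists_coord_eq ![a, -a - b, b] (by
    simp only [Matrix.cons_val]; ring)).imp fun x h => by simp [h]
  · exact (Δ.exists_coord_eq ![b, a, -a - b] (by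
    simp only [Matrix.cons_val]; ring)).imp fun x h => by simp [h]
  · exact (Δ.exists_coord_eq ![-a - b, a, b] (by
    simp only [Matrix.cons_val]; ring)).imp fun x h => by simp [h]
  · exact (Δ.exists_coord_eq ![b, -a - b, a] (by
    simp only [Matrix.cons_val]; ring)).imp fun x h => by simp [h]
  · exact (Δ.exists_coord_eq ![-a - b, b, a] (by
    simp only [Matrix.cons_val]; ring)).imp fun x h => by simp [h]

/-- Equal normals would make two coordinates proportional, but any two coordinates take independent
values. Hence a permutation of edges that preserves normals preserves the sides. -/
theorem normal_injective : Function.Injective Δ.normal := by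
  intro i j h
  by_contra hij
  obtain ⟨x, hi, hj⟩ := Δ.exists_coord_pair hij 0 (1 : ℝ)
  have key : ∀ k : Fin 3, Δ.coord x k =
      Δ.latticeLength k * ((Δ.normal k).1 * x.2 - (Δ.normal k).2 * x.1) := fun k =>
    (Δ.latticeLength_mul_height (fun _ => 0) ⟨k, ⟨0, Δ.latticeLength_pos k⟩⟩ x).symm
  rw [key, h] at hi
  rw [key] at hj
  have := Δ.latticeLength_pos_real i
  rcases mul_eq_zero.1 hi with h0 | h0
  · exact this.ne' h0
  · rw [h0, mul_zero] at hj
    exact zero_ne_one hj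

/-! ### Enumerated families of lines -/

/-- The residue of an integer modulo the lattice length of a side. -/
def residue (i : Fin 3) (n : ℤ) : Fin (Δ.latticeLength i) :=
  ⟨(n % Δ.latticeLength i).toNat, by
    have h := Int.emod_lt_of_pos n (Δ.latticeLength_pos_int i)
    have h' := Int.emod_nonneg n (Δ.latticeLength_pos_int i).ne'
    omega⟩

theorem residue_cast (i : Fin 3) (n : ℤ) :
    ((Δ.residue i n : ℕ) : ℤ) = n % Δ.latticeLength i :=
  Int.toNat_of_nonneg (Int.emod_nonneg n (Δ.latticeLength_pos_int i).ne')

theorem residue_add_mul (i : Fin 3) (n k : ℤ) :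
    Δ.residue i (n + Δ.latticeLength i * k) = Δ.residue i n := by
  ext; zify; rw [residue_cast, residue_cast, Int.add_mul_emod_self_left]

theorem residue_natCast (i : Fin 3) (k : Fin (Δ.latticeLength i)) :
    Δ.residue i (k : ℕ) = k := by
  ext; zify; rw [residue_cast]
  exact Int.emod_eq_of_lt (by positivity) (by exact_mod_cast k.2)

/-- The coordinate of the `n`-th line in the direction of the `i`-th normal, where `η` measures the
deviation from equidistant lines. -/
def level (η : Δ.Edge → ℝ) (i : Fin 3) (n : ℤ) : ℝ := n + η ⟨i, Δ.residue i n⟩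

/-- The offsets on the torus of the lines described by `η`. -/
def position (η : Δ.Edge → ℝ) (e : Δ.Edge) : UnitAddCircle :=
  ((((e.2 : ℕ) + η e) / Δ.latticeLength e.1 : ℝ) : UnitAddCircle)

theorem level_add_mul (η : Δ.Edge → ℝ) (i : Fin 3) (n k : ℤ) :
    Δ.level η i (n + Δ.latticeLength i * k) = Δ.level η i n + Δ.latticeLength i * k := by
  unfold level
  rw [residue_add_mul]
  push_cast
  ring

theorem level_add_of_dvd (η : Δ.Edge → ℝ) (i : Fin 3) (n : ℤ) {k : ℤ}
    (hk : (Δ.latticeLength i : ℤ) ∣ k) : Δ.level η i (n + k) = Δ.level η i n + k := by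
  obtain ⟨q, rfl⟩ := hk
  rw [level_add_mul]
  push_cast
  rfl

/-- The lifts of the lines of the arrangement in the `i`-th direction are enumerated by `η`. -/
def Enumerates (η : Δ.Edge → ℝ) (c : Δ.Edge → UnitAddCircle) : Prop :=
  ∀ i (r : ℝ), (∃ k, (r : UnitAddCircle) = c ⟨i, k⟩) ↔
    ∃ n, Δ.latticeLength i * r = Δ.level η i n

/-- Moving a lift by an integer moves its coordinate by a multiple of the lattice length, so the
lifts of the `k`-th line are the levels whose index has residue `k`. -/
theorem coe_eq_position_iff (η : Δ.Edge → ℝ) (i : Fin 3) (k : Fin (Δ.latticeLength i)) (r : ℝ) :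
    (r : UnitAddCircle) = Δ.position η ⟨i, k⟩ ↔
      ∃ n, Δ.residue i n = k ∧ Δ.latticeLength i * r = Δ.level η i n := by
  have hl := Δ.latticeLength_pos_real i
  unfold position
  rw [unitAddCircle_coe_eq_coe_iff]
  constructor
  · rintro ⟨z, rfl⟩
    refine ⟨(k : ℕ) + Δ.latticeLength i * z, ?_, ?_⟩
    · rw [residue_add_mul, residue_natCast]
    · rw [level_add_mul, level, residue_natCast]
      push_cast
      field_simp
  · rintro ⟨n, rfl, hn⟩
    refine ⟨n / Δ.latticeLength i, ?_⟩
    have h1 : ((Δ.residue i n : ℕ) : ℝ) = ((n % Δ.latticeLength i : ℤ) : ℝ) := by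
      exact_mod_cast Δ.residue_cast i n
    have h2 : (n : ℝ) = ((n % Δ.latticeLength i : ℤ) : ℝ) +
        Δ.latticeLength i * ((n / Δ.latticeLength i : ℤ) : ℝ) := by
      exact_mod_cast (Int.emod_add_mul_ediv n (Δ.latticeLength i)).symm
    change r = ((Δ.residue i n : ℕ) + η ⟨i, Δ.residue i n⟩) / (Δ.latticeLength i) + _
    rw [h1]
    unfold level at hn
    field_simp
    linarith

/-- `Enumerates` looks only at the set of lines in each direction, so a permutation of parallel
lines does not matter. All later statements on cells rest on it alone. -/
theorem enumerates_of_comp_eq {η : Δ.Edge → ℝ} {c : Δ.Edge → UnitAddCircle}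
    {σ : Equiv.Perm Δ.Edge} (hσ : ∀ e, Δ.normal (σ e).1 = Δ.normal e.1)
    (h : c ∘ σ = Δ.position η) : Δ.Enumerates η c := by
  intro i r
  have hfst : ∀ e, (σ e).1 = e.1 := fun e => Δ.normal_injective (hσ e)
  constructor
  · rintro ⟨k, hk⟩
    obtain ⟨⟨j, k'⟩, he⟩ := σ.surjective ⟨i, k⟩
    have hj : i = j := by have := hfst ⟨j, k'⟩; rwa [he] at this
    subst hj
    rw [← he, show c (σ ⟨i, k'⟩) = Δ.position η ⟨i, k'⟩ from congrFun h _,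
      coe_eq_position_iff] at hk
    obtain ⟨n, -, hn⟩ := hk
    exact ⟨n, hn⟩
  · rintro ⟨n, hn⟩
    have h1 := (Δ.coe_eq_position_iff η i (Δ.residue i n) r).2 ⟨n, rfl, hn⟩
    rw [← congrFun h ⟨i, Δ.residue i n⟩, Function.comp_apply] at h1
    have h2 := hfst ⟨i, Δ.residue i n⟩
    obtain ⟨⟨j, k'⟩, hk'⟩ : ∃ e, e = σ ⟨i, Δ.residue i n⟩ := ⟨_, rfl⟩
    rw [← hk'] at h1 h2
    dsimp only at h2
    subst h2
    exact ⟨k', h1⟩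

end LatticeTriangle

namespace LatticeTriangle

/-! ### Cells and edges -/

variable (Δ : LatticeTriangle) {η : Δ.Edge → ℝ} {c : Δ.Edge → UnitAddCircle}

/-- The open polygon between consecutive lines of each direction. -/
def cell (η : Δ.Edge → ℝ) (n : Fin 3 → ℤ) : Set (ℝ × ℝ) :=
  {x | ∀ i, Δ.level η i (n i) < Δ.coord x i ∧ Δ.coord x i < Δ.level η i (n i + 1)}

/-- The closed polygon between consecutive lines of each direction. -/
def closedCell (η : Δ.Edge → ℝ) (n : Fin 3 → ℤ) : Set (ℝ × ℝ) :=
  {x | ∀ i, Δ.level η i (n i) ≤ Δ.coord x i ∧ Δ.coord x i ≤ Δ.level η i (n i + 1)}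

theorem mem_preimage_iff (c : Δ.Edge → UnitAddCircle) (e : Δ.Edge) (x : ℝ × ℝ) :
    x ∈ (Δ.arrangement c e).preimage ↔
      ((Δ.coord x e.1 / Δ.latticeLength e.1 : ℝ) : UnitAddCircle) = c e := by
  have hl := Δ.latticeLength_pos_real e.1
  rw [← Δ.latticeLength_mul_height c e x, mul_div_cancel_left₀ _ hl.ne']
  rfl

theorem exists_mem_preimage_iff (h : Δ.Enumerates η c) (i : Fin 3) (x : ℝ × ℝ) :
    (∃ k, x ∈ (Δ.arrangement c ⟨i, k⟩).preimage) ↔ ∃ n, Δ.coord x i = Δ.level η i n := by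
  have hl := Δ.latticeLength_pos_real i
  simp only [mem_preimage_iff]
  rw [h i]
  simp only [mul_div_cancel₀ _ hl.ne']

theorem mem_iUnion_preimage_iff (h : Δ.Enumerates η c) (x : ℝ × ℝ) :
    x ∈ ⋃ e, (Δ.arrangement c e).preimage ↔ ∃ i n, Δ.coord x i = Δ.level η i n := by
  rw [Set.mem_iUnion]
  constructor
  · rintro ⟨⟨i, k⟩, hx⟩
    exact ⟨i, (Δ.exists_mem_preimage_iff h i x).1 ⟨k, hx⟩⟩
  · rintro ⟨i, hi⟩
    obtain ⟨k, hk⟩ := (Δ.exists_mem_preimage_iff h i x).2 hi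
    exact ⟨⟨i, k⟩, hk⟩

/-- The lifts of lines of the arrangement are the level lines of the coordinates. -/
theorem exists_isLift_iff (h : Δ.Enumerates η c) {P : Set (ℝ × ℝ) → Prop} :
    (∃ e s, (Δ.arrangement c e).IsLift s ∧ P ((Δ.arrangement c e).level s)) ↔
      ∃ i n, P {x | Δ.coord x i = Δ.level η i n} := by
  have key : ∀ (e : Δ.Edge) (s : ℝ), (Δ.arrangement c e).level s =
      {x | Δ.coord x e.1 = Δ.latticeLength e.1 * s} := by
    intro e s
    have hl := Δ.latticeLength_pos_real e.1
    ext x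
    change (Δ.arrangement c e).height x = s ↔ Δ.coord x e.1 = _
    rw [← Δ.latticeLength_mul_height c e x, mul_right_inj' hl.ne']
  constructor
  · rintro ⟨⟨i, k⟩, s, hs, hP⟩
    obtain ⟨n, hn⟩ := (h i s).1 ⟨k, hs⟩
    refine ⟨i, n, ?_⟩
    rw [key] at hP
    rwa [← hn]
  · rintro ⟨i, n, hP⟩
    have hl := Δ.latticeLength_pos_real i
    obtain ⟨k, hk⟩ := (h i (Δ.level η i n / Δ.latticeLength i)).2
      ⟨n, mul_div_cancel₀ _ hl.ne'⟩
    refine ⟨⟨i, k⟩, _, hk, ?_⟩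
    rw [key]
    simpa only [mul_div_cancel₀ _ hl.ne'] using hP

variable (hm : ∀ i, StrictMono (Δ.level η i))
include hm

/-- By quasi-periodicity the levels are unbounded in both directions. -/
theorem exists_level_le_lt (i : Fin 3) (y : ℝ) :
    ∃ n, Δ.level η i n ≤ y ∧ y < Δ.level η i (n + 1) := by
  have hl := Δ.latticeLength_pos_real i
  have hlev : ∀ k : ℤ, Δ.level η i (Δ.latticeLength i * k) =
      Δ.level η i 0 + Δ.latticeLength i * k := fun k => by
    rw [← level_add_mul, zero_add]
  obtain ⟨n, hn, hn'⟩ := Int.exists_greatest_of_bdd (P := fun n => Δ.level η i n ≤ y) (by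
    obtain ⟨k, hk⟩ := exists_int_gt ((y - Δ.level η i 0) / Δ.latticeLength i)
    refine ⟨Δ.latticeLength i * k, fun z hz => ?_⟩
    by_contra! hlt
    have h1 := hm i hlt
    rw [hlev] at h1
    rw [div_lt_iff₀ hl] at hk
    linarith) (by
    obtain ⟨k, hk⟩ := exists_int_lt ((y - Δ.level η i 0) / Δ.latticeLength i)
    refine ⟨Δ.latticeLength i * k, ?_⟩
    rw [hlev]
    rw [lt_div_iff₀ hl] at hk
    linarith)
  refine ⟨n, hn, ?_⟩
  by_contra! h
  have := hn' _ h
  omega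

omit hm in
theorem convex_cell (n : Fin 3 → ℤ) : Convex ℝ (Δ.cell η n) := by
  intro x hx y hy a b ha hb hab i
  simp only [map_add, map_smul, Pi.add_apply, Pi.smul_apply, smul_eq_mul]
  have := (convex_Ioo (Δ.level η i (n i)) (Δ.level η i (n i + 1))) (hx i) (hy i) ha hb hab
  exact this

omit hm in
theorem isOpen_cell (n : Fin 3 → ℤ) : IsOpen (Δ.cell η n) := by
  simp only [cell, Set.ofPred_forall]
  refine isOpen_iInter_of_finite fun i => ?_
  exact (isOpen_lt continuous_const (Δ.continuous_coord_apply i)).inter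
    (isOpen_lt (Δ.continuous_coord_apply i) continuous_const)

omit hm in
theorem isClosed_closedCell (n : Fin 3 → ℤ) : IsClosed (Δ.closedCell η n) := by
  simp only [closedCell, Set.ofPred_forall]
  refine isClosed_iInter fun i => ?_
  exact (isClosed_le continuous_const (Δ.continuous_coord_apply i)).inter
    (isClosed_le (Δ.continuous_coord_apply i) continuous_const)

omit hm in
-- A point of the closed polygon is the limit of points on the segment to an interior point. Without
-- an interior point this fails: the three closed strips may meet only in their boundaries.
theorem closure_cell {n : Fin 3 → ℤ} (hne : (Δ.cell η n).Nonempty) :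
    closure (Δ.cell η n) = Δ.closedCell η n := by
  apply subset_antisymm
  · exact closure_minimal (fun x hx i => ⟨(hx i).1.le, (hx i).2.le⟩) (Δ.isClosed_closedCell n)
  · intro x hx
    obtain ⟨z, hz⟩ := hne
    have hf : Continuous fun t : ℝ => (1 - t) • x + t • z := by fun_prop
    have ht : Filter.Tendsto (fun t : ℝ => (1 - t) • x + t • z) (nhdsWithin 0 (Set.Ioo 0 1))
        (nhds x) := by
      have := hf.tendsto 0
      simp only [sub_zero, one_smul, zero_smul, add_zero] at this
      exact this.mono_left nhdsWithin_le_nhds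
    have : (nhdsWithin (0 : ℝ) (Set.Ioo 0 1)).NeBot := by
      rw [← mem_closure_iff_nhdsWithin_neBot, closure_Ioo zero_ne_one]
      simp
    refine mem_closure_of_tendsto ht ?_
    filter_upwards [self_mem_nhdsWithin] with t ht i
    simp only [map_add, map_smul, Pi.add_apply, Pi.smul_apply, smul_eq_mul]
    obtain ⟨h1, h2⟩ := hx i
    obtain ⟨h3, h4⟩ := hz i
    have ht0 := ht.1
    have ht1 : 0 < 1 - t := by linarith [ht.2]
    constructor <;> nlinarith

omit hm in
theorem frontier_cell {n : Fin 3 → ℤ} (hne : (Δ.cell η n).Nonempty) :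
    frontier (Δ.cell η n) = Δ.closedCell η n \ Δ.cell η n := by
  rw [frontier, Δ.closure_cell hne, (Δ.isOpen_cell n).interior_eq]

theorem exists_mem_cell (h : Δ.Enumerates η c) {x : ℝ × ℝ}
    (hx : x ∈ (⋃ e, (Δ.arrangement c e).preimage)ᶜ) : ∃ n, x ∈ Δ.cell η n := by
  rw [Set.mem_compl_iff, Δ.mem_iUnion_preimage_iff h] at hx
  push Not at hx
  choose n hn1 hn2 using fun i => Δ.exists_level_le_lt hm i (Δ.coord x i)
  exact ⟨n, fun i => ⟨lt_of_le_of_ne (hn1 i) (hx i _).symm, hn2 i⟩⟩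

theorem cell_subset_compl (h : Δ.Enumerates η c) (n : Fin 3 → ℤ) :
    Δ.cell η n ⊆ (⋃ e, (Δ.arrangement c e).preimage)ᶜ := by
  intro x hx
  rw [Set.mem_compl_iff, Δ.mem_iUnion_preimage_iff h]
  rintro ⟨i, m, hi⟩
  obtain ⟨h1, h2⟩ := hx i
  rw [hi] at h1 h2
  have h1' := (hm i).lt_iff_lt.1 h1
  have h2' := (hm i).lt_iff_lt.1 h2
  omega

/-- The open polygon is convex, hence contained in the component. Conversely, each coordinate maps
the component to an interval that avoids all levels, so it stays between two consecutive ones. -/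
theorem connectedComponentIn_eq_cell (h : Δ.Enumerates η c) {n : Fin 3 → ℤ} {x : ℝ × ℝ}
    (hx : x ∈ Δ.cell η n) :
    connectedComponentIn (⋃ e, (Δ.arrangement c e).preimage)ᶜ x = Δ.cell η n := by
  have hsub := Δ.cell_subset_compl hm h n
  apply subset_antisymm
  · have hpre : ∀ i, ((fun z => Δ.coord z i) ''
        connectedComponentIn (⋃ e, (Δ.arrangement c e).preimage)ᶜ x).OrdConnected := fun i =>
      (isPreconnected_connectedComponentIn.image _
        (Δ.continuous_coord_apply i).continuousOn).ordConnected
    have hxm := mem_connectedComponentIn (hsub hx)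
    intro z hz i
    have hno : ∀ m, Δ.level η i m ∉ (fun z => Δ.coord z i) ''
        connectedComponentIn (⋃ e, (Δ.arrangement c e).preimage)ᶜ x := by
      rintro m ⟨w, hw, hwm⟩
      exact connectedComponentIn_subset _ _ hw
        ((Δ.mem_iUnion_preimage_iff h w).2 ⟨i, m, hwm⟩)
    constructor
    · by_contra! hlt
      exact hno _ ((hpre i).out ⟨z, hz, rfl⟩ ⟨x, hxm, rfl⟩ ⟨hlt, (hx i).1.le⟩)
    · by_contra! hlt
      exact hno _ ((hpre i).out ⟨x, hxm, rfl⟩ ⟨z, hz, rfl⟩ ⟨(hx i).2.le, hlt⟩)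
  · exact (Δ.convex_cell n).isPreconnected.subset_connectedComponentIn hx hsub

theorem isCell_iff (h : Δ.Enumerates η c) (C : Set (ℝ × ℝ)) :
    IsCell (Δ.arrangement c) C ↔ ∃ n, (Δ.cell η n).Nonempty ∧ C = Δ.cell η n := by
  constructor
  · rintro ⟨x, hx, rfl⟩
    obtain ⟨n, hn⟩ := Δ.exists_mem_cell hm h hx
    exact ⟨n, ⟨x, hn⟩, Δ.connectedComponentIn_eq_cell hm h hn⟩
  · rintro ⟨n, ⟨x, hx⟩, rfl⟩
    exact ⟨x, Δ.cell_subset_compl hm h n hx, (Δ.connectedComponentIn_eq_cell hm h hx).symm⟩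

omit hm in
theorem isEdgeOf_iff (h : Δ.Enumerates η c) (C E : Set (ℝ × ℝ)) :
    IsEdgeOf (Δ.arrangement c) C E ↔
      ∃ i n, E = frontier C ∩ {x | Δ.coord x i = Δ.level η i n} ∧ E.Nonempty :=
  Δ.exists_isLift_iff h (P := fun K => E = frontier C ∩ K ∧ E.Nonempty)

omit hm in
theorem forall_isLift_iff (h : Δ.Enumerates η c) {P : Fin 3 → ℝ → Prop} :
    (∀ e s, (Δ.arrangement c e).IsLift s → P e.1 (Δ.latticeLength e.1 * s)) ↔
      ∀ i n, P i (Δ.level η i n) := by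
  constructor
  · intro H i n
    have hl := Δ.latticeLength_pos_real i
    obtain ⟨k, hk⟩ := (h i (Δ.level η i n / Δ.latticeLength i)).2
      ⟨n, mul_div_cancel₀ _ hl.ne'⟩
    have := H ⟨i, k⟩ _ hk
    rwa [mul_div_cancel₀ _ hl.ne'] at this
  · rintro H ⟨i, k⟩ s hs
    obtain ⟨n, hn⟩ := (h i s).1 ⟨k, hs⟩
    dsimp only
    rw [hn]
    exact H i n

omit hm in
theorem level_arrangement (c : Δ.Edge → UnitAddCircle) (e : Δ.Edge) (s : ℝ) :
    (Δ.arrangement c e).level s = {x | Δ.coord x e.1 = Δ.latticeLength e.1 * s} := by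
  have hl := Δ.latticeLength_pos_real e.1
  ext x
  change (Δ.arrangement c e).height x = s ↔ Δ.coord x e.1 = _
  rw [← Δ.latticeLength_mul_height c e x, mul_right_inj' hl.ne']

omit hm in
theorem isWhite_iff (h : Δ.Enumerates η c) (C : Set (ℝ × ℝ)) :
    IsWhite (Δ.arrangement c) C ↔ IsCell (Δ.arrangement c) C ∧
      ∀ i n, (frontier C ∩ {x | Δ.coord x i = Δ.level η i n}).Nonempty →
        ∀ x ∈ C, Δ.level η i n < Δ.coord x i := by
  refine and_congr_right fun _ => ?_
  rw [← Δ.forall_isLift_iff h (P := fun i r => (frontier C ∩ {x | Δ.coord x i = r}).Nonempty →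
        ∀ x ∈ C, r < Δ.coord x i)]
  refine forall_congr' fun e => forall_congr' fun s => ?_
  have hl := Δ.latticeLength_pos_real e.1
  simp only [level_arrangement, ← Δ.latticeLength_mul_height c e, mul_lt_mul_iff_right₀ hl]

omit hm in
theorem isBlack_iff (h : Δ.Enumerates η c) (C : Set (ℝ × ℝ)) :
    IsBlack (Δ.arrangement c) C ↔ IsCell (Δ.arrangement c) C ∧
      ∀ i n, (frontier C ∩ {x | Δ.coord x i = Δ.level η i n}).Nonempty →
        ∀ x ∈ C, Δ.coord x i < Δ.level η i n := by
  refine and_congr_right fun _ => ?_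
  rw [← Δ.forall_isLift_iff h (P := fun i r => (frontier C ∩ {x | Δ.coord x i = r}).Nonempty →
        ∀ x ∈ C, Δ.coord x i < r)]
  refine forall_congr' fun e => forall_congr' fun s => ?_
  have hl := Δ.latticeLength_pos_real e.1
  simp only [level_arrangement, ← Δ.latticeLength_mul_height c e, mul_lt_mul_iff_right₀ hl]

end LatticeTriangle

namespace LatticeTriangle

/-! ### Arrangements in the pattern of equidistant lines -/

variable (Δ : LatticeTriangle) {η : Δ.Edge → ℝ} {c : Δ.Edge → UnitAddCircle}

/-- The sum of the levels of three lines, one in each direction. -/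
def levelSum (η : Δ.Edge → ℝ) (n : Fin 3 → ℤ) : ℝ :=
  Δ.level η 0 (n 0) + Δ.level η 1 (n 1) + Δ.level η 2 (n 2)

/-- The deviations `η` for which the lines form triangles in the same pattern as
equidistant lines. -/
def IsGood (η : Δ.Edge → ℝ) : Prop :=
  ∀ n : Fin 3 → ℤ, (n 0 + n 1 + n 2 = 0 → Δ.levelSum η n < 0) ∧
    (n 0 + n 1 + n 2 = 1 → 0 < Δ.levelSum η n)

variable {Δ}

/-- Raising one index takes the index sum from 0 to 1 and the sum of levels from negative to
positive, while the other two levels stay fixed. -/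
theorem IsGood.strictMono (hη : Δ.IsGood η) (i : Fin 3) : StrictMono (Δ.level η i) := by
  refine strictMono_int_of_lt_succ fun k => ?_
  fin_cases i
  · have h1 := (hη ![k, -k, 0]).1 (by simp)
    have h2 := (hη ![k + 1, -k, 0]).2 (by simp)
    simp only [levelSum, Matrix.cons_val] at h1 h2
    change Δ.level η 0 k < Δ.level η 0 (k + 1)
    linarith
  · have h1 := (hη ![-k, k, 0]).1 (by simp)
    have h2 := (hη ![-k, k + 1, 0]).2 (by simp)
    simp only [levelSum, Matrix.cons_val] at h1 h2
    change Δ.level η 1 k < Δ.level η 1 (k + 1)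
    linarith
  · have h1 := (hη ![-k, 0, k]).1 (by simp)
    have h2 := (hη ![-k, 0, k + 1]).2 (by simp)
    simp only [levelSum, Matrix.cons_val] at h1 h2
    change Δ.level η 2 k < Δ.level η 2 (k + 1)
    linarith

theorem IsGood.levelSum_neg (hη : Δ.IsGood η) (a b d : ℤ) (h : a + b + d ≤ 0) :
    Δ.level η 0 a + Δ.level η 1 b + Δ.level η 2 d < 0 := by
  have h1 := (hη ![a, b, -a - b]).1 (by simp only [Matrix.cons_val]; ring)
  simp only [levelSum, Matrix.cons_val] at h1
  have h2 := (hη.strictMono 2).monotone (show d ≤ -a - b by omega)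
  linarith

theorem IsGood.levelSum_pos (hη : Δ.IsGood η) (a b d : ℤ) (h : 1 ≤ a + b + d) :
    0 < Δ.level η 0 a + Δ.level η 1 b + Δ.level η 2 d := by
  have h1 := (hη ![a, b, 1 - a - b]).2 (by simp only [Matrix.cons_val]; ring)
  simp only [levelSum, Matrix.cons_val] at h1
  have h2 := (hη.strictMono 2).monotone (show 1 - a - b ≤ d by omega)
  linarith

variable (Δ)

/-- The triangle to the left of three lines. -/
def whiteCell (η : Δ.Edge → ℝ) (n : Fin 3 → ℤ) : Set (ℝ × ℝ) :=
  {x | ∀ i, Δ.level η i (n i) < Δ.coord x i}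

/-- The triangle to the right of three lines. -/
def blackCell (η : Δ.Edge → ℝ) (n : Fin 3 → ℤ) : Set (ℝ × ℝ) :=
  {x | ∀ i, Δ.coord x i < Δ.level η i (n i)}

variable {Δ}

/-- The three upper bounds are redundant: a point left of the three lines that reached the next line
in one direction would have coordinates of positive sum. -/
theorem IsGood.cell_eq_whiteCell (hη : Δ.IsGood η) {n : Fin 3 → ℤ}
    (hn : n 0 + n 1 + n 2 = 0) : Δ.cell η n = Δ.whiteCell η n := by
  refine subset_antisymm (fun x hx i => (hx i).1) fun x hx i => ⟨hx i, ?_⟩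
  have hs := Δ.coord_sum x
  have h0 := hx 0
  have h1 := hx 1
  have h2 := hx 2
  fin_cases i
  · change Δ.coord x 0 < Δ.level η 0 (n 0 + 1)
    have := hη.levelSum_pos (n 0 + 1) (n 1) (n 2) (by omega)
    linarith
  · change Δ.coord x 1 < Δ.level η 1 (n 1 + 1)
    have := hη.levelSum_pos (n 0) (n 1 + 1) (n 2) (by omega)
    linarith
  · change Δ.coord x 2 < Δ.level η 2 (n 2 + 1)
    have := hη.levelSum_pos (n 0) (n 1) (n 2 + 1) (by omega)
    linarith

/-- Dual to the white case. A cell is indexed by its lower lines and a black triangle by its upper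
ones, whence the shift by one. -/
theorem IsGood.cell_eq_blackCell (hη : Δ.IsGood η) {n : Fin 3 → ℤ}
    (hn : n 0 + n 1 + n 2 = 1) : Δ.cell η (n - 1) = Δ.blackCell η n := by
  refine subset_antisymm (fun x hx i => ?_) fun x hx i => ⟨?_, ?_⟩
  · have := (hx i).2
    rwa [Pi.sub_apply, Pi.one_apply, sub_add_cancel] at this
  · have hs := Δ.coord_sum x
    have h0 := hx 0
    have h1 := hx 1
    have h2 := hx 2
    rw [Pi.sub_apply, Pi.one_apply]
    fin_cases i
    · change Δ.level η 0 (n 0 - 1) < Δ.coord x 0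
      have := hη.levelSum_neg (n 0 - 1) (n 1) (n 2) (by omega)
      linarith
    · change Δ.level η 1 (n 1 - 1) < Δ.coord x 1
      have := hη.levelSum_neg (n 0) (n 1 - 1) (n 2) (by omega)
      linarith
    · change Δ.level η 2 (n 2 - 1) < Δ.coord x 2
      have := hη.levelSum_neg (n 0) (n 1) (n 2 - 1) (by omega)
      linarith
  · rw [Pi.sub_apply, Pi.one_apply, sub_add_cancel]
    exact hx i

variable (Δ)

/-- The point with coordinates obtained from the levels by projection along the diagonal. It is the
centroid of the triangle formed by the three lines. -/
def node (η : Δ.Edge → ℝ) (n : Fin 3 → ℤ) : ℝ × ℝ :=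
  Δ.recon fun i => Δ.level η i (n i) - Δ.levelSum η n / 3

theorem coord_node (η : Δ.Edge → ℝ) (n : Fin 3 → ℤ) (i : Fin 3) :
    Δ.coord (Δ.node η n) i = Δ.level η i (n i) - Δ.levelSum η n / 3 := by
  unfold node
  rw [Δ.coord_recon _ (by unfold levelSum; ring)]

variable {Δ}

theorem IsGood.node_mem_whiteCell (hη : Δ.IsGood η) {n : Fin 3 → ℤ}
    (hn : n 0 + n 1 + n 2 = 0) : Δ.node η n ∈ Δ.whiteCell η n := fun i => by
  rw [coord_node]
  linarith [(hη n).1 hn]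

theorem IsGood.node_mem_blackCell (hη : Δ.IsGood η) {n : Fin 3 → ℤ}
    (hn : n 0 + n 1 + n 2 = 1) : Δ.node η n ∈ Δ.blackCell η n := fun i => by
  rw [coord_node]
  linarith [(hη n).2 hn]

/-- The coordinates of a point have sum zero, so the lower levels of its cell have negative sum and
the upper levels positive sum. The three values belong to white triangles, uncolored cells and black
triangles, in this order. -/
theorem IsGood.index_sum_of_nonempty (hη : Δ.IsGood η) {n : Fin 3 → ℤ}
    (hne : (Δ.cell η n).Nonempty) :
    n 0 + n 1 + n 2 = 0 ∨ n 0 + n 1 + n 2 = -1 ∨ n 0 + n 1 + n 2 = -2 := by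
  obtain ⟨x, hx⟩ := hne
  have hs := Δ.coord_sum x
  by_contra! h
  rcases lt_or_ge 0 (n 0 + n 1 + n 2) with h0 | h0
  · have := hη.levelSum_pos (n 0) (n 1) (n 2) (by omega)
    linarith [(hx 0).1, (hx 1).1, (hx 2).1]
  · have := hη.levelSum_neg (n 0 + 1) (n 1 + 1) (n 2 + 1) (by omega)
    linarith [(hx 0).2, (hx 1).2, (hx 2).2]

variable (Δ) in
theorem mem_frontier_cell (hm : ∀ i, StrictMono (Δ.level η i)) {n : Fin 3 → ℤ}
    (hne : (Δ.cell η n).Nonempty) {x : ℝ × ℝ} (hx : x ∈ Δ.closedCell η n) {i : Fin 3} {m : ℤ}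
    (hi : Δ.coord x i = Δ.level η i m) : x ∈ frontier (Δ.cell η n) := by
  rw [Δ.frontier_cell hne]
  refine ⟨hx, fun hx' => ?_⟩
  obtain ⟨h1, h2⟩ := hx' i
  rw [hi] at h1 h2
  have h1' := (hm i).lt_iff_lt.1 h1
  have h2' := (hm i).lt_iff_lt.1 h2
  omega

/-- The intersection point of lines in the first two directions. -/
theorem IsGood.exists_mem_closedCell (hη : Δ.IsGood η) {n : Fin 3 → ℤ} {a b : ℤ}
    (ha : n 0 ≤ a) (ha' : a ≤ n 0 + 1) (hb : n 1 ≤ b) (hb' : b ≤ n 1 + 1)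
    (hab : a + b + n 2 = 0) :
    ∃ x ∈ Δ.closedCell η n, Δ.coord x 0 = Δ.level η 0 a ∧ Δ.coord x 1 = Δ.level η 1 b := by
  obtain ⟨x, hx⟩ := Δ.exists_coord_eq ![Δ.level η 0 a, Δ.level η 1 b,
    -Δ.level η 0 a - Δ.level η 1 b] (by simp only [Matrix.cons_val]; ring)
  have h0 : Δ.coord x 0 = Δ.level η 0 a := by rw [hx]; rfl
  have h1 : Δ.coord x 1 = Δ.level η 1 b := by rw [hx]; rfl
  have h2 : Δ.coord x 2 = -Δ.level η 0 a - Δ.level η 1 b := by rw [hx]; rfl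
  refine ⟨x, fun i => ?_, h0, h1⟩
  fin_cases i
  · change Δ.level η 0 (n 0) ≤ Δ.coord x 0 ∧ Δ.coord x 0 ≤ Δ.level η 0 (n 0 + 1)
    rw [h0]
    exact ⟨(hη.strictMono 0).monotone ha, (hη.strictMono 0).monotone ha'⟩
  · change Δ.level η 1 (n 1) ≤ Δ.coord x 1 ∧ Δ.coord x 1 ≤ Δ.level η 1 (n 1 + 1)
    rw [h1]
    exact ⟨(hη.strictMono 1).monotone hb, (hη.strictMono 1).monotone hb'⟩
  · change Δ.level η 2 (n 2) ≤ Δ.coord x 2 ∧ Δ.coord x 2 ≤ Δ.level η 2 (n 2 + 1)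
    rw [h2]
    have h3 := hη.levelSum_neg a b (n 2) (by omega)
    have h4 := hη.levelSum_pos a b (n 2 + 1) (by omega)
    constructor <;> linarith

/-- A white cell cannot touch an upper line. For index sums -1 and -2 a vertex of the cell on the
upper line of direction 0 can be exhibited, which leaves index sum 0. -/
theorem IsGood.isWhite_iff (hη : Δ.IsGood η) (h : Δ.Enumerates η c) (C : Set (ℝ × ℝ)) :
    IsWhite (Δ.arrangement c) C ↔
      ∃ n : Fin 3 → ℤ, n 0 + n 1 + n 2 = 0 ∧ C = Δ.whiteCell η n := by
  have hm := hη.strictMono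
  rw [Δ.isWhite_iff h, Δ.isCell_iff hm h]
  constructor
  · rintro ⟨⟨n, hne, rfl⟩, hw⟩
    have key : ∀ b, n 1 ≤ b → b ≤ n 1 + 1 → n 0 + 1 + b + n 2 = 0 → False := by
      intro b hb hb' hs
      obtain ⟨x, hx, h0, -⟩ := hη.exists_mem_closedCell (n := n) (a := n 0 + 1) (b := b)
        (by omega) le_rfl hb hb' hs
      obtain ⟨z, hz⟩ := hne
      have := hw 0 (n 0 + 1) ⟨x, Δ.mem_frontier_cell hm ⟨z, hz⟩ hx h0, h0⟩ z hz
      exact lt_asymm this (hz 0).2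
    rcases hη.index_sum_of_nonempty hne with hs | hs | hs
    · exact ⟨n, hs, hη.cell_eq_whiteCell hs⟩
    · exact (key (n 1) le_rfl (by omega) (by omega)).elim
    · exact (key (n 1 + 1) (by omega) le_rfl (by omega)).elim
  · rintro ⟨n, hs, rfl⟩
    rw [← hη.cell_eq_whiteCell hs]
    have hne : (Δ.cell η n).Nonempty := by
      rw [hη.cell_eq_whiteCell hs]
      exact ⟨_, hη.node_mem_whiteCell hs⟩
    refine ⟨⟨n, hne, rfl⟩, ?_⟩
    rintro i m ⟨z, hz, hzi⟩ x hx
    rw [Δ.frontier_cell hne] at hz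
    have hzi' : Δ.coord z i = Δ.level η i m := hzi
    -- Even the closure of the triangle stays strictly below the next line in each direction, so
    -- every line that it touches has index at most `n i`.
    have hlt : Δ.coord z i < Δ.level η i (n i + 1) := by
      have hs' := Δ.coord_sum z
      have h0 := (hz.1 0).1
      have h1 := (hz.1 1).1
      have h2 := (hz.1 2).1
      fin_cases i
      · have := hη.levelSum_pos (n 0 + 1) (n 1) (n 2) (by omega)
        change Δ.coord z 0 < Δ.level η 0 (n 0 + 1)
        linarith
      · have := hη.levelSum_pos (n 0) (n 1 + 1) (n 2) (by omega)
        change Δ.coord z 1 < Δ.level η 1 (n 1 + 1)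
        linarith
      · have := hη.levelSum_pos (n 0) (n 1) (n 2 + 1) (by omega)
        change Δ.coord z 2 < Δ.level η 2 (n 2 + 1)
        linarith
    rw [hzi', (hm i).lt_iff_lt, Int.lt_add_one_iff] at hlt
    exact ((hm i).monotone hlt).trans_lt (hx i).1

theorem IsGood.isBlack_iff (hη : Δ.IsGood η) (h : Δ.Enumerates η c) (C : Set (ℝ × ℝ)) :
    IsBlack (Δ.arrangement c) C ↔
      ∃ n : Fin 3 → ℤ, n 0 + n 1 + n 2 = 1 ∧ C = Δ.blackCell η n := by
  have hm := hη.strictMono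
  rw [Δ.isBlack_iff h, Δ.isCell_iff hm h]
  constructor
  · rintro ⟨⟨n, hne, rfl⟩, hw⟩
    have key : ∀ a, n 0 ≤ a → a ≤ n 0 + 1 → a + n 1 + n 2 = 0 → False := by
      intro a ha ha' hs
      obtain ⟨x, hx, -, h1⟩ := hη.exists_mem_closedCell (n := n) (a := a) (b := n 1)
        ha ha' le_rfl (by omega) hs
      obtain ⟨z, hz⟩ := hne
      have := hw 1 (n 1) ⟨x, Δ.mem_frontier_cell hm ⟨z, hz⟩ hx h1, h1⟩ z hz
      exact lt_asymm this (hz 1).1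
    rcases hη.index_sum_of_nonempty hne with hs | hs | hs
    · exact (key (n 0) le_rfl (by omega) (by omega)).elim
    · exact (key (n 0 + 1) (by omega) le_rfl (by omega)).elim
    · have hs' : (n + 1) 0 + (n + 1) 1 + (n + 1) 2 = 1 := by
        simp only [Pi.add_apply, Pi.one_apply]; omega
      refine ⟨n + 1, hs', ?_⟩
      rw [← hη.cell_eq_blackCell hs', add_sub_cancel_right]
  · rintro ⟨n, hs, rfl⟩
    rw [← hη.cell_eq_blackCell hs]
    have hne : (Δ.cell η (n - 1)).Nonempty := by
      rw [hη.cell_eq_blackCell hs]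
      exact ⟨_, hη.node_mem_blackCell hs⟩
    refine ⟨⟨n - 1, hne, rfl⟩, ?_⟩
    rintro i m ⟨z, hz, hzi⟩ x hx
    rw [Δ.frontier_cell hne] at hz
    have hzi' : Δ.coord z i = Δ.level η i m := hzi
    have hle : ∀ i, Δ.coord z i ≤ Δ.level η i (n i) := fun i => by
      have := (hz.1 i).2
      rwa [Pi.sub_apply, Pi.one_apply, sub_add_cancel] at this
    have hlt : Δ.level η i (n i - 1) < Δ.coord z i := by
      have hs' := Δ.coord_sum z
      have h0 := hle 0
      have h1 := hle 1
      have h2 := hle 2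
      fin_cases i
      · have := hη.levelSum_neg (n 0 - 1) (n 1) (n 2) (by omega)
        change Δ.level η 0 (n 0 - 1) < Δ.coord z 0
        linarith
      · have := hη.levelSum_neg (n 0) (n 1 - 1) (n 2) (by omega)
        change Δ.level η 1 (n 1 - 1) < Δ.coord z 1
        linarith
      · have := hη.levelSum_neg (n 0) (n 1) (n 2 - 1) (by omega)
        change Δ.level η 2 (n 2 - 1) < Δ.coord z 2
        linarith
    rw [hzi', (hm i).lt_iff_lt] at hlt
    have h3 := (hx i).2
    rw [Pi.sub_apply, Pi.one_apply, sub_add_cancel] at h3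
    exact h3.trans_le ((hm i).monotone (by omega))

/-- Only the edges of a cell of index sum -1 need an argument. Across a lower line the index sum of
the neighbor is -2, so it is a black triangle; across an upper line it is 0, so it is a white one.
-/
theorem IsGood.isAdmissible (hη : Δ.IsGood η) (h : Δ.Enumerates η c) :
    IsAdmissible (Δ.arrangement c) := by
  have hm := hη.strictMono
  intro C E hC hE
  rw [Δ.isCell_iff hm h] at hC
  obtain ⟨n, hne, rfl⟩ := hC
  have hE' := hE
  rw [Δ.isEdgeOf_iff h] at hE'
  obtain ⟨i, m, hEeq, hEne⟩ := hE'
  rcases hη.index_sum_of_nonempty hne with hs | hs | hs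
  · exact ⟨_, Or.inl ((hη.isWhite_iff h _).2 ⟨n, hs, hη.cell_eq_whiteCell hs⟩), hE⟩
  · have hfr : ∀ n' : Fin 3 → ℤ, (∀ j, j ≠ i → n' j = n j) → (Δ.cell η n').Nonempty →
        (n' i = m ∨ n' i + 1 = m) → (n i = m ∨ n i + 1 = m) →
        IsEdgeOf (Δ.arrangement c) (Δ.cell η n') E := by
      intro n' hj hne' hi' hi
      rw [Δ.isEdgeOf_iff h]
      refine ⟨i, m, ?_, hEne⟩
      rw [hEeq]
      -- The part of the boundary on a bounding line of direction `i` depends only on the other two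
      -- indices, which the two neighbors share.
      have aux : ∀ p : Fin 3 → ℤ, (Δ.cell η p).Nonempty → (p i = m ∨ p i + 1 = m) →
          frontier (Δ.cell η p) ∩ {x | Δ.coord x i = Δ.level η i m} =
            {x | Δ.coord x i = Δ.level η i m ∧ ∀ j, j ≠ i →
              Δ.level η j (p j) ≤ Δ.coord x j ∧ Δ.coord x j ≤ Δ.level η j (p j + 1)} := by
        intro p hp hpi
        ext x
        constructor
        · rintro ⟨hx, hxi⟩
          rw [Δ.frontier_cell hp] at hx
          exact ⟨hxi, fun j _ => hx.1 j⟩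
        · rintro ⟨hxi, hx⟩
          refine ⟨Δ.mem_frontier_cell hm hp (fun j => ?_) hxi, hxi⟩
          by_cases hji : j = i
          · subst hji
            rw [hxi, (hm j).le_iff_le, (hm j).le_iff_le]
            omega
          · exact hx j hji
      rw [aux n hne hi, aux n' hne' hi']
      ext x
      refine and_congr_right fun _ => forall_congr' fun j => forall_congr' fun hji => ?_
      rw [hj j hji]
    have hmem : n i = m ∨ n i + 1 = m := by
      rw [hEeq] at hEne
      obtain ⟨x, hx, hxi⟩ := hEne
      rw [Δ.frontier_cell hne] at hx
      have hxi' : Δ.coord x i = Δ.level η i m := hxi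
      have := hx.1 i
      rw [hxi', (hm i).le_iff_le, (hm i).le_iff_le] at this
      omega
    have hsum : ∀ v, Function.update n i v 0 + Function.update n i v 1 + Function.update n i v 2 =
        n 0 + n 1 + n 2 - n i + v := by
      intro v
      fin_cases i <;> simp [Function.update] <;> ring
    rcases hmem with hi | hi
    · have hs2 := hsum (n i - 1)
      obtain ⟨q, hq⟩ : ∃ q, q = Function.update n i (n i - 1) := ⟨_, rfl⟩
      rw [← hq] at hs2
      have hb : (q + 1) 0 + (q + 1) 1 + (q + 1) 2 = 1 := by
        simp only [Pi.add_apply, Pi.one_apply]; omega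
      have hcell := hη.cell_eq_blackCell hb
      rw [add_sub_cancel_right] at hcell
      refine ⟨_, Or.inr ((hη.isBlack_iff h _).2 ⟨_, hb, hcell⟩), hfr q ?_ ?_ ?_ (Or.inl hi)⟩
      · intro j hj; rw [hq, Function.update_of_ne hj]
      · rw [hcell]; exact ⟨_, hη.node_mem_blackCell hb⟩
      · right; rw [hq, Function.update_self]; omega
    · have hs2 := hsum (n i + 1)
      obtain ⟨q, hq⟩ : ∃ q, q = Function.update n i (n i + 1) := ⟨_, rfl⟩
      rw [← hq] at hs2
      have hb : q 0 + q 1 + q 2 = 0 := by omega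
      have hcell := hη.cell_eq_whiteCell hb
      refine ⟨_, Or.inl ((hη.isWhite_iff h _).2 ⟨_, hb, hcell⟩), hfr q ?_ ?_ ?_ (Or.inr hi)⟩
      · intro j hj; rw [hq, Function.update_of_ne hj]
      · rw [hcell]; exact ⟨_, hη.node_mem_whiteCell hb⟩
      · left; rw [hq, Function.update_self]; omega
  · have hs' : (n + 1) 0 + (n + 1) 1 + (n + 1) 2 = 1 := by
      simp only [Pi.add_apply, Pi.one_apply]; omega
    refine ⟨_, Or.inr ((hη.isBlack_iff h _).2 ⟨n + 1, hs', ?_⟩), hE⟩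
    rw [← hη.cell_eq_blackCell hs', add_sub_cancel_right]

/-- Different lines through one point have different directions, so a triple point lies on one line
of each direction and yields three levels of sum zero. For good deviations no such sum vanishes. -/
theorem IsGood.isSimple (hη : Δ.IsGood η) : IsSimple (Δ.arrangement (Δ.position η)) := by
  have hm := hη.strictMono
  have hmem : ∀ (e : Δ.Edge) (x : ℝ × ℝ), x ∈ (Δ.arrangement (Δ.position η) e).preimage →
      ∃ n, Δ.residue e.1 n = e.2 ∧ Δ.coord x e.1 = Δ.level η e.1 n := by
    rintro ⟨i, k⟩ x hx
    rw [mem_preimage_iff, coe_eq_position_iff] at hx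
    simpa only [mul_div_cancel₀ _ (Δ.latticeLength_pos_real i).ne'] using hx
  have hne : ∀ (e f : Δ.Edge) (x : ℝ × ℝ), e ≠ f →
      x ∈ (Δ.arrangement (Δ.position η) e).preimage →
      x ∈ (Δ.arrangement (Δ.position η) f).preimage → e.1 ≠ f.1 := by
    rintro ⟨i, k⟩ ⟨j, l⟩ x hef he hf hij
    dsimp only at hij
    subst hij
    obtain ⟨n, hn, hxn⟩ := hmem _ _ he
    obtain ⟨p, hp, hxp⟩ := hmem _ _ hf
    dsimp only at hn hxn hp hxp
    have := (hm i).injective (hxn.symm.trans hxp)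
    apply hef
    rw [← hn, ← hp, this]
  intro e f g hef hfg heg
  rw [Set.eq_empty_iff_forall_notMem]
  rintro x ⟨⟨he, hf⟩, hg⟩
  have hall : ∀ a b d : Fin 3, a ≠ b → b ≠ d → a ≠ d → ∀ i, i = a ∨ i = b ∨ i = d := by decide
  have hex : ∀ i, ∃ n, Δ.coord x i = Δ.level η i n := by
    intro i
    rcases hall _ _ _ (hne _ _ _ hef he hf) (hne _ _ _ hfg hf hg) (hne _ _ _ heg he hg) i with
      rfl | rfl | rfl
    · exact (hmem _ _ he).imp fun n hn => hn.2
    · exact (hmem _ _ hf).imp fun n hn => hn.2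
    · exact (hmem _ _ hg).imp fun n hn => hn.2
  choose n hn using hex
  have hs := Δ.coord_sum x
  rw [hn, hn, hn] at hs
  rcases le_or_gt (n 0 + n 1 + n 2) 0 with h | h
  · exact (hη.levelSum_neg _ _ _ h).ne hs
  · exact (hη.levelSum_pos _ _ _ h).ne' hs

end LatticeTriangle

namespace LatticeTriangle

/-! ### The pattern of an admissible simple arrangement -/

variable {Δ : LatticeTriangle} {η : Δ.Edge → ℝ} {c : Δ.Edge → UnitAddCircle}

/-- Parallel lines of a simple arrangement are different. -/
theorem offset_injective_of_isSimple (h : IsSimple (Δ.arrangement c)) (i : Fin 3) :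
    Function.Injective fun k => c ⟨i, k⟩ := by
  intro k k' hk
  by_contra hne
  dsimp only at hk
  have hij : i ≠ i + 1 := by fin_cases i <;> decide
  -- Two coinciding lines and any line of another direction have a point in common, which would be a
  -- triple point.
  obtain ⟨r, hr⟩ := QuotientAddGroup.mk_surjective (c ⟨i, k⟩)
  obtain ⟨r', hr'⟩ := QuotientAddGroup.mk_surjective (c ⟨i + 1, ⟨0, Δ.latticeLength_pos _⟩⟩)
  obtain ⟨x, hx, hx'⟩ := Δ.exists_coord_pair hij (Δ.latticeLength i * r)
    (Δ.latticeLength (i + 1) * r')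
  have hl := Δ.latticeLength_pos_real i
  have hl' := Δ.latticeLength_pos_real (i + 1)
  have := h ⟨i, k⟩ ⟨i, k'⟩ ⟨i + 1, ⟨0, Δ.latticeLength_pos _⟩⟩ (by simpa using hne)
    (fun h => hij (congrArg Sigma.fst h)) (fun h => hij (congrArg Sigma.fst h))
  rw [Set.eq_empty_iff_forall_notMem] at this
  apply this x
  refine ⟨⟨?_, ?_⟩, ?_⟩
  · rw [mem_preimage_iff]; dsimp only; rw [hx, mul_div_cancel_left₀ _ hl.ne']; exact hr
  · rw [mem_preimage_iff]; dsimp only; rw [hx, mul_div_cancel_left₀ _ hl.ne', ← hk]; exact hr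
  · rw [mem_preimage_iff]; dsimp only; rw [hx', mul_div_cancel_left₀ _ hl'.ne']; exact hr'

/-- Levels of sum zero are the coordinates of a point, and three lines pass through it. -/
theorem levelSum_ne_zero_of_isSimple (hs : IsSimple (Δ.arrangement c)) (h : Δ.Enumerates η c)
    (n : Fin 3 → ℤ) : Δ.levelSum η n ≠ 0 := by
  intro h0
  obtain ⟨x, hx⟩ := Δ.exists_coord_eq (fun i => Δ.level η i (n i)) h0
  have hmem : ∀ i, ∃ k, x ∈ (Δ.arrangement c ⟨i, k⟩).preimage := fun i =>
    (Δ.exists_mem_preimage_iff h i x).2 ⟨n i, by rw [hx]⟩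
  choose k hk using hmem
  have := hs ⟨0, k 0⟩ ⟨1, k 1⟩ ⟨2, k 2⟩ (fun h => by simpa using congrArg Sigma.fst h)
    (fun h => by simpa using congrArg Sigma.fst h) (fun h => by simpa using congrArg Sigma.fst h)
  rw [Set.eq_empty_iff_forall_notMem] at this
  exact this x ⟨⟨hk 0, hk 1⟩, hk 2⟩

/-- Finitely many different points on the circle are enumerated by an increasing sequence. -/
theorem exists_strictMono_enumerates (hc : ∀ i, Function.Injective fun k => c ⟨i, k⟩) :
    ∃ η : Δ.Edge → ℝ, Δ.Enumerates η c ∧ ∀ i, StrictMono (Δ.level η i) := by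
  have : ∀ i : Fin 3, ∃ r : Fin (Δ.latticeLength i) → ℝ, StrictMono r ∧
      (∀ k, r k ∈ Set.Ico (0 : ℝ) 1) ∧ ∃ σ : Equiv.Perm (Fin (Δ.latticeLength i)),
        ∀ k, (r k : UnitAddCircle) = c ⟨i, σ k⟩ := by
    intro i
    have hrep : ∀ k, ∃ r : ℝ, r ∈ Set.Ico (0 : ℝ) 1 ∧ (r : UnitAddCircle) = c ⟨i, k⟩ := by
      intro k
      obtain ⟨r, hr⟩ := QuotientAddGroup.mk_surjective (c ⟨i, k⟩)
      refine ⟨Int.fract r, ⟨Int.fract_nonneg r, Int.fract_lt_one r⟩, ?_⟩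
      rw [← hr]
      rw [unitAddCircle_coe_eq_coe_iff]
      exact ⟨-⌊r⌋, by rw [Int.fract]; push_cast; ring⟩
    choose r hr hrc using hrep
    have hinj : Function.Injective r := fun k k' h => hc i (by
      dsimp only; rw [← hrc, ← hrc, h])
    refine ⟨r ∘ Tuple.sort r, (Tuple.monotone_sort r).strictMono_of_injective
      (hinj.comp (Tuple.sort r).injective), fun k => hr _, Tuple.sort r, fun k => hrc _⟩
  choose r hmono hr σ hσ using this
  -- The deviation is chosen such that the `n`-th line is the sorted representative at the residue
  -- of `n`, translated by the quotient of `n`.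
  have hlevel : ∀ i n, Δ.level (fun e => Δ.latticeLength e.1 * r e.1 e.2 - (e.2 : ℕ)) i n =
      Δ.latticeLength i * ((n / Δ.latticeLength i : ℤ) + r i (Δ.residue i n)) := by
    intro i n
    have h1 : ((Δ.residue i n : ℕ) : ℝ) = ((n % Δ.latticeLength i : ℤ) : ℝ) := by
      exact_mod_cast Δ.residue_cast i n
    have h2 : (n : ℝ) = ((n % Δ.latticeLength i : ℤ) : ℝ) +
        Δ.latticeLength i * ((n / Δ.latticeLength i : ℤ) : ℝ) := by
      exact_mod_cast (Int.emod_add_mul_ediv n (Δ.latticeLength i)).symm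
    unfold level
    dsimp only
    rw [h1]
    linear_combination h2
  refine ⟨fun e => Δ.latticeLength e.1 * r e.1 e.2 - (e.2 : ℕ), fun i s => ?_,
    fun i n n' hn => ?_⟩
  · have hl := Δ.latticeLength_pos_real i
    simp only [hlevel, mul_right_inj' hl.ne']
    constructor
    · rintro ⟨k, hk⟩
      rw [← (σ i).apply_symm_apply k, ← hσ, unitAddCircle_coe_eq_coe_iff] at hk
      obtain ⟨z, hz⟩ := hk
      refine ⟨((σ i).symm k : ℕ) + Δ.latticeLength i * z, ?_⟩
      rw [residue_add_mul, residue_natCast, hz, Int.add_mul_ediv_left _ _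
        (Δ.latticeLength_pos_int i).ne', Int.ediv_eq_zero_of_lt (by positivity)
        (by exact_mod_cast ((σ i).symm k).2)]
      push_cast
      ring
    · rintro ⟨n, hn⟩
      refine ⟨σ i (Δ.residue i n), ?_⟩
      rw [← hσ, unitAddCircle_coe_eq_coe_iff]
      exact ⟨_, by rw [hn, add_comm]⟩
  · rw [hlevel, hlevel]
    refine mul_lt_mul_of_pos_left ?_ (Δ.latticeLength_pos_real i)
    have hl := Δ.latticeLength_pos_int i
    rcases (Int.ediv_le_ediv hl hn.le).lt_or_eq with h | h
    · have h' : ((n / Δ.latticeLength i : ℤ) : ℝ) + 1 ≤ (n' / Δ.latticeLength i : ℤ) := by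
        exact_mod_cast h
      linarith [(hr i (Δ.residue i n)).2, (hr i (Δ.residue i n')).1]
    · rw [h]
      have : Δ.residue i n < Δ.residue i n' := by
        rw [Fin.lt_def]
        zify
        rw [residue_cast, residue_cast]
        have h1 := Int.emod_add_mul_ediv n (Δ.latticeLength i)
        have h2 := Int.emod_add_mul_ediv n' (Δ.latticeLength i)
        rw [← h] at h2
        omega
      linarith [hmono i this]

/-- If `η` enumerates the lines in increasing order, then the offsets are given by `η` up to a
permutation of parallel lines. -/
theorem exists_perm_of_enumerates (h : Δ.Enumerates η c) (hm : ∀ i, StrictMono (Δ.level η i)) :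
    ∃ σ : Equiv.Perm Δ.Edge, (∀ e, Δ.normal (σ e).1 = Δ.normal e.1) ∧
      c ∘ σ = Δ.position η := by
  have hex : ∀ i (k : Fin (Δ.latticeLength i)), ∃ k', Δ.position η ⟨i, k⟩ = c ⟨i, k'⟩ := by
    intro i k
    obtain ⟨r, hr⟩ := QuotientAddGroup.mk_surjective (Δ.position η ⟨i, k⟩)
    obtain ⟨n, -, hn⟩ := (Δ.coe_eq_position_iff η i k r).1 hr
    exact ((h i r).2 ⟨n, hn⟩).imp fun k' hk' => hr.symm.trans hk'
  choose f hf using hex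
  have hinj : ∀ i, Function.Injective (f i) := by
    intro i k k' hk
    have h1 : Δ.position η ⟨i, k⟩ = Δ.position η ⟨i, k'⟩ := by rw [hf, hf, hk]
    obtain ⟨r, hr⟩ := QuotientAddGroup.mk_surjective (Δ.position η ⟨i, k⟩)
    obtain ⟨n, hn, hn'⟩ := (Δ.coe_eq_position_iff η i k r).1 hr
    obtain ⟨p, hp, hp'⟩ := (Δ.coe_eq_position_iff η i k' r).1 (hr.trans h1)
    rw [← hn, ← hp, (hm i).injective (hn'.symm.trans hp')]
  refine ⟨Equiv.sigmaCongrRight fun i =>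
    Equiv.ofBijective (f i) (Finite.injective_iff_bijective.1 (hinj i)), fun e => rfl, ?_⟩
  ext ⟨i, k⟩
  exact (hf i k).symm

/-- Two numbers in given intervals with given sum. -/
theorem exists_add_eq_of_mem_Icc {a a' b b' s : ℝ} (ha : a ≤ a') (hb : b ≤ b') (h : a + b ≤ s)
    (h' : s ≤ a' + b') : ∃ y ∈ Set.Icc a a', ∃ z ∈ Set.Icc b b', y + z = s := by
  -- The smallest first summand that keeps the second one at most `b'`.
  refine ⟨max a (s - b'), ⟨le_max_left _ _, max_le ha (by linarith)⟩, s - max a (s - b'),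
    ⟨?_, ?_⟩, by ring⟩
  · have := max_le (show a ≤ s - b by linarith) (show s - b' ≤ s - b by linarith)
    linarith
  · have := le_max_right a (s - b')
    linarith

/-- In an admissible arrangement the cell to the left of two lines crossing at a vertex
is a white triangle. -/
theorem isWhite_cell_of_isAdmissible (h : Δ.Enumerates η c) (hm : ∀ i, StrictMono (Δ.level η i))
    (hadm : IsAdmissible (Δ.arrangement c)) {n : Fin 3 → ℤ} (hneg : Δ.levelSum η n < 0)
    (hpos : 0 < Δ.level η 0 (n 0) + Δ.level η 1 (n 1) + Δ.level η 2 (n 2 + 1)) :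
    (Δ.cell η n).Nonempty ∧ IsWhite (Δ.arrangement c) (Δ.cell η n) := by
  unfold levelSum at hneg
  have hstep : ∀ i, Δ.level η i (n i) < Δ.level η i (n i + 1) := fun i => hm i (by omega)
  -- A third of the smallest of the three gaps, so that `2 * ε` still fits into the last one.
  obtain ⟨ε, hε, hε0, hε1, hε2⟩ : ∃ ε > 0, Δ.level η 0 (n 0) + ε < Δ.level η 0 (n 0 + 1) ∧
      Δ.level η 1 (n 1) + ε < Δ.level η 1 (n 1 + 1) ∧
      Δ.level η 0 (n 0) + Δ.level η 1 (n 1) + Δ.level η 2 (n 2) + 2 * ε < 0 := by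
    have h0 := hstep 0
    have h1 := hstep 1
    refine ⟨min (min (Δ.level η 0 (n 0 + 1) - Δ.level η 0 (n 0))
      (Δ.level η 1 (n 1 + 1) - Δ.level η 1 (n 1)))
      (-(Δ.level η 0 (n 0) + Δ.level η 1 (n 1) + Δ.level η 2 (n 2))) / 3, ?_, ?_⟩
    · exact div_pos (lt_min (lt_min (by linarith) (by linarith)) (by linarith)) (by norm_num)
    · have hp : 0 < min (min (Δ.level η 0 (n 0 + 1) - Δ.level η 0 (n 0))
        (Δ.level η 1 (n 1 + 1) - Δ.level η 1 (n 1)))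
        (-(Δ.level η 0 (n 0) + Δ.level η 1 (n 1) + Δ.level η 2 (n 2))) :=
        lt_min (lt_min (by linarith) (by linarith)) (by linarith)
      have e1 := (min_le_left (min (Δ.level η 0 (n 0 + 1) - Δ.level η 0 (n 0))
        (Δ.level η 1 (n 1 + 1) - Δ.level η 1 (n 1)))
        (-(Δ.level η 0 (n 0) + Δ.level η 1 (n 1) + Δ.level η 2 (n 2))))
      have e2 := (min_le_right (min (Δ.level η 0 (n 0 + 1) - Δ.level η 0 (n 0))
        (Δ.level η 1 (n 1 + 1) - Δ.level η 1 (n 1)))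
        (-(Δ.level η 0 (n 0) + Δ.level η 1 (n 1) + Δ.level η 2 (n 2))))
      have e3 := e1.trans (min_le_left _ _)
      have e4 := e1.trans (min_le_right _ _)
      refine ⟨?_, ?_, ?_⟩ <;> linarith
  have hpt : ∀ a b : ℝ, ∃ x, Δ.coord x 0 = a ∧ Δ.coord x 1 = b ∧ Δ.coord x 2 = -a - b :=
    fun a b => (Δ.exists_coord_eq ![a, b, -a - b] (by simp only [Matrix.cons_val]; ring)).imp
      fun x hx => by rw [hx]; exact ⟨rfl, rfl, rfl⟩
  -- `v` is the crossing, `w` a nearby point on the line of direction 0 in the relative interior of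
  -- the edge, and `x` a nearby point inside the cell.
  obtain ⟨v, hv0, hv1, hv2⟩ := hpt (Δ.level η 0 (n 0)) (Δ.level η 1 (n 1))
  obtain ⟨w, hw0, hw1, hw2⟩ := hpt (Δ.level η 0 (n 0)) (Δ.level η 1 (n 1) + ε)
  obtain ⟨x, hx0, hx1, hx2⟩ := hpt (Δ.level η 0 (n 0) + ε) (Δ.level η 1 (n 1) + ε)
  have hx : x ∈ Δ.cell η n := by
    rw [cell, Set.mem_ofPred_eq, Fin.forall_fin_succ, Fin.forall_fin_succ, Fin.forall_fin_one]
    change (Δ.level η 0 (n 0) < Δ.coord x 0 ∧ Δ.coord x 0 < Δ.level η 0 (n 0 + 1)) ∧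
      (Δ.level η 1 (n 1) < Δ.coord x 1 ∧ Δ.coord x 1 < Δ.level η 1 (n 1 + 1)) ∧
      (Δ.level η 2 (n 2) < Δ.coord x 2 ∧ Δ.coord x 2 < Δ.level η 2 (n 2 + 1))
    rw [hx0, hx1, hx2]
    refine ⟨⟨?_, ?_⟩, ⟨?_, ?_⟩, ?_, ?_⟩ <;> linarith
  have hne : (Δ.cell η n).Nonempty := ⟨x, hx⟩
  have hv : v ∈ Δ.closedCell η n := by
    rw [closedCell, Set.mem_ofPred_eq, Fin.forall_fin_succ, Fin.forall_fin_succ,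
      Fin.forall_fin_one]
    change (Δ.level η 0 (n 0) ≤ Δ.coord v 0 ∧ Δ.coord v 0 ≤ Δ.level η 0 (n 0 + 1)) ∧
      (Δ.level η 1 (n 1) ≤ Δ.coord v 1 ∧ Δ.coord v 1 ≤ Δ.level η 1 (n 1 + 1)) ∧
      (Δ.level η 2 (n 2) ≤ Δ.coord v 2 ∧ Δ.coord v 2 ≤ Δ.level η 2 (n 2 + 1))
    rw [hv0, hv1, hv2]
    refine ⟨⟨?_, ?_⟩, ⟨?_, ?_⟩, ?_, ?_⟩ <;> linarith
  have hw : w ∈ Δ.closedCell η n := by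
    rw [closedCell, Set.mem_ofPred_eq, Fin.forall_fin_succ, Fin.forall_fin_succ,
      Fin.forall_fin_one]
    change (Δ.level η 0 (n 0) ≤ Δ.coord w 0 ∧ Δ.coord w 0 ≤ Δ.level η 0 (n 0 + 1)) ∧
      (Δ.level η 1 (n 1) ≤ Δ.coord w 1 ∧ Δ.coord w 1 ≤ Δ.level η 1 (n 1 + 1)) ∧
      (Δ.level η 2 (n 2) ≤ Δ.coord w 2 ∧ Δ.coord w 2 ≤ Δ.level η 2 (n 2 + 1))
    rw [hw0, hw1, hw2]
    refine ⟨⟨?_, ?_⟩, ⟨?_, ?_⟩, ?_, ?_⟩ <;> linarith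
  have hvE : v ∈ frontier (Δ.cell η n) ∩ {x | Δ.coord x 0 = Δ.level η 0 (n 0)} :=
    ⟨Δ.mem_frontier_cell hm hne hv hv0, hv0⟩
  have hwE : w ∈ frontier (Δ.cell η n) ∩ {x | Δ.coord x 0 = Δ.level η 0 (n 0)} :=
    ⟨Δ.mem_frontier_cell hm hne hw hw0, hw0⟩
  -- A colored cell has the edge through `v` and `w`. As `w` lies strictly between consecutive lines
  -- of directions 1 and 2, this cell agrees with the given one in these two indices.
  obtain ⟨C, hC, hCE⟩ := hadm _ _ ((Δ.isCell_iff hm h _).2 ⟨n, hne, rfl⟩)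
    ((Δ.isEdgeOf_iff h _ _).2 ⟨0, n 0, rfl, ⟨v, hvE⟩⟩)
  rw [Δ.isEdgeOf_iff h] at hCE
  obtain ⟨i, m, hCE, -⟩ := hCE
  rw [hCE] at hvE hwE
  obtain ⟨p, hp, rfl⟩ := (Δ.isCell_iff hm h C).1 (hC.elim And.left And.left)
  have hvp := hvE.1
  have hwp := hwE.1
  have hwp' := hwE.1
  rw [Δ.frontier_cell hp] at hwp'
  have hwc := hwp'.1
  have hp1 : p 1 = n 1 := by
    obtain ⟨e1, e2⟩ := hwc 1
    rw [hw1] at e1 e2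
    have f1 := (hm 1).lt_iff_lt.1 (e1.trans_lt hε1)
    have f2 := (hm 1).lt_iff_lt.1 ((lt_add_of_pos_right _ hε).trans_le e2)
    omega
  have hp2 : p 2 = n 2 := by
    obtain ⟨e1, e2⟩ := hwc 2
    rw [hw2] at e1 e2
    have f1 := (hm 2).lt_iff_lt.1 (e1.trans_lt
      (show _ < Δ.level η 2 (n 2 + 1) by linarith))
    have f2 := (hm 2).lt_iff_lt.1 ((show Δ.level η 2 (n 2) < _ by linarith).trans_le e2)
    omega
  have hp0 : p 0 ≤ n 0 := by
    have e1 := (hwc 0).1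
    rwa [hw0, (hm 0).le_iff_le] at e1
  obtain ⟨z, hz⟩ := hp
  rcases hC with hC | hC
  -- A white cell is to the left of the edge, so it is the given cell.
  · have e := ((Δ.isWhite_iff h _).1 hC).2 0 (n 0) ⟨v, hvp, hv0⟩ z hz
    have e' := (hm 0).lt_iff_lt.1 (e.trans (hz 0).2)
    have hpn : p = n := by
      funext j
      fin_cases j
      · change p 0 = n 0
        omega
      · exact hp1
      · exact hp2
    rw [hpn] at hC
    exact ⟨hne, hC⟩
  -- A black cell would be to the right of the other line through `v`, against `p 1 = n 1`.
  · have e := ((Δ.isBlack_iff h _).1 hC).2 1 (n 1) ⟨v, hvp, hv1⟩ z hz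
    have e' := (hz 1).1
    rw [hp1] at e'
    exact (lt_asymm e e').elim

/-- If one of the sums were not positive, the corresponding upper line would meet the closed cell,
by an intermediate value argument in the other two coordinates. A white cell does not touch its
upper lines. -/
theorem level_sum_pos_of_isWhite (h : Δ.Enumerates η c) (hm : ∀ i, StrictMono (Δ.level η i))
    {n : Fin 3 → ℤ} (hne : (Δ.cell η n).Nonempty)
    (hw : IsWhite (Δ.arrangement c) (Δ.cell η n)) :
    0 < Δ.level η 0 (n 0 + 1) + Δ.level η 1 (n 1) + Δ.level η 2 (n 2) ∧
    0 < Δ.level η 0 (n 0) + Δ.level η 1 (n 1 + 1) + Δ.level η 2 (n 2) := by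
  have hw' := ((Δ.isWhite_iff h _).1 hw).2
  obtain ⟨x, hx⟩ := hne
  have hstep : ∀ i, Δ.level η i (n i) ≤ Δ.level η i (n i + 1) := fun i =>
    (hm i).monotone (by omega)
  have hs := Δ.coord_sum x
  have hx0 := (hx 0).2
  have hx1 := (hx 1).2
  have hx2 := (hx 2).2
  have key : ∀ i (y : Fin 3 → ℝ), y 0 + y 1 + y 2 = 0 → y i = Δ.level η i (n i + 1) →
      (∀ j, Δ.level η j (n j) ≤ y j ∧ y j ≤ Δ.level η j (n j + 1)) → False := by
    intro i y hy hyi hj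
    obtain ⟨z, hz⟩ := Δ.exists_coord_eq y hy
    have hzi : Δ.coord z i = Δ.level η i (n i + 1) := by rw [hz, hyi]
    have := hw' i (n i + 1) ⟨z, Δ.mem_frontier_cell hm ⟨x, hx⟩ (fun j => by rw [hz]; exact hj j)
      hzi, hzi⟩ x hx
    exact lt_asymm this (hx i).2
  constructor
  · by_contra! hcon
    obtain ⟨y, hy, z, hz, hyz⟩ := exists_add_eq_of_mem_Icc (s := -Δ.level η 0 (n 0 + 1))
      (hstep 1) (hstep 2) (by linarith) (by linarith)
    refine key 0 ![Δ.level η 0 (n 0 + 1), y, z] ?_ rfl ?_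
    · simp only [Matrix.cons_val]; linarith
    · rw [Fin.forall_fin_succ, Fin.forall_fin_succ, Fin.forall_fin_one]
      exact ⟨⟨hstep 0, le_rfl⟩, hy, hz⟩
  · by_contra! hcon
    obtain ⟨y, hy, z, hz, hyz⟩ := exists_add_eq_of_mem_Icc (s := -Δ.level η 1 (n 1 + 1))
      (hstep 0) (hstep 2) (by linarith) (by linarith)
    refine key 1 ![y, Δ.level η 1 (n 1 + 1), z] ?_ rfl ?_
    · simp only [Matrix.cons_val]; linarith
    · rw [Fin.forall_fin_succ, Fin.forall_fin_succ, Fin.forall_fin_one]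
      exact ⟨hy, ⟨hstep 1, le_rfl⟩, hz⟩

/-- A function on the integers that is weakly decreasing and periodic is constant. -/
theorem eq_zero_of_antitone_of_periodic {g : ℤ → ℤ} (hg : ∀ a, g (a + 1) ≤ g a) {N : ℤ}
    (hN : 0 < N) (hper : ∀ a, g (a + N) = g a) (a : ℤ) : g a = g 0 := by
  have hanti : Antitone g := antitone_int_of_succ_le hg
  have h1 : Function.Periodic g 1 := fun b =>
    le_antisymm (hg b) (by rw [← hper b]; exact hanti (by omega))
  have := h1.int_mul_eq a
  rwa [mul_one] at this

/-- The combinatorial type of an admissible simple arrangement. -/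
theorem exists_levelSum_neg_iff (hs : IsSimple (Δ.arrangement c)) (h : Δ.Enumerates η c)
    (hm : ∀ i, StrictMono (Δ.level η i)) (hadm : IsAdmissible (Δ.arrangement c)) :
    ∃ K : ℤ, ∀ n : Fin 3 → ℤ, Δ.levelSum η n < 0 ↔ n 0 + n 1 + n 2 ≤ K := by
  have hex : ∀ a b : ℤ, ∃ d, Δ.level η 0 a + Δ.level η 1 b + Δ.level η 2 d < 0 ∧
      0 < Δ.level η 0 a + Δ.level η 1 b + Δ.level η 2 (d + 1) := by
    intro a b
    obtain ⟨d, hd, hd'⟩ := Δ.exists_level_le_lt hm 2 (-Δ.level η 0 a - Δ.level η 1 b)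
    refine ⟨d, ?_, by linarith⟩
    refine lt_of_le_of_ne (by linarith) ?_
    simpa [levelSum] using levelSum_ne_zero_of_isSimple hs h ![a, b, d]
  choose κ hκ hκ' using hex
  have huniq : ∀ a b d, Δ.level η 0 a + Δ.level η 1 b + Δ.level η 2 d < 0 ↔ d ≤ κ a b := by
    intro a b d
    constructor
    · intro hd
      have := (hm 2).lt_iff_lt.1 (show Δ.level η 2 d < Δ.level η 2 (κ a b + 1) by
        linarith [hκ' a b])
      omega
    · intro hd
      have := (hm 2).monotone hd
      linarith [hκ a b]
  -- The cell with lower lines `a`, `b`, `κ a b` is white, so raising `a` or `b` makes the sum of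
  -- levels positive already at index `κ a b`.
  have hstep : ∀ a b, κ (a + 1) b + 1 ≤ κ a b ∧ κ a (b + 1) + 1 ≤ κ a b := by
    intro a b
    obtain ⟨hne, hw⟩ := isWhite_cell_of_isAdmissible (n := ![a, b, κ a b]) h hm hadm
      (hκ a b) (hκ' a b)
    obtain ⟨h1, h2⟩ := level_sum_pos_of_isWhite h hm hne hw
    simp only [Matrix.cons_val] at h1 h2
    constructor
    · by_contra! hlt
      exact lt_asymm h1 ((huniq _ _ _).2 (by omega))
    · by_contra! hlt
      exact lt_asymm h2 ((huniq _ _ _).2 (by omega))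
  obtain ⟨N, hN, hdvd⟩ : ∃ N : ℤ, 0 < N ∧ ∀ i, (Δ.latticeLength i : ℤ) ∣ N := by
    refine ⟨Δ.latticeLength 0 * Δ.latticeLength 1 * Δ.latticeLength 2, ?_, ?_⟩
    · have := Δ.latticeLength_pos_int
      exact mul_pos (mul_pos (this 0) (this 1)) (this 2)
    · intro i
      fin_cases i
      · exact ((dvd_refl _).mul_right _).mul_right _
      · exact ((dvd_refl _).mul_left _).mul_right _
      · exact (dvd_refl _).mul_left _
  -- Raising one index by the common multiple `N` and lowering the third by `N` does not change the
  -- sum of the levels.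
  have hper : ∀ a b, κ (a + N) b + N = κ a b ∧ κ a (b + N) + N = κ a b := by
    intro a b
    have key : ∀ a' b', (∀ e, Δ.level η 0 a' + Δ.level η 1 b' + Δ.level η 2 (e - N) =
        Δ.level η 0 a + Δ.level η 1 b + Δ.level η 2 e) → κ a' b' + N = κ a b := by
      intro a' b' he
      apply le_antisymm
      · rw [← huniq, ← he, huniq]; omega
      · have := (huniq a b (κ a b)).2 le_rfl
        rw [← he, huniq] at this
        omega
    constructor
    · refine key _ _ fun e => ?_
      have h1 := Δ.level_add_of_dvd η 0 a (hdvd 0)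
      have h2 := Δ.level_add_of_dvd η 2 e (hdvd 2).neg_right
      rw [← sub_eq_add_neg] at h2
      push_cast at h2
      linarith
    · refine key _ _ fun e => ?_
      have h1 := Δ.level_add_of_dvd η 1 b (hdvd 1)
      have h2 := Δ.level_add_of_dvd η 2 e (hdvd 2).neg_right
      rw [← sub_eq_add_neg] at h2
      push_cast at h2
      linarith
  -- Adding the index to `κ` gives a weakly decreasing periodic function in each variable, hence a
  -- constant.
  have hκ0 : ∀ a b, κ a b = κ 0 0 - a - b := by
    intro a b
    have h1 := eq_zero_of_antitone_of_periodic (g := fun a => κ a b + a)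
      (fun a => by have := (hstep a b).1; omega) hN
      (fun a => by have := (hper a b).1; omega) a
    have h2 := eq_zero_of_antitone_of_periodic (g := fun b => κ 0 b + b)
      (fun b => by have := (hstep 0 b).2; omega) hN
      (fun b => by have := (hper 0 b).2; omega) b
    omega
  refine ⟨κ 0 0, fun n => ?_⟩
  rw [levelSum, huniq, hκ0]
  omega

/-- Admissible simple arrangements are described by good deviations. -/
theorem exists_isGood_of_isAdmissible (hs : IsSimple (Δ.arrangement c))
    (hadm : IsAdmissible (Δ.arrangement c)) :
    ∃ σ : Equiv.Perm Δ.Edge, (∀ e, Δ.normal (σ e).1 = Δ.normal e.1) ∧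
      ∃ η, Δ.IsGood η ∧ c ∘ σ = Δ.position η := by
  have hc := offset_injective_of_isSimple hs
  obtain ⟨η, h, hm⟩ := exists_strictMono_enumerates hc
  obtain ⟨K, hK⟩ := exists_levelSum_neg_iff hs h hm hadm
  -- Renumbering the lines of the first direction by `K` moves the threshold of the index sum to 0.
  obtain ⟨k, hk⟩ : ∃ k : Fin 3 → ℤ, k = ![K, 0, 0] := ⟨_, rfl⟩
  have hlevel : ∀ i n, Δ.level (fun e => Δ.level η e.1 ((e.2 : ℕ) + k e.1) - (e.2 : ℕ)) i n =
      Δ.level η i (n + k i) := by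
    intro i n
    have h2 : n = ((Δ.residue i n : ℕ) : ℤ) + Δ.latticeLength i * (n / Δ.latticeLength i) := by
      rw [residue_cast]
      exact (Int.emod_add_mul_ediv n (Δ.latticeLength i)).symm
    have h3 : (n : ℝ) = ((Δ.residue i n : ℕ) : ℝ) +
        Δ.latticeLength i * ((n / Δ.latticeLength i : ℤ) : ℝ) := by
      exact_mod_cast h2
    have h4 : Δ.level η i (n + k i) = Δ.level η i ((Δ.residue i n : ℕ) + k i) +
        Δ.latticeLength i * ((n / Δ.latticeLength i : ℤ) : ℝ) := by
      rw [← level_add_mul]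
      congr 1
      omega
    rw [h4]
    conv_lhs => rw [level]
    linear_combination h3
  have h' : Δ.Enumerates (fun e => Δ.level η e.1 ((e.2 : ℕ) + k e.1) - (e.2 : ℕ)) c := by
    intro i r
    rw [h i r]
    simp only [hlevel]
    constructor
    · rintro ⟨n, hn⟩
      exact ⟨n - k i, by rw [sub_add_cancel, hn]⟩
    · rintro ⟨n, hn⟩
      exact ⟨_, hn⟩
  have hm' : ∀ i, StrictMono (Δ.level (fun e => Δ.level η e.1 ((e.2 : ℕ) + k e.1) - (e.2 : ℕ)) i) :=
    fun i n n' hn => by rw [hlevel, hlevel]; exact hm i (by omega)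
  obtain ⟨σ, hσ, hσ'⟩ := exists_perm_of_enumerates h' hm'
  refine ⟨σ, hσ, _, fun n => ?_, hσ'⟩
  have hsum : Δ.levelSum (fun e => Δ.level η e.1 ((e.2 : ℕ) + k e.1) - (e.2 : ℕ)) n =
      Δ.levelSum η (n + k) := by
    simp only [levelSum, hlevel, Pi.add_apply]
  have hk' : (n + k) 0 + (n + k) 1 + (n + k) 2 = n 0 + n 1 + n 2 + K := by
    simp only [hk, Pi.add_apply, Matrix.cons_val]; ring
  rw [hsum]
  constructor
  · intro hn
    rw [hK]
    omega
  · intro hn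
    refine lt_of_le_of_ne ?_ (levelSum_ne_zero_of_isSimple hs h _).symm
    by_contra! hlt
    rw [hK] at hlt
    omega

end LatticeTriangle

namespace LatticeTriangle

variable {Δ : LatticeTriangle} {η : Δ.Edge → ℝ} {c : Δ.Edge → UnitAddCircle}

/-! ### Permutations of parallel lines -/

theorem arrangement_comp {σ : Equiv.Perm Δ.Edge} (hσ : ∀ e, Δ.normal (σ e).1 = Δ.normal e.1) :
    Δ.arrangement (c ∘ σ) = Δ.arrangement c ∘ σ := by
  funext e
  simp only [arrangement, Function.comp_apply, hσ]

theorem isSimple_comp_iff {σ : Equiv.Perm Δ.Edge} (hσ : ∀ e, Δ.normal (σ e).1 = Δ.normal e.1) :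
    IsSimple (Δ.arrangement (c ∘ σ)) ↔ IsSimple (Δ.arrangement c) := by
  rw [arrangement_comp hσ]
  constructor
  · intro h i j k hij hjk hik
    have := h (σ.symm i) (σ.symm j) (σ.symm k) (σ.symm.injective.ne hij) (σ.symm.injective.ne hjk)
      (σ.symm.injective.ne hik)
    simpa only [Function.comp_apply, Equiv.apply_symm_apply] using this
  · intro h i j k hij hjk hik
    exact h (σ i) (σ j) (σ k) (σ.injective.ne hij) (σ.injective.ne hjk) (σ.injective.ne hik)

theorem normal_symm {σ : Equiv.Perm Δ.Edge} (hσ : ∀ e, Δ.normal (σ e).1 = Δ.normal e.1)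
    (e : Δ.Edge) : Δ.normal (σ.symm e).1 = Δ.normal e.1 := by
  rw [← hσ, Equiv.apply_symm_apply]

theorem comp_mem_connectedComponentIn {σ : Equiv.Perm Δ.Edge}
    (hσ : ∀ e, Δ.normal (σ e).1 = Δ.normal e.1) {c' : Δ.Edge → UnitAddCircle}
    (hc : c ∈ Δ.simpleArrangements) (h : c' ∈ connectedComponentIn Δ.simpleArrangements c) :
    c' ∘ σ ∈ connectedComponentIn Δ.simpleArrangements (c ∘ σ) := by
  have hcont : Continuous fun d : Δ.Edge → UnitAddCircle => d ∘ σ :=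
    continuous_pi fun e => continuous_apply (σ e)
  have hpre := (isPreconnected_connectedComponentIn (F := Δ.simpleArrangements) (x := c)).image
    (fun d => d ∘ σ) hcont.continuousOn
  refine hpre.subset_connectedComponentIn (F := Δ.simpleArrangements)
    ⟨c, mem_connectedComponentIn hc, rfl⟩ ?_ ⟨c', h, rfl⟩
  rintro _ ⟨d, hd, rfl⟩
  exact (isSimple_comp_iff hσ).2 (connectedComponentIn_subset _ _ hd)

theorem SameComponent.refl (hc : c ∈ Δ.simpleArrangements) : Δ.SameComponent c c :=
  ⟨Equiv.refl _, fun _ => rfl, mem_connectedComponentIn hc⟩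

theorem SameComponent.symm {c' : Δ.Edge → UnitAddCircle} (hc : c ∈ Δ.simpleArrangements)
    (h : Δ.SameComponent c c') : Δ.SameComponent c' c := by
  obtain ⟨σ, hσ, h⟩ := h
  refine ⟨σ.symm, normal_symm hσ, ?_⟩
  have h1 := comp_mem_connectedComponentIn (normal_symm hσ) (connectedComponentIn_subset _ _ h)
    (connectedComponentIn_eq h ▸ mem_connectedComponentIn hc)
  rwa [Function.comp_assoc, Equiv.self_comp_symm, Function.comp_id] at h1

theorem SameComponent.trans {c' c'' : Δ.Edge → UnitAddCircle} (hc' : c' ∈ Δ.simpleArrangements)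
    (h : Δ.SameComponent c c') (h' : Δ.SameComponent c' c'') : Δ.SameComponent c c'' := by
  obtain ⟨σ, hσ, h⟩ := h
  obtain ⟨τ, hτ, h'⟩ := h'
  refine ⟨σ.trans τ, fun e => (hτ _).trans (hσ e), ?_⟩
  have h1 := comp_mem_connectedComponentIn hσ hc' h'
  rw [← connectedComponentIn_eq h] at h1
  exact h1

/-! ### The component of the admissible arrangements -/

variable (Δ) in
/-- The arrangements that are, up to permutation of parallel lines, described
by good deviations. -/
def goodArrangements : Set (Δ.Edge → UnitAddCircle) :=
  {c | ∃ σ : Equiv.Perm Δ.Edge, (∀ e, Δ.normal (σ e).1 = Δ.normal e.1) ∧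
    ∃ η, Δ.IsGood η ∧ c ∘ σ = Δ.position η}

theorem levelSum_eq (η : Δ.Edge → ℝ) (n : Fin 3 → ℤ) :
    Δ.levelSum η n = ((n 0 + n 1 + n 2 : ℤ) : ℝ) + (η ⟨0, Δ.residue 0 (n 0)⟩ +
      η ⟨1, Δ.residue 1 (n 1)⟩ + η ⟨2, Δ.residue 2 (n 2)⟩) := by
  unfold levelSum level
  push_cast
  ring

theorem continuous_levelSum (n : Fin 3 → ℤ) : Continuous fun η => Δ.levelSum η n := by
  simp only [levelSum_eq]
  fun_prop

theorem continuous_position : Continuous Δ.position := by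
  refine continuous_pi fun e => (AddCircle.continuous_mk' 1).comp ?_
  fun_prop

theorem isOpenMap_position : IsOpenMap Δ.position := by
  refine IsOpenMap.piMap (f := fun (e : Δ.Edge) (t : ℝ) =>
    ((((e.2 : ℕ) + t) / Δ.latticeLength e.1 : ℝ) : UnitAddCircle)) (fun e => ?_)
    (Filter.Eventually.of_forall fun e => ?_)
  · have hl := (Δ.latticeLength_pos_real e.1).ne'
    exact QuotientAddGroup.isOpenMap_coe.comp
      (((Homeomorph.addLeft ((e.2 : ℕ) : ℝ)).trans
        (Homeomorph.mulRight₀ _ (inv_ne_zero hl))).isOpenMap)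
  · have hl := (Δ.latticeLength_pos_real e.1).ne'
    intro y
    obtain ⟨r, rfl⟩ := QuotientAddGroup.mk_surjective y
    refine ⟨r * Δ.latticeLength e.1 - (e.2 : ℕ), ?_⟩
    dsimp only
    rw [add_sub_cancel, mul_div_cancel_right₀ _ hl]

/-- The inequality for `n` involves `η` only through the residues of `n`, so finitely many strict
inequalities suffice. -/
theorem isOpen_isGood : IsOpen {η | Δ.IsGood η} := by
  have : {η | Δ.IsGood η} = ⋂ k : ∀ i, Fin (Δ.latticeLength i),
      {η | ((∃ n : Fin 3 → ℤ, n 0 + n 1 + n 2 = 0 ∧ ∀ i, Δ.residue i (n i) = k i) →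
          η ⟨0, k 0⟩ + η ⟨1, k 1⟩ + η ⟨2, k 2⟩ < 0) ∧
        ((∃ n : Fin 3 → ℤ, n 0 + n 1 + n 2 = 1 ∧ ∀ i, Δ.residue i (n i) = k i) →
          -1 < η ⟨0, k 0⟩ + η ⟨1, k 1⟩ + η ⟨2, k 2⟩)} := by
    ext η
    simp only [Set.mem_ofPred_eq, Set.mem_iInter]
    constructor
    · intro h k
      constructor
      · rintro ⟨n, hn, hk⟩
        have := (h n).1 hn
        rw [levelSum_eq, hn, hk, hk, hk] at this
        simpa using this
      · rintro ⟨n, hn, hk⟩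
        have := (h n).2 hn
        rw [levelSum_eq, hn, hk, hk, hk] at this
        push_cast at this
        linarith
    · intro h n
      obtain ⟨h1, h2⟩ := h fun i => Δ.residue i (n i)
      constructor
      · intro hn
        have := h1 ⟨n, hn, fun _ => rfl⟩
        rw [levelSum_eq, hn]
        simpa using this
      · intro hn
        have := h2 ⟨n, hn, fun _ => rfl⟩
        rw [levelSum_eq, hn]
        push_cast
        linarith
  rw [this]
  refine isOpen_iInter_of_finite fun k => ?_
  have hcont : Continuous fun η : Δ.Edge → ℝ => η ⟨0, k 0⟩ + η ⟨1, k 1⟩ + η ⟨2, k 2⟩ := by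
    fun_prop
  refine IsOpen.inter ?_ ?_
  · by_cases hk : ∃ n : Fin 3 → ℤ, n 0 + n 1 + n 2 = 0 ∧ ∀ i, Δ.residue i (n i) = k i
    · simp only [hk, true_imp_iff]
      exact isOpen_lt hcont continuous_const
    · simp only [hk, false_imp_iff]
      exact isOpen_univ
  · by_cases hk : ∃ n : Fin 3 → ℤ, n 0 + n 1 + n 2 = 1 ∧ ∀ i, Δ.residue i (n i) = k i
    · simp only [hk, true_imp_iff]
      exact isOpen_lt continuous_const hcont
    · simp only [hk, false_imp_iff]
      exact isOpen_univ

theorem isOpen_goodArrangements : IsOpen Δ.goodArrangements := by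
  have : Δ.goodArrangements = ⋃ σ ∈ {σ : Equiv.Perm Δ.Edge | ∀ e, Δ.normal (σ e).1 = Δ.normal e.1},
      (fun c : Δ.Edge → UnitAddCircle => c ∘ σ) ⁻¹' (Δ.position '' {η | Δ.IsGood η}) := by
    ext c
    simp only [goodArrangements, Set.mem_ofPred_eq, Set.mem_iUnion, Set.mem_preimage,
      Set.mem_image, exists_prop]
    simp only [eq_comm]
  rw [this]
  refine isOpen_biUnion fun σ _ => (isOpenMap_position _ isOpen_isGood).preimage ?_
  exact continuous_pi fun e => continuous_apply (σ e)

variable (Δ) in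
/-- A bounded set of deviations satisfying the weak inequalities in the definition of good
deviations. -/
def weakBox (M : ℝ) : Set (Δ.Edge → ℝ) :=
  {η | ∀ n : Fin 3 → ℤ, (n 0 + n 1 + n 2 = 0 → Δ.levelSum η n ≤ 0) ∧
    (n 0 + n 1 + n 2 = 1 → 0 ≤ Δ.levelSum η n)} ∩ Set.Icc (fun _ => -M) (fun _ => M)

theorem isCompact_weakBox (M : ℝ) : IsCompact (Δ.weakBox M) := by
  refine isCompact_Icc.inter_left ?_
  simp only [Set.ofPred_forall]
  refine isClosed_iInter fun n => IsClosed.inter ?_ ?_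
  · by_cases hn : n 0 + n 1 + n 2 = 0
    · simp only [hn, true_imp_iff]
      exact isClosed_le (continuous_levelSum n) continuous_const
    · simp only [hn, false_imp_iff]
      exact isClosed_univ
  · by_cases hn : n 0 + n 1 + n 2 = 1
    · simp only [hn, true_imp_iff]
      exact isClosed_le continuous_const (continuous_levelSum n)
    · simp only [hn, false_imp_iff]
      exact isClosed_univ

/-- Good deviations can be translated to a bounded set without changing the arrangement. -/
theorem exists_weakBox : ∃ M : ℝ, ∀ η, Δ.IsGood η →
    ∃ η' ∈ Δ.weakBox M, Δ.position η' = Δ.position η := by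
  obtain ⟨N, hN, hdvd⟩ : ∃ N : ℤ, 0 < N ∧ ∀ i, (Δ.latticeLength i : ℤ) ∣ N := by
    refine ⟨Δ.latticeLength 0 * Δ.latticeLength 1 * Δ.latticeLength 2, ?_, ?_⟩
    · have := Δ.latticeLength_pos_int
      exact mul_pos (mul_pos (this 0) (this 1)) (this 2)
    · intro i
      fin_cases i
      · exact ((dvd_refl _).mul_right _).mul_right _
      · exact ((dvd_refl _).mul_left _).mul_right _
      · exact (dvd_refl _).mul_left _
  have hN' : (0 : ℝ) < N := by exact_mod_cast hN
  have hlN : ∀ i, (Δ.latticeLength i : ℝ) ≤ N := fun i => by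
    exact_mod_cast Int.le_of_dvd hN (hdvd i)
  refine ⟨5 * N, fun η hη => ?_⟩
  -- Two translations bring the first two base levels into `[0, N)`. The third is dictated by total
  -- translation zero, which preserves all sums of levels.
  obtain ⟨p, hp, hp0, hp1⟩ : ∃ p : Fin 3 → ℤ, p 0 + p 1 + p 2 = 0 ∧
      (0 ≤ Δ.level η 0 0 + N * p 0 ∧ Δ.level η 0 0 + N * p 0 < N) ∧
      (0 ≤ Δ.level η 1 0 + N * p 1 ∧ Δ.level η 1 0 + N * p 1 < N) := by
    have key : ∀ x : ℝ, 0 ≤ x + N * ((-⌊x / N⌋ : ℤ) : ℝ) ∧ x + N * ((-⌊x / N⌋ : ℤ) : ℝ) < N := by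
      intro x
      have h1 := Int.floor_le (x / N)
      have h2 := Int.lt_floor_add_one (x / N)
      rw [le_div_iff₀ hN'] at h1
      rw [div_lt_iff₀ hN'] at h2
      push_cast
      constructor <;> nlinarith
    refine ⟨![-⌊Δ.level η 0 0 / N⌋, -⌊Δ.level η 1 0 / N⌋,
      ⌊Δ.level η 0 0 / N⌋ + ⌊Δ.level η 1 0 / N⌋], ?_, key _, key _⟩
    simp only [Matrix.cons_val]
    ring
  have hlev : ∀ i n, Δ.level (fun e => η e + N * p e.1) i n = Δ.level η i n + N * p i :=
    fun i n => by unfold level; ring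
  have hp' : (p 0 : ℝ) + p 1 + p 2 = 0 := by exact_mod_cast hp
  have hsum : ∀ n, Δ.levelSum (fun e => η e + N * p e.1) n = Δ.levelSum η n := fun n => by
    simp only [levelSum, hlev]
    linear_combination (N : ℝ) * hp'
  refine ⟨fun e => η e + N * p e.1, ⟨fun n => ?_, ?_⟩, ?_⟩
  · rw [hsum]
    exact ⟨fun h => ((hη n).1 h).le, fun h => ((hη n).2 h).le⟩
  · have hm := hη.strictMono
    have hwin : ∀ i (k : ℤ), 0 ≤ k → k ≤ Δ.latticeLength i →
        Δ.level η i 0 ≤ Δ.level η i k ∧ Δ.level η i k ≤ Δ.level η i 0 + Δ.latticeLength i := by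
      intro i k hk hk'
      refine ⟨(hm i).monotone hk, ?_⟩
      have := Δ.level_add_mul η i 0 1
      rw [zero_add, mul_one, Int.cast_one, mul_one] at this
      rw [← this]
      exact (hm i).monotone hk'
    -- The third base level is confined by the sign conditions at index sums 0 and 1.
    have h2 : Δ.level η 2 0 + N * p 2 < 0 := by
      have := hη.levelSum_neg 0 0 0 (by omega)
      nlinarith
    have h2' : -(3 * N) < Δ.level η 2 0 + N * p 2 := by
      have h3 := hη.levelSum_pos 0 0 1 (by omega)
      have h4 := (hwin 2 1 (by omega) (Δ.latticeLength_pos_int 2)).2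
      have h5 := hlN 2
      nlinarith
    have hb : ∀ i, -(3 * N) ≤ Δ.level η i 0 + N * p i ∧ Δ.level η i 0 + N * p i ≤ N := by
      intro i
      fin_cases i
      · exact ⟨(by linarith : -(3 * (N : ℝ)) ≤ 0).trans hp0.1, hp0.2.le⟩
      · exact ⟨(by linarith : -(3 * (N : ℝ)) ≤ 0).trans hp1.1, hp1.2.le⟩
      · exact ⟨h2'.le, h2.le.trans hN'.le⟩
    have he : ∀ e : Δ.Edge, -(5 * N) ≤ η e + N * p e.1 ∧ η e + N * p e.1 ≤ 5 * N := by
      rintro ⟨i, k⟩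
      have hk : ((k : ℕ) : ℤ) ≤ Δ.latticeLength i := by exact_mod_cast k.2.le
      have hk' : ((k : ℕ) : ℝ) ≤ Δ.latticeLength i := by exact_mod_cast hk
      have h6 := hwin i (k : ℕ) (by positivity) hk
      have h7 : Δ.level η i (k : ℕ) = (k : ℕ) + η ⟨i, k⟩ := by
        rw [level, residue_natCast]; push_cast; rfl
      rw [h7] at h6
      have h8 := hb i
      have h9 := hlN i
      have h10 : (0 : ℝ) ≤ ((k : ℕ) : ℝ) := by positivity
      dsimp only
      constructor <;> linarith
    exact ⟨fun e => (he e).1, fun e => (he e).2⟩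
  -- `N` is a multiple of the lattice length, so the offset changes by an integer.
  · funext e
    unfold position
    rw [unitAddCircle_coe_eq_coe_iff]
    obtain ⟨q, hq⟩ := hdvd e.1
    refine ⟨q * p e.1, ?_⟩
    have hq' : (N : ℝ) = Δ.latticeLength e.1 * q := by exact_mod_cast hq
    have hl := (Δ.latticeLength_pos_real e.1).ne'
    rw [hq']
    push_cast
    field_simp
    ring

theorem goodArrangements_subset : Δ.goodArrangements ⊆ Δ.simpleArrangements := by
  rintro c ⟨σ, hσ, η, hη, h⟩
  have := hη.isSimple
  rw [← h] at this
  exact (isSimple_comp_iff hσ).1 this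

/-- The good arrangements are closed in the space of simple arrangements. -/
theorem exists_isClosed_goodArrangements :
    ∃ V, IsClosed V ∧ Δ.goodArrangements ⊆ V ∧ V ∩ Δ.simpleArrangements ⊆ Δ.goodArrangements := by
  obtain ⟨M, hM⟩ := Δ.exists_weakBox
  refine ⟨⋃ σ ∈ {σ : Equiv.Perm Δ.Edge | ∀ e, Δ.normal (σ e).1 = Δ.normal e.1},
      (fun c : Δ.Edge → UnitAddCircle => c ∘ σ) ⁻¹' (Δ.position '' Δ.weakBox M), ?_, ?_, ?_⟩
  · refine (Set.toFinite _).isClosed_biUnion fun σ _ => ?_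
    refine ((isCompact_weakBox M).image continuous_position).isClosed.preimage ?_
    exact continuous_pi fun e => continuous_apply (σ e)
  · rintro c ⟨σ, hσ, η, hη, h⟩
    obtain ⟨η', hη', hpos⟩ := hM η hη
    exact Set.mem_biUnion hσ ⟨η', hη', hpos.trans h.symm⟩
  · rintro c ⟨hc, hs⟩
    obtain ⟨σ, hσ, η, hη, h⟩ := Set.mem_iUnion₂.1 hc
    -- Simplicity turns the weak inequalities into strict ones.
    have hne := levelSum_ne_zero_of_isSimple hs (Δ.enumerates_of_comp_eq hσ h.symm)
    exact ⟨σ, hσ, η, fun n => ⟨fun hn => lt_of_le_of_ne ((hη.1 n).1 hn) (hne n),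
      fun hn => lt_of_le_of_ne ((hη.1 n).2 hn) (hne n).symm⟩, h.symm⟩

/-- Within the simple arrangements the good ones are open and closed, so they contain every
connected component that they meet. -/
theorem mem_goodArrangements_of_sameComponent {c' : Δ.Edge → UnitAddCircle}
    (hc : c ∈ Δ.goodArrangements) (h : Δ.SameComponent c c') : c' ∈ Δ.goodArrangements := by
  obtain ⟨V, hV, hV1, hV2⟩ := Δ.exists_isClosed_goodArrangements
  obtain ⟨σ, hσ, h⟩ := h
  have hsub : connectedComponentIn Δ.simpleArrangements c ⊆ Δ.goodArrangements := by
    refine IsPreconnected.subset_left_of_subset_union isOpen_goodArrangements hV.isOpen_compl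
      ?_ ?_ ⟨c, mem_connectedComponentIn (goodArrangements_subset hc), hc⟩
      isPreconnected_connectedComponentIn
    · exact Set.disjoint_compl_right_iff_subset.2 hV1
    · intro d hd
      by_cases hdV : d ∈ V
      · exact Or.inl (hV2 ⟨hdV, connectedComponentIn_subset _ _ hd⟩)
      · exact Or.inr hdV
  obtain ⟨τ, hτ, η, hη, he⟩ := hsub h
  exact ⟨τ.trans σ, fun e => (hσ _).trans (hτ e), η, hη, he⟩

/-- Deformation of deviations along a straight line. -/
theorem IsGood.lineMap {η' : Δ.Edge → ℝ} (hη : Δ.IsGood η) (hη' : Δ.IsGood η') {t : ℝ}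
    (ht : t ∈ Set.Icc (0 : ℝ) 1) : Δ.IsGood (AffineMap.lineMap η η' t) := by
  have hsum : ∀ n, Δ.levelSum (AffineMap.lineMap η η' t) n =
      (1 - t) * Δ.levelSum η n + t * Δ.levelSum η' n := by
    intro n
    simp only [levelSum_eq, AffineMap.lineMap_apply, vsub_eq_sub, vadd_eq_add, Pi.add_apply,
      Pi.smul_apply, Pi.sub_apply, smul_eq_mul]
    ring
  have h0 : 0 ≤ 1 - t := by linarith [ht.2]
  intro n
  rw [hsum]
  constructor
  · intro hn
    have h1 := (hη n).1 hn
    have h2 := (hη' n).1 hn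
    rcases ht.1.eq_or_lt with h | h
    · rw [← h]; linarith
    · nlinarith
  · intro hn
    have h1 := (hη n).2 hn
    have h2 := (hη' n).2 hn
    rcases ht.1.eq_or_lt with h | h
    · rw [← h]; linarith
    · nlinarith

/-- Good deviations form a convex set, and each of them gives a simple arrangement, so a segment of
deviations gives a path of simple arrangements. -/
theorem sameComponent_of_mem_goodArrangements {c' : Δ.Edge → UnitAddCircle}
    (hc : c ∈ Δ.goodArrangements) (hc' : c' ∈ Δ.goodArrangements) : Δ.SameComponent c c' := by
  have hs := goodArrangements_subset hc
  obtain ⟨σ, hσ, η, hη, h⟩ := hc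
  obtain ⟨τ, hτ, η', hη', h'⟩ := hc'
  have hpath : Continuous fun t : ℝ => Δ.position (AffineMap.lineMap η η' t) :=
    continuous_position.comp AffineMap.lineMap_continuous
  have hpre := (convex_Icc (0 : ℝ) 1).isPreconnected.image _ hpath.continuousOn
  have hmem : Δ.position η' ∈ connectedComponentIn Δ.simpleArrangements (Δ.position η) := by
    refine hpre.subset_connectedComponentIn ⟨0, by simp, by simp⟩ ?_ ⟨1, by simp, by simp⟩
    rintro _ ⟨t, ht, rfl⟩
    exact (hη.lineMap hη' ht).isSimple
  rw [← h, ← h'] at hmem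
  refine SameComponent.trans ((isSimple_comp_iff hσ).2 hs) ⟨σ.symm, normal_symm hσ, ?_⟩
    ⟨τ, hτ, hmem⟩
  rw [Function.comp_assoc, Equiv.self_comp_symm, Function.comp_id]
  exact mem_connectedComponentIn hs

theorem isAdmissible_iff (hs : c ∈ Δ.simpleArrangements) :
    IsAdmissible (Δ.arrangement c) ↔ c ∈ Δ.goodArrangements := by
  constructor
  · exact exists_isGood_of_isAdmissible hs
  · rintro ⟨σ, hσ, η, hη, h⟩
    exact hη.isAdmissible (Δ.enumerates_of_comp_eq hσ h)

/-- The output of the algorithm consists of one graph. -/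
theorem exists_output_eq (hne : Δ.goodArrangements.Nonempty) {V : Set (Δ.Edge → UnitAddCircle)}
    (hV : Δ.IsRepresentativeSystem V) :
    ∃ c ∈ V, c ∈ Δ.goodArrangements ∧ Δ.output V = {graphOf (Δ.arrangement c)} := by
  obtain ⟨d, hd⟩ := hne
  obtain ⟨c, ⟨hcV, hdc⟩, huniq⟩ := hV.2 d (goodArrangements_subset hd)
  refine ⟨c, hcV, mem_goodArrangements_of_sameComponent hd hdc, ?_⟩
  ext G
  rw [Set.mem_singleton_iff]
  constructor
  · rintro ⟨c', hc', hadm, rfl⟩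
    rw [isAdmissible_iff (hV.1 hc')] at hadm
    rw [huniq c' ⟨hc', sameComponent_of_mem_goodArrangements hd hadm⟩]
  · rintro rfl
    exact ⟨c, hcV, (isAdmissible_iff (hV.1 hcV)).2
      (mem_goodArrangements_of_sameComponent hd hdc), rfl⟩

theorem exists_isRepresentativeSystem (hc : c ∈ Δ.simpleArrangements) :
    ∃ V, Δ.IsRepresentativeSystem V ∧ c ∈ V := by
  let s : Setoid Δ.simpleArrangements :=
    { r := fun x y => Δ.SameComponent x y
      iseqv := ⟨fun x => SameComponent.refl x.2, fun {x _} h => h.symm x.2,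
        fun {_ y _} h h' => h.trans y.2 h'⟩ }
  classical
  -- An arbitrary choice of representatives, altered only at the class of `c` so that `c` is
  -- selected.
  let f : Quotient s → Δ.simpleArrangements := Function.update Quotient.out ⟦⟨c, hc⟩⟧ ⟨c, hc⟩
  have hf : ∀ q, ⟦f q⟧ = q := by
    intro q
    by_cases h : q = ⟦⟨c, hc⟩⟧
    · rw [h]; simp [f]
    · simp [f, Function.update_of_ne h]
  refine ⟨Set.range fun q => (f q : Δ.Edge → UnitAddCircle), ⟨?_, ?_⟩, ⟨⟦⟨c, hc⟩⟧, by simp [f]⟩⟩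
  · rintro _ ⟨q, rfl⟩
    exact (f q).2
  · intro d hd
    refine ⟨f ⟦⟨d, hd⟩⟧, ⟨⟨_, rfl⟩, ?_⟩, ?_⟩
    · exact Quotient.exact (hf ⟦⟨d, hd⟩⟧).symm
    · rintro _ ⟨⟨q, rfl⟩, hq⟩
      have : (⟦⟨d, hd⟩⟧ : Quotient s) = ⟦f q⟧ := Quotient.sound hq
      dsimp only
      rw [this, hf]

end LatticeTriangle

open MeasureTheory

namespace LatticeTriangle

variable {Δ : LatticeTriangle} {η : Δ.Edge → ℝ} {c : Δ.Edge → UnitAddCircle}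

/-! ### Centers of gravity of triangles -/

variable (Δ) in
/-- The linear map that permutes the coordinates cyclically. -/
def rotation : (ℝ × ℝ) →ₗ[ℝ] (ℝ × ℝ) :=
  Δ.recon ∘ₗ LinearMap.funLeft ℝ ℝ (fun i : Fin 3 => i + 1) ∘ₗ Δ.coord

theorem coord_rotation (x : ℝ × ℝ) (i : Fin 3) :
    Δ.coord (Δ.rotation x) i = Δ.coord x (i + 1) := by
  unfold rotation
  rw [LinearMap.comp_apply, LinearMap.comp_apply, coord_recon]
  · rfl
  · change Δ.coord x 1 + Δ.coord x 2 + Δ.coord x 0 = 0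
    linarith [Δ.coord_sum x]

/-- The map has order three, and 1 is the only real cube root of 1. -/
theorem det_rotation : LinearMap.det Δ.rotation = 1 := by
  have h : Δ.rotation ∘ₗ Δ.rotation ∘ₗ Δ.rotation = LinearMap.id := by
    refine LinearMap.ext fun x => Δ.coord_injective (funext fun i => ?_)
    rw [LinearMap.comp_apply, LinearMap.comp_apply, coord_rotation, coord_rotation,
      coord_rotation, LinearMap.id_apply]
    fin_cases i <;> rfl
  have hd := congrArg LinearMap.det h
  rw [LinearMap.det_comp, LinearMap.det_comp, LinearMap.det_id] at hd
  have hd' : LinearMap.det Δ.rotation ^ 3 = 1 := by rw [← hd]; ring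
  exact (Odd.strictMono_pow (R := ℝ) (n := 3) (by decide)).injective (by simpa using hd')

/-- A region that is invariant under a cyclic affine permutation of the coordinates has its center
of gravity at the fixed point. -/
theorem coord_centerOfGravity {C : Set (ℝ × ℝ)} (hC : IsOpen C) (hne : C.Nonempty)
    (hb : Bornology.IsBounded C) (t : Fin 3 → ℝ)
    (hinv : ∀ x, x ∈ C ↔ Δ.rotation x + Δ.recon (fun i => t i - t (i + 1)) ∈ C) (i : Fin 3) :
    Δ.coord (centerOfGravity C) i = t i - (t 0 + t 1 + t 2) / 3 := by
  have hvol : volume C ≠ 0 := (hC.measure_pos volume hne).ne'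
  have hfin : volume C ≠ ⊤ := hb.measure_lt_top.ne
  have hreal : volume.real C ≠ 0 := (measureReal_ne_zero_iff hfin).2 hvol
  have hint : IntegrableOn (fun x : ℝ × ℝ => x) C :=
    (continuous_id.continuousOn.integrableOn_compact
      (Metric.isCompact_of_isClosed_isBounded isClosed_closure hb.closure)).mono_set subset_closure
  have hint' : ∀ i, IntegrableOn (fun x => Δ.coord x i) C := fun i =>
    ((Δ.continuous_coord_apply i).continuousOn.integrableOn_compact
      (Metric.isCompact_of_isClosed_isBounded isClosed_closure hb.closure)).mono_set subset_closure
  have hcog : ∀ i, volume.real C * Δ.coord (centerOfGravity C) i = ∫ x in C, Δ.coord x i := by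
    intro i
    have h1 := ((ContinuousLinearMap.proj (R := ℝ) (φ := fun _ : Fin 3 => ℝ) i).comp
      (LinearMap.toContinuousLinearMap Δ.coord)).integral_comp_comm hint
    change ∫ x in C, Δ.coord x i = Δ.coord (∫ x in C, x) i at h1
    rw [h1, centerOfGravity, setAverage_eq, map_smul, Pi.smul_apply, smul_eq_mul,
      mul_inv_cancel_left₀ hreal]
  have hmp : MeasurePreserving (fun x => Δ.rotation x + Δ.recon (fun i => t i - t (i + 1)))
      volume volume := by
    have h1 : MeasurePreserving Δ.rotation volume volume := by
      refine ⟨(LinearMap.continuous_of_finiteDimensional _).measurable, ?_⟩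
      rw [Measure.map_linearMap_addHaar_eq_smul_addHaar volume (by rw [det_rotation]; simp),
        det_rotation]
      simp
    exact (measurePreserving_add_right volume _).comp h1
  have hemb : MeasurableEmbedding
      (fun x => Δ.rotation x + Δ.recon (fun i => t i - t (i + 1))) := by
    have hcont : Continuous (fun x => Δ.rotation x + Δ.recon (fun i => t i - t (i + 1))) :=
      (LinearMap.continuous_of_finiteDimensional _).add continuous_const
    refine hcont.measurableEmbedding fun x y hxy => ?_
    have hxy' : Δ.rotation x = Δ.rotation y := add_right_cancel hxy
    refine Δ.coord_injective (funext fun i => ?_)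
    have := congrFun (congrArg Δ.coord hxy') (i + 2)
    rw [coord_rotation, coord_rotation, add_assoc] at this
    simpa using this
  -- Integrating a shifted coordinate over the region, once directly and once after the
  -- measure-preserving symmetry, shows that all shifted coordinates of the center agree. The sum
  -- zero then determines them.
  have hstep : ∀ i, Δ.coord (centerOfGravity C) i - t i =
      Δ.coord (centerOfGravity C) (i + 1) - t (i + 1) := by
    intro i
    have h1 := hmp.setIntegral_preimage_emb hemb (fun x => Δ.coord x i - t i) C
    have hpre : (fun x => Δ.rotation x + Δ.recon (fun i => t i - t (i + 1))) ⁻¹' C = C := by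
      ext x
      exact (hinv x).symm
    have hval : ∀ x, Δ.coord (Δ.rotation x + Δ.recon (fun i => t i - t (i + 1))) i - t i =
        Δ.coord x (i + 1) - t (i + 1) := by
      intro x
      rw [map_add, Pi.add_apply, coord_rotation, coord_recon]
      · ring
      · change t 0 - t 1 + (t 1 - t 2) + (t 2 - t 0) = 0
        ring
    rw [hpre] at h1
    simp only [hval] at h1
    have hconst : ∀ r : ℝ, IntegrableOn (fun _ : ℝ × ℝ => r) C := fun r =>
      integrableOn_const hfin
    rw [integral_sub (hint' _) (hconst _), integral_sub (hint' _) (hconst _), ← hcog, ← hcog,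
      setIntegral_const, setIntegral_const, smul_eq_mul, smul_eq_mul, ← mul_sub, ← mul_sub] at h1
    exact (mul_left_cancel₀ hreal h1).symm
  have hs := Δ.coord_sum (centerOfGravity C)
  have h0 : Δ.coord (centerOfGravity C) 0 - t 0 = Δ.coord (centerOfGravity C) 1 - t 1 := hstep 0
  have h1 : Δ.coord (centerOfGravity C) 1 - t 1 = Δ.coord (centerOfGravity C) 2 - t 2 := hstep 1
  fin_cases i
  · change Δ.coord (centerOfGravity C) 0 = t 0 - _
    linarith
  · change Δ.coord (centerOfGravity C) 1 = t 1 - _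
    linarith
  · change Δ.coord (centerOfGravity C) 2 = t 2 - _
    linarith

theorem isBounded_cell (n : Fin 3 → ℤ) : Bornology.IsBounded (Δ.cell η n) := by
  have hK : IsCompact (Δ.recon '' Set.Icc (fun i => Δ.level η i (n i))
      (fun i => Δ.level η i (n i + 1))) := isCompact_Icc.image Δ.continuous_recon
  refine hK.isBounded.subset fun x hx => ⟨Δ.coord x, ⟨fun i => (hx i).1.le, fun i => (hx i).2.le⟩,
    Δ.recon_coord x⟩

theorem forall_fin_three_add_one_iff {P : Fin 3 → Prop} : (∀ i, P (i + 1)) ↔ ∀ i, P i := by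
  constructor
  · intro h i
    have := h (i + 2)
    rw [add_assoc] at this
    simpa using this
  · exact fun h i => h _

theorem coord_rotation_add (x : ℝ × ℝ) (t : Fin 3 → ℝ) (i : Fin 3) :
    Δ.coord (Δ.rotation x + Δ.recon (fun i => t i - t (i + 1))) i =
      Δ.coord x (i + 1) - t (i + 1) + t i := by
  rw [map_add, Pi.add_apply, coord_rotation, coord_recon]
  · ring
  · change t 0 - t 1 + (t 1 - t 2) + (t 2 - t 0) = 0
    ring

/-- The triangle is cut out by the same inequality on each shifted coordinate, so it is invariant
under their cyclic permutation. -/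
theorem IsGood.centerOfGravity_whiteCell (hη : Δ.IsGood η) {n : Fin 3 → ℤ}
    (hn : n 0 + n 1 + n 2 = 0) : centerOfGravity (Δ.whiteCell η n) = Δ.node η n := by
  refine Δ.coord_injective (funext fun i => ?_)
  rw [coord_node]
  refine coord_centerOfGravity ?_ ⟨_, hη.node_mem_whiteCell hn⟩ ?_
    (fun i => Δ.level η i (n i)) (fun x => ?_) i
  · rw [← hη.cell_eq_whiteCell hn]; exact Δ.isOpen_cell n
  · rw [← hη.cell_eq_whiteCell hn]; exact isBounded_cell n
  · simp only [whiteCell, Set.mem_ofPred_eq]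
    simp only [coord_rotation_add x (fun i => Δ.level η i (n i)), lt_add_iff_pos_left, sub_pos]
    rw [forall_fin_three_add_one_iff (P := fun i => Δ.level η i (n i) < Δ.coord x i)]

theorem IsGood.centerOfGravity_blackCell (hη : Δ.IsGood η) {n : Fin 3 → ℤ}
    (hn : n 0 + n 1 + n 2 = 1) : centerOfGravity (Δ.blackCell η n) = Δ.node η n := by
  refine Δ.coord_injective (funext fun i => ?_)
  rw [coord_node]
  refine coord_centerOfGravity ?_ ⟨_, hη.node_mem_blackCell hn⟩ ?_
    (fun i => Δ.level η i (n i)) (fun x => ?_) i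
  · rw [← hη.cell_eq_blackCell hn]; exact Δ.isOpen_cell _
  · rw [← hη.cell_eq_blackCell hn]; exact isBounded_cell _
  · simp only [blackCell, Set.mem_ofPred_eq]
    simp only [coord_rotation_add x (fun i => Δ.level η i (n i)), add_lt_iff_neg_right, sub_neg]
    rw [forall_fin_three_add_one_iff (P := fun i => Δ.coord x i < Δ.level η i (n i))]

/-! ### The graph of an admissible arrangement -/

/-- Raise one index by one. -/
def raise (n : Fin 3 → ℤ) (i : Fin 3) : Fin 3 → ℤ := n + Pi.single i 1

theorem raise_self (n : Fin 3 → ℤ) (i : Fin 3) : raise n i i = n i + 1 := by simp [raise]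

theorem raise_of_ne (n : Fin 3 → ℤ) {i j : Fin 3} (h : j ≠ i) : raise n i j = n j := by
  simp [raise, h]

theorem raise_sum (n : Fin 3 → ℤ) (i : Fin 3) :
    raise n i 0 + raise n i 1 + raise n i 2 = n 0 + n 1 + n 2 + 1 := by
  fin_cases i <;> simp [raise] <;> ring

theorem levelSum_raise (η : Δ.Edge → ℝ) (n : Fin 3 → ℤ) (i : Fin 3) :
    Δ.levelSum η (raise n i) =
      Δ.levelSum η n - Δ.level η i (n i) + Δ.level η i (n i + 1) := by
  fin_cases i <;> simp [levelSum, raise] <;> ring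

theorem exists_eq_raise {n N : Fin 3 → ℤ} (h : ∀ i, n i ≤ N i) (hn : n 0 + n 1 + n 2 = 0)
    (hN : N 0 + N 1 + N 2 = 1) : ∃ i, N = raise n i := by
  have h0 := h 0
  have h1 := h 1
  have h2 := h 2
  have key : N 0 = n 0 + 1 ∧ N 1 = n 1 ∧ N 2 = n 2 ∨ N 0 = n 0 ∧ N 1 = n 1 + 1 ∧ N 2 = n 2 ∨
    N 0 = n 0 ∧ N 1 = n 1 ∧ N 2 = n 2 + 1 := by omega
  rcases key with ⟨a, b, d⟩ | ⟨a, b, d⟩ | ⟨a, b, d⟩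
  · refine ⟨0, funext fun j => ?_⟩
    fin_cases j <;> simp [raise, a, b, d]
  · refine ⟨1, funext fun j => ?_⟩
    fin_cases j <;> simp [raise, a, b, d]
  · refine ⟨2, funext fun j => ?_⟩
    fin_cases j <;> simp [raise, a, b, d]

/-- The vertex shared by a black and a white triangle. -/
theorem IsGood.exists_vertex (hη : Δ.IsGood η) (h : Δ.Enumerates η c) {n : Fin 3 → ℤ}
    (hn : n 0 + n 1 + n 2 = 0) (i : Fin 3) :
    ∃ v, IsVertex (Δ.arrangement c) v ∧ v ∈ frontier (Δ.blackCell η (raise n i)) ∧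
      v ∈ frontier (Δ.whiteCell η n) := by
  have hm := hη.strictMono
  have hN : raise n i 0 + raise n i 1 + raise n i 2 = 1 := by rw [raise_sum, hn, zero_add]
  have hsum : ∑ j, (if j = i then Δ.levelSum η n else 0) = Δ.levelSum η n := by simp
  rw [Fin.sum_univ_three] at hsum
  -- The black and the white triangle share their lines in the two directions other than `i`; `v` is
  -- the crossing of these. Its `i`-th coordinate is forced by the sum zero.
  obtain ⟨v, hv⟩ := Δ.exists_coord_eq
    (fun j => Δ.level η j (n j) - if j = i then Δ.levelSum η n else 0) (by
      have : Δ.levelSum η n = Δ.level η 0 (n 0) + Δ.level η 1 (n 1) + Δ.level η 2 (n 2) := rfl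
      linarith)
  have hvj : ∀ j, j ≠ i → Δ.coord v j = Δ.level η j (n j) := fun j hj => by
    rw [hv]; simp [hj]
  have hvi : Δ.coord v i = Δ.level η i (n i) - Δ.levelSum η n := by rw [hv]; simp
  have hneg := (hη n).1 hn
  have hpos := (hη _).2 hN
  rw [levelSum_raise] at hpos
  have hi : i + 1 ≠ i := by fin_cases i <;> decide
  have hi' : i + 2 ≠ i := by fin_cases i <;> decide
  have hi'' : i + 1 ≠ i + 2 := by fin_cases i <;> decide
  refine ⟨v, ?_, ?_, ?_⟩
  · obtain ⟨k, hk⟩ := (Δ.exists_mem_preimage_iff h (i + 1) v).2 ⟨_, hvj _ hi⟩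
    obtain ⟨k', hk'⟩ := (Δ.exists_mem_preimage_iff h (i + 2) v).2 ⟨_, hvj _ hi'⟩
    exact ⟨_, _, fun he => hi'' (congrArg Sigma.fst he), hk, hk'⟩
  · rw [← hη.cell_eq_blackCell hN]
    refine Δ.mem_frontier_cell hm ?_ (fun j => ?_) (hvj _ hi)
    · rw [hη.cell_eq_blackCell hN]; exact ⟨_, hη.node_mem_blackCell hN⟩
    · simp only [Pi.sub_apply, Pi.one_apply, sub_add_cancel]
      by_cases hj : j = i
      · subst hj
        rw [raise_self, add_sub_cancel_right, hvi]
        constructor <;> linarith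
      · rw [raise_of_ne n hj, hvj j hj]
        exact ⟨(hm j).monotone (by omega), le_rfl⟩
  · rw [← hη.cell_eq_whiteCell hn]
    refine Δ.mem_frontier_cell hm ?_ (fun j => ?_) (hvj _ hi)
    · rw [hη.cell_eq_whiteCell hn]; exact ⟨_, hη.node_mem_whiteCell hn⟩
    · by_cases hj : j = i
      · subst hj
        rw [hvi]
        constructor <;> linarith
      · rw [hvj j hj]
        exact ⟨le_rfl, (hm j).monotone (by omega)⟩

variable (Δ) in
/-- The graph whose nodes are the centroids of the triangles described by `η`. -/
def latticeGraph (η : Δ.Edge → ℝ) : ColoredGraph where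
  black := {p | ∃ n : Fin 3 → ℤ, n 0 + n 1 + n 2 = 1 ∧ p = proj (Δ.node η n)}
  white := {p | ∃ n : Fin 3 → ℤ, n 0 + n 1 + n 2 = 0 ∧ p = proj (Δ.node η n)}
  edges := {e | ∃ (n : Fin 3 → ℤ) (i : Fin 3), n 0 + n 1 + n 2 = 0 ∧
    e = segmentPath (Δ.node η (raise n i)) (Δ.node η n)}

theorem IsGood.graphOf_eq (hη : Δ.IsGood η) (h : Δ.Enumerates η c) :
    graphOf (Δ.arrangement c) = Δ.latticeGraph η := by
  have hw := hη.isWhite_iff h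
  have hb := hη.isBlack_iff h
  ext x
  · constructor
    · rintro ⟨C, hC, rfl⟩
      obtain ⟨n, hn, rfl⟩ := (hb C).1 hC
      exact ⟨n, hn, by rw [hη.centerOfGravity_blackCell hn]⟩
    · rintro ⟨n, hn, rfl⟩
      exact ⟨_, (hb _).2 ⟨n, hn, rfl⟩, by rw [hη.centerOfGravity_blackCell hn]⟩
  · constructor
    · rintro ⟨C, hC, rfl⟩
      obtain ⟨n, hn, rfl⟩ := (hw C).1 hC
      exact ⟨n, hn, by rw [hη.centerOfGravity_whiteCell hn]⟩
    · rintro ⟨n, hn, rfl⟩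
      exact ⟨_, (hw _).2 ⟨n, hn, rfl⟩, by rw [hη.centerOfGravity_whiteCell hn]⟩
  · constructor
    · rintro ⟨B, C, v, hB, hC, -, hvB, hvC, rfl⟩
      obtain ⟨N, hN, rfl⟩ := (hb B).1 hB
      obtain ⟨n, hn, rfl⟩ := (hw C).1 hC
      -- The shared vertex is weakly left of the lines of the white triangle and weakly right of
      -- those of the black one. With index sums 0 and 1, exactly one index differs.
      have hnN : ∀ i, n i ≤ N i := by
        intro i
        have h1 : Δ.coord v i ≤ Δ.level η i (N i) := closure_minimal
          (t := {x | Δ.coord x i ≤ Δ.level η i (N i)}) (fun x hx => (hx i).le)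
          (isClosed_le (Δ.continuous_coord_apply i) continuous_const)
          (frontier_subset_closure hvB)
        have h2 : Δ.level η i (n i) ≤ Δ.coord v i := closure_minimal
          (t := {x | Δ.level η i (n i) ≤ Δ.coord x i}) (fun x hx => (hx i).le)
          (isClosed_le continuous_const (Δ.continuous_coord_apply i))
          (frontier_subset_closure hvC)
        exact (hη.strictMono i).le_iff_le.1 (h2.trans h1)
      obtain ⟨i, rfl⟩ := exists_eq_raise hnN hn hN
      exact ⟨n, i, hn, by
        rw [hη.centerOfGravity_whiteCell hn, hη.centerOfGravity_blackCell hN]⟩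
    · rintro ⟨n, i, hn, rfl⟩
      obtain ⟨v, hv, hvB, hvC⟩ := hη.exists_vertex h hn i
      have hN : raise n i 0 + raise n i 1 + raise n i 2 = 1 := by rw [raise_sum, hn, zero_add]
      exact ⟨_, _, v, (hb _).2 ⟨_, hN, rfl⟩, (hw _).2 ⟨n, hn, rfl⟩, hv, hvB, hvC, by
        rw [hη.centerOfGravity_whiteCell hn, hη.centerOfGravity_blackCell hN]⟩

end LatticeTriangle

namespace LatticeTriangle

/-! ### Points of the graph -/

variable {Δ : LatticeTriangle} {η : Δ.Edge → ℝ}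

variable (Δ) in
/-- The point with parameter `r` on the edge from the black node `raise n i` to the white
node `n`. -/
def edgePoint (η : Δ.Edge → ℝ) (n : Fin 3 → ℤ) (i : Fin 3) (r : ℝ) : ℝ × ℝ :=
  AffineMap.lineMap (Δ.node η (raise n i)) (Δ.node η n) r

variable (Δ) in
/-- The point on a spatial staircase that projects to a given point of an edge of the graph. -/
def stairPoint (η : Δ.Edge → ℝ) (n : Fin 3 → ℤ) (i : Fin 3) (r : ℝ) (j : Fin 3) : ℝ :=
  (1 - r) * Δ.level η j (raise n i j) + r * Δ.level η j (n j)

theorem coord_edgePoint (η : Δ.Edge → ℝ) (n : Fin 3 → ℤ) (i : Fin 3) (r : ℝ) (j : Fin 3) :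
    Δ.coord (Δ.edgePoint η n i r) j = Δ.stairPoint η n i r j -
      (Δ.stairPoint η n i r 0 + Δ.stairPoint η n i r 1 + Δ.stairPoint η n i r 2) / 3 := by
  simp only [edgePoint, AffineMap.lineMap_apply_module, map_add, map_smul, Pi.add_apply,
    Pi.smul_apply, smul_eq_mul, coord_node, stairPoint, levelSum]
  ring

theorem edgePoint_zero (η : Δ.Edge → ℝ) (n : Fin 3 → ℤ) (i : Fin 3) :
    Δ.edgePoint η n i 0 = Δ.node η (raise n i) := AffineMap.lineMap_apply_zero _ _

theorem edgePoint_one (η : Δ.Edge → ℝ) (n : Fin 3 → ℤ) (i : Fin 3) :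
    Δ.edgePoint η n i 1 = Δ.node η n := AffineMap.lineMap_apply_one _ _

/-- Two parameters describe the same point of the graph in the plane. -/
def SamePoint (n : Fin 3 → ℤ) (i : Fin 3) (r : ℝ) (n' : Fin 3 → ℤ) (i' : Fin 3) (r' : ℝ) : Prop :=
  (n = n' ∧ i = i' ∧ r = r') ∨ (n = n' ∧ r = 1 ∧ r' = 1) ∨
    (raise n i = raise n' i' ∧ r = 0 ∧ r' = 0)

theorem SamePoint.edgePoint_eq {n n' : Fin 3 → ℤ} {i i' : Fin 3} {r r' : ℝ}
    (h : SamePoint n i r n' i' r') (η : Δ.Edge → ℝ) :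
    Δ.edgePoint η n i r = Δ.edgePoint η n' i' r' := by
  rcases h with ⟨rfl, rfl, rfl⟩ | ⟨rfl, rfl, rfl⟩ | ⟨h, rfl, rfl⟩
  · rfl
  · rw [edgePoint_one, edgePoint_one]
  · rw [edgePoint_zero, edgePoint_zero, h]

theorem stairPoint_mem (hm : ∀ i, StrictMono (Δ.level η i)) (n : Fin 3 → ℤ) (i : Fin 3) {r : ℝ}
    (hr : r ∈ Set.Icc (0 : ℝ) 1) (j : Fin 3) :
    Δ.level η j (n j) ≤ Δ.stairPoint η n i r j ∧
      Δ.stairPoint η n i r j ≤ Δ.level η j (raise n i j) := by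
  have h : Δ.level η j (n j) ≤ Δ.level η j (raise n i j) := by
    refine (hm j).monotone ?_
    by_cases hj : j = i
    · rw [hj, raise_self]; omega
    · rw [raise_of_ne n hj]
  unfold stairPoint
  constructor <;> nlinarith [hr.1, hr.2]

theorem stairPoint_self (η : Δ.Edge → ℝ) (n : Fin 3 → ℤ) (i : Fin 3) (r : ℝ) :
    Δ.stairPoint η n i r i = (1 - r) * Δ.level η i (n i + 1) + r * Δ.level η i (n i) := by
  rw [stairPoint, raise_self]

theorem stairPoint_of_ne (η : Δ.Edge → ℝ) (n : Fin 3 → ℤ) {i j : Fin 3} (h : j ≠ i) (r : ℝ) :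
    Δ.stairPoint η n i r j = Δ.level η j (n j) := by
  rw [stairPoint, raise_of_ne n h]
  ring

/-- The staircase does not contain different points on a line in the direction of the diagonal. -/
theorem not_forall_stairPoint_lt (hm : ∀ i, StrictMono (Δ.level η i)) {n n' : Fin 3 → ℤ}
    {i i' : Fin 3} {r r' : ℝ} (hn : n 0 + n 1 + n 2 = 0) (hn' : n' 0 + n' 1 + n' 2 = 0)
    (hr : r ∈ Set.Icc (0 : ℝ) 1) (hr' : r' ∈ Set.Icc (0 : ℝ) 1) :
    ¬ ∀ j, Δ.stairPoint η n' i' r' j < Δ.stairPoint η n i r j := by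
  intro h
  have hlt : ∀ j, n' j < raise n i j := fun j => (hm j).lt_iff_lt.1
    (((stairPoint_mem hm n' i' hr' j).1.trans_lt (h j)).trans_le (stairPoint_mem hm n i hr j).2)
  have h0 := hlt 0
  have h1 := hlt 1
  have h2 := hlt 2
  have := raise_sum n i
  omega

/-- Points of the staircase with equal projections differ by a multiple of the diagonal, which must
be zero since neither exceeds the other in all coordinates. It remains to see when two segments of
the staircase meet. -/
theorem samePoint_of_edgePoint_eq (hm : ∀ i, StrictMono (Δ.level η i)) {n n' : Fin 3 → ℤ}
    {i i' : Fin 3} {r r' : ℝ} (hn : n 0 + n 1 + n 2 = 0) (hn' : n' 0 + n' 1 + n' 2 = 0)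
    (hr : r ∈ Set.Icc (0 : ℝ) 1) (hr' : r' ∈ Set.Icc (0 : ℝ) 1)
    (h : Δ.edgePoint η n i r = Δ.edgePoint η n' i' r') : SamePoint n i r n' i' r' := by
  have hX : ∀ j, Δ.stairPoint η n i r j = Δ.stairPoint η n' i' r' j := by
    have hd : ∀ j, Δ.stairPoint η n i r j - (Δ.stairPoint η n i r 0 +
        Δ.stairPoint η n i r 1 + Δ.stairPoint η n i r 2) / 3 = Δ.stairPoint η n' i' r' j -
        (Δ.stairPoint η n' i' r' 0 + Δ.stairPoint η n' i' r' 1 +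
          Δ.stairPoint η n' i' r' 2) / 3 := by
      intro j
      rw [← coord_edgePoint, ← coord_edgePoint, h]
    rcases lt_trichotomy (Δ.stairPoint η n i r 0 + Δ.stairPoint η n i r 1 +
      Δ.stairPoint η n i r 2) (Δ.stairPoint η n' i' r' 0 + Δ.stairPoint η n' i' r' 1 +
          Δ.stairPoint η n' i' r' 2) with hlt | heq | hgt
    · exact (not_forall_stairPoint_lt hm hn' hn hr' hr fun j => by linarith [hd j]).elim
    · exact fun j => by linarith [hd j]
    · exact (not_forall_stairPoint_lt hm hn hn' hr hr' fun j => by linarith [hd j]).elim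
  have hle : ∀ j, n' j ≤ raise n i j := fun j => (hm j).le_iff_le.1
    (((stairPoint_mem hm n' i' hr' j).1.trans (hX j).ge).trans (stairPoint_mem hm n i hr j).2)
  have hle' : ∀ j, n j ≤ raise n' i' j := fun j => (hm j).le_iff_le.1
    (((stairPoint_mem hm n i hr j).1.trans (hX j).le).trans (stairPoint_mem hm n' i' hr' j).2)
  have hsum : ∀ (p : Fin 3 → ℤ), p 0 + p 1 + p 2 = p i + p (i + 1) + p (i + 2) := by
    intro p
    fin_cases i
    · rfl
    · change p 0 + p 1 + p 2 = p 1 + p 2 + p 0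
      ring
    · change p 0 + p 1 + p 2 = p 2 + p 0 + p 1
      ring
  have hcover : ∀ j : Fin 3, j = i ∨ j = i + 1 ∨ j = i + 2 := by
    intro j
    fin_cases i <;> fin_cases j <;> decide
  have hs := hsum n
  have hs' := hsum n'
  have hi1 : i + 1 ≠ i := by fin_cases i <;> decide
  have hi2 : i + 2 ≠ i := by fin_cases i <;> decide
  have hi12 : i + 1 ≠ i + 2 := by fin_cases i <;> decide
  have hgap : ∀ j k, Δ.level η j k < Δ.level η j (k + 1) := fun j k => hm j (by omega)
  -- Parallel segments that meet agree in two indices, hence in the third by the index sum, and then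
  -- in the parameter.
  by_cases hii : i' = i
  · subst hii
    have e1 := hle (i' + 1)
    have e2 := hle (i' + 2)
    have e1' := hle' (i' + 1)
    have e2' := hle' (i' + 2)
    rw [raise_of_ne _ hi1] at e1 e1'
    rw [raise_of_ne _ hi2] at e2 e2'
    have hnn : n = n' := by
      funext j
      rcases hcover j with rfl | rfl | rfl <;> omega
    subst hnn
    refine Or.inl ⟨rfl, rfl, ?_⟩
    have h1 := hX i'
    rw [stairPoint_self, stairPoint_self] at h1
    have h2 := hgap i' (n i')
    have h3 : (r - r') * (Δ.level η i' (n i' + 1) - Δ.level η i' (n i')) = 0 := by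
      linear_combination -h1
    rcases mul_eq_zero.1 h3 with h4 | h4 <;> linarith
  · have hXi := hX i
    rw [stairPoint_self, stairPoint_of_ne _ _ (Ne.symm hii)] at hXi
    have hXi' := hX i'
    rw [stairPoint_self, stairPoint_of_ne _ _ hii] at hXi'
    have hga := hgap i (n i)
    have hgb := hgap i' (n' i')
    have hthird : ∀ j, j ≠ i → j ≠ i' → n j = n' j := by
      intro j h1 h2
      have e1 := hle j
      have e2 := hle' j
      rw [raise_of_ne _ h1] at e1
      rw [raise_of_ne _ h2] at e2
      omega
    have hsi : n i + n i' = n' i + n' i' := by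
      rcases hcover i' with h1 | rfl | rfl
      · exact (hii h1).elim
      · have := hthird (i + 2) hi2 hi12.symm
        omega
      · have := hthird (i + 1) hi1 hi12
        omega
    have e1 := hle i
    have e2 := hle' i
    rw [raise_self] at e1
    rw [raise_of_ne _ (Ne.symm hii)] at e2
    -- For segments in different directions, `n' i` is `n i` or `n i + 1`. In the first case they
    -- meet in a common white node, in the second in a common black node.
    rcases e2.eq_or_lt with h1 | h1
    · have hnn : n = n' := by
        funext j
        by_cases hj : j = i
        · rw [hj, h1]
        · by_cases hj' : j = i'
          · rw [hj']; omega
          · exact hthird j hj hj'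
      subst hnn
      refine Or.inr (Or.inl ⟨rfl, ?_, ?_⟩)
      · have h3 : (1 - r) * (Δ.level η i (n i + 1) - Δ.level η i (n i)) = 0 := by
          linear_combination hXi
        rcases mul_eq_zero.1 h3 with h4 | h4 <;> linarith
      · have h3 : (1 - r') * (Δ.level η i' (n i' + 1) - Δ.level η i' (n i')) = 0 := by
          linear_combination -hXi'
        rcases mul_eq_zero.1 h3 with h4 | h4 <;> linarith
    · have h2 : n' i = n i + 1 := by omega
      have h2' : n i' = n' i' + 1 := by omega
      rw [h2] at hXi
      rw [h2'] at hXi'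
      refine Or.inr (Or.inr ⟨?_, ?_, ?_⟩)
      · funext j
        by_cases hj : j = i
        · rw [hj, raise_self, raise_of_ne _ (Ne.symm hii), h2]
        · by_cases hj' : j = i'
          · rw [hj', raise_self, raise_of_ne _ hii, h2']
          · rw [raise_of_ne _ hj, raise_of_ne _ hj', hthird j hj hj']
      · have h3 : r * (Δ.level η i (n i + 1) - Δ.level η i (n i)) = 0 := by
          linear_combination -hXi
        rcases mul_eq_zero.1 h3 with h4 | h4 <;> linarith
      · have h3 : r' * (Δ.level η i' (n' i' + 1) - Δ.level η i' (n' i')) = 0 := by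
          linear_combination hXi'
        rcases mul_eq_zero.1 h3 with h4 | h4 <;> linarith

/-! ### Periodicity -/

theorem raise_add (n m : Fin 3 → ℤ) (i : Fin 3) : raise (n + m) i = raise n i + m := by
  unfold raise
  rw [add_right_comm]

/-- The coordinates of an integral point are multiples of the lattice lengths, so adding them to the
indices adds them to the levels. -/
theorem node_add (η : Δ.Edge → ℝ) (n : Fin 3 → ℤ) (m : ℤ × ℤ) :
    Δ.node η (n + Δ.intCoord m) = Δ.node η n + intPoint m := by
  refine Δ.coord_injective (funext fun i => ?_)
  have hlev : ∀ j, Δ.level η j ((n + Δ.intCoord m) j) = Δ.level η j (n j) + Δ.intCoord m j :=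
    fun j => Δ.level_add_of_dvd η j (n j) (Δ.latticeLength_dvd_intCoord m j)
  have hs : (Δ.intCoord m 0 : ℝ) + Δ.intCoord m 1 + Δ.intCoord m 2 = 0 := by
    exact_mod_cast Δ.intCoord_sum m
  rw [map_add, Pi.add_apply, coord_node, coord_node, coord_intPoint, levelSum, hlev, hlev, hlev,
    hlev, levelSum]
  linear_combination -(hs / 3)

theorem edgePoint_add (η : Δ.Edge → ℝ) (n : Fin 3 → ℤ) (i : Fin 3) (r : ℝ) (m : ℤ × ℤ) :
    Δ.edgePoint η (n + Δ.intCoord m) i r = Δ.edgePoint η n i r + intPoint m := by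
  unfold edgePoint
  rw [raise_add, node_add, node_add, AffineMap.lineMap_apply_module,
    AffineMap.lineMap_apply_module]
  module

theorem index_sum_add {n : Fin 3 → ℤ} (hn : n 0 + n 1 + n 2 = 0) (m : ℤ × ℤ) :
    (n + Δ.intCoord m) 0 + (n + Δ.intCoord m) 1 + (n + Δ.intCoord m) 2 = 0 := by
  have := Δ.intCoord_sum m
  simp only [Pi.add_apply]
  omega

/-- Coincidence of points of the graph on the torus does not depend on the deviations. -/
theorem proj_edgePoint_eq_iff (hm : ∀ i, StrictMono (Δ.level η i)) {n n' : Fin 3 → ℤ}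
    {i i' : Fin 3} {r r' : ℝ} (hn : n 0 + n 1 + n 2 = 0) (hn' : n' 0 + n' 1 + n' 2 = 0)
    (hr : r ∈ Set.Icc (0 : ℝ) 1) (hr' : r' ∈ Set.Icc (0 : ℝ) 1) :
    proj (Δ.edgePoint η n i r) = proj (Δ.edgePoint η n' i' r') ↔
      ∃ m, SamePoint n i r (n' + Δ.intCoord m) i' r' := by
  rw [proj_eq_proj_iff]
  refine exists_congr fun m => ?_
  rw [← edgePoint_add]
  exact ⟨samePoint_of_edgePoint_eq hm hn (index_sum_add hn' m) hr hr', fun h => h.edgePoint_eq η⟩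

theorem proj_edgePoint_add (η : Δ.Edge → ℝ) (n : Fin 3 → ℤ) (i : Fin 3) (r : ℝ) (m : ℤ × ℤ) :
    proj (Δ.edgePoint η (n + Δ.intCoord m) i r) = proj (Δ.edgePoint η n i r) := by
  rw [edgePoint_add, proj_eq_proj_iff]
  exact ⟨m, rfl⟩

variable (Δ) in
/-- There are finitely many white nodes up to translation. -/
theorem exists_finite_indices : ∃ S : Set (Fin 3 → ℤ), S.Finite ∧
    (∀ n ∈ S, n 0 + n 1 + n 2 = 0) ∧
    ∀ n : Fin 3 → ℤ, n 0 + n 1 + n 2 = 0 → ∃ m, n + Δ.intCoord m ∈ S := by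
  obtain ⟨B, hB, hB'⟩ : ∃ B, B = Δ.signedArea.sign * Δ.signedArea ∧ 0 < B := by
    refine ⟨_, rfl, ?_⟩
    rcases lt_or_gt_of_ne Δ.signedArea_ne_zero with h | h
    · rw [Int.sign_eq_neg_one_of_neg h]; omega
    · rw [Int.sign_eq_one_of_pos h]; omega
  refine ⟨(fun p : ℤ × ℤ => ![-p.1 - p.2, p.1, p.2]) '' (Set.Ico 0 B ×ˢ Set.Ico 0 B),
    ((Set.finite_Ico 0 B).prod (Set.finite_Ico 0 B)).image _, ?_, fun n hn => ?_⟩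
  · rintro _ ⟨p, -, rfl⟩
    simp only [Matrix.cons_val]
    ring
  -- By Cramer's rule every pair of multiples of the determinant `B` occurs as the last two
  -- coordinates of an integral point, so these two indices can be reduced modulo `B`.
  · obtain ⟨m, hm1, hm2⟩ : ∃ m, Δ.intCoord m 1 = -(B * (n 1 / B)) ∧
        Δ.intCoord m 2 = -(B * (n 2 / B)) := by
      refine ⟨(-(n 1 / B) * (Δ.side 2).2 + n 2 / B * (Δ.side 1).2,
        -(n 2 / B) * (Δ.side 1).1 + n 1 / B * (Δ.side 2).1), ?_, ?_⟩
      · simp only [intCoord]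
        linear_combination n 1 / B * hB - Δ.signedArea.sign * (n 1 / B) * Δ.side_det
      · simp only [intCoord]
        linear_combination n 2 / B * hB - Δ.signedArea.sign * (n 2 / B) * Δ.side_det
    have hs := index_sum_add (Δ := Δ) hn m
    have h1 := Int.emod_def (n 1) B
    have h2 := Int.emod_def (n 2) B
    refine ⟨m, (n 1 % B, n 2 % B), ⟨⟨Int.emod_nonneg _ hB'.ne', Int.emod_lt_of_pos _ hB'⟩,
      Int.emod_nonneg _ hB'.ne', Int.emod_lt_of_pos _ hB'⟩, funext fun j => ?_⟩
    simp only [Pi.add_apply] at hs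
    fin_cases j
    · change -(n 1 % B) - n 2 % B = n 0 + Δ.intCoord m 0
      omega
    · change n 1 % B = n 1 + Δ.intCoord m 1
      omega
    · change n 2 % B = n 2 + Δ.intCoord m 2
      omega

/-! ### The graph is an embedded bicolored graph -/

theorem segmentPath_apply (η : Δ.Edge → ℝ) (n : Fin 3 → ℤ) (i : Fin 3) (t : unitInterval) :
    segmentPath (Δ.node η (raise n i)) (Δ.node η n) t = proj (Δ.edgePoint η n i t) := rfl

theorem exists_raise_eq {n : Fin 3 → ℤ} (hn : n 0 + n 1 + n 2 = 1) :
    ∃ p : Fin 3 → ℤ, p 0 + p 1 + p 2 = 0 ∧ raise p 0 = n := by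
  refine ⟨n - Pi.single 0 1, ?_, by simp [raise]⟩
  simp
  omega

theorem mem_black_iff (η : Δ.Edge → ℝ) (p : Torus) : p ∈ (Δ.latticeGraph η).black ↔
    ∃ (n : Fin 3 → ℤ) (i : Fin 3), n 0 + n 1 + n 2 = 0 ∧ p = proj (Δ.edgePoint η n i 0) := by
  constructor
  · rintro ⟨N, hN, rfl⟩
    obtain ⟨n, hn, rfl⟩ := exists_raise_eq hN
    exact ⟨n, 0, hn, by rw [edgePoint_zero]⟩
  · rintro ⟨n, i, hn, rfl⟩
    exact ⟨raise n i, by rw [raise_sum, hn, zero_add], by rw [edgePoint_zero]⟩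

theorem mem_white_iff (η : Δ.Edge → ℝ) (p : Torus) : p ∈ (Δ.latticeGraph η).white ↔
    ∃ (n : Fin 3 → ℤ) (i : Fin 3), n 0 + n 1 + n 2 = 0 ∧ p = proj (Δ.edgePoint η n i 1) := by
  simp only [edgePoint_one]
  constructor
  · rintro ⟨n, hn, rfl⟩
    exact ⟨n, 0, hn, rfl⟩
  · rintro ⟨n, -, hn, rfl⟩
    exact ⟨n, hn, rfl⟩

theorem mem_support_iff (η : Δ.Edge → ℝ) (p : Torus) : p ∈ (Δ.latticeGraph η).support ↔
    ∃ (n : Fin 3 → ℤ) (i : Fin 3) (t : unitInterval), n 0 + n 1 + n 2 = 0 ∧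
      p = proj (Δ.edgePoint η n i t) := by
  constructor
  · rintro ((h | h) | h)
    · obtain ⟨n, i, hn, rfl⟩ := (mem_black_iff η p).1 h
      exact ⟨n, i, 0, hn, rfl⟩
    · obtain ⟨n, i, hn, rfl⟩ := (mem_white_iff η p).1 h
      exact ⟨n, i, 1, hn, rfl⟩
    · obtain ⟨e, ⟨n, i, hn, rfl⟩, t, rfl⟩ := Set.mem_iUnion₂.1 h
      exact ⟨n, i, t, hn, rfl⟩
  · rintro ⟨n, i, t, hn, rfl⟩
    exact Or.inr (Set.mem_biUnion ⟨n, i, hn, rfl⟩ ⟨t, rfl⟩)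

theorem isBicoloredGraph_latticeGraph (hm : ∀ i, StrictMono (Δ.level η i)) :
    (Δ.latticeGraph η).IsBicoloredGraph := by
  obtain ⟨S, hS, -, hSm⟩ := exists_finite_indices Δ
  -- The parameter along an edge is a well-defined function on the graph in the torus, with value 0
  -- at black and 1 at white nodes.
  have hparam : ∀ {n n' : Fin 3 → ℤ} {i i' : Fin 3} {t t' : unitInterval},
      n 0 + n 1 + n 2 = 0 → n' 0 + n' 1 + n' 2 = 0 →
      proj (Δ.edgePoint η n i t) = proj (Δ.edgePoint η n' i' t') → t = t' := by
    intro n n' i i' t t' hn hn' h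
    obtain ⟨m, h⟩ := (proj_edgePoint_eq_iff hm hn hn' t.2 t'.2).1 h
    rcases h with ⟨-, -, h⟩ | ⟨-, h, h'⟩ | ⟨-, h, h'⟩
    · exact Subtype.ext h
    · exact Subtype.ext (h.trans h'.symm)
    · exact Subtype.ext (h.trans h'.symm)
  have hnode : ∀ p ∈ (Δ.latticeGraph η).nodes, ∃ (n : Fin 3 → ℤ) (i : Fin 3) (t : unitInterval),
      n 0 + n 1 + n 2 = 0 ∧ (t = 0 ∨ t = 1) ∧ p = proj (Δ.edgePoint η n i t) := by
    rintro p (h | h)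
    · obtain ⟨n, i, hn, rfl⟩ := (mem_black_iff η p).1 h
      exact ⟨n, i, 0, hn, Or.inl rfl, rfl⟩
    · obtain ⟨n, i, hn, rfl⟩ := (mem_white_iff η p).1 h
      exact ⟨n, i, 1, hn, Or.inr rfl, rfl⟩
  refine ⟨?_, ?_, ?_, ?_, ?_, ?_, ?_, ?_⟩
  · refine ((hS.prod (Set.finite_univ (α := Fin 3))).image
      fun q : (Fin 3 → ℤ) × Fin 3 => proj (Δ.edgePoint η q.1 q.2 0)).subset fun p hp => ?_
    obtain ⟨n, i, hn, rfl⟩ := (mem_black_iff η p).1 hp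
    obtain ⟨m, hm'⟩ := hSm n hn
    exact ⟨(_, i), ⟨hm', trivial⟩, proj_edgePoint_add η n i 0 m⟩
  · refine ((hS.prod (Set.finite_univ (α := Fin 3))).image
      fun q : (Fin 3 → ℤ) × Fin 3 => proj (Δ.edgePoint η q.1 q.2 1)).subset fun p hp => ?_
    obtain ⟨n, i, hn, rfl⟩ := (mem_white_iff η p).1 hp
    obtain ⟨m, hm'⟩ := hSm n hn
    exact ⟨(_, i), ⟨hm', trivial⟩, proj_edgePoint_add η n i 1 m⟩
  · rw [Set.disjoint_left]
    intro p hb hw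
    obtain ⟨n, i, hn, rfl⟩ := (mem_black_iff η p).1 hb
    obtain ⟨n', i', hn', h⟩ := (mem_white_iff η _).1 hw
    exact zero_ne_one (hparam (t := 0) (t' := 1) hn hn' h)
  · refine ((hS.prod (Set.finite_univ (α := Fin 3))).image fun q : (Fin 3 → ℤ) × Fin 3 =>
      segmentPath (Δ.node η (raise q.1 q.2)) (Δ.node η q.1)).subset ?_
    rintro _ ⟨n, i, hn, rfl⟩
    obtain ⟨m, hm'⟩ := hSm n hn
    refine ⟨(_, i), ⟨hm', trivial⟩, ContinuousMap.ext fun t => ?_⟩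
    exact proj_edgePoint_add η n i t m
  · rintro _ ⟨n, i, hn, rfl⟩
    exact Or.inl ⟨(mem_black_iff η _).2 ⟨n, i, hn, rfl⟩, (mem_white_iff η _).2 ⟨n, i, hn, rfl⟩⟩
  · rintro _ ⟨n, i, hn, rfl⟩
    rw [Set.disjoint_left]
    rintro _ ⟨t, ht, rfl⟩ hp
    obtain ⟨n', i', t', hn', ht', h⟩ := hnode _ hp
    rw [segmentPath_apply] at h
    have := hparam hn hn' h
    subst this
    rcases ht' with rfl | rfl
    · exact lt_irrefl _ ht.1
    · exact lt_irrefl _ ht.2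
  · rintro _ ⟨n, i, hn, rfl⟩ t - t' - h
    exact hparam hn hn h
  · rintro _ ⟨n, i, hn, rfl⟩ _ ⟨n', i', hn', rfl⟩ hne
    rw [Set.disjoint_left]
    rintro _ ⟨t, ht, rfl⟩ ⟨t', ht', h⟩
    apply hne
    rw [segmentPath_apply, segmentPath_apply] at h
    obtain ⟨m, h⟩ := (proj_edgePoint_eq_iff hm hn hn' t.2 t'.2).1 h.symm
    rcases h with ⟨rfl, rfl, -⟩ | ⟨-, h, -⟩ | ⟨-, h, -⟩
    · exact ContinuousMap.ext fun s => proj_edgePoint_add η n' i s m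
    · exact (ht.2.ne (Subtype.ext h)).elim
    · exact (ht.1.ne' (Subtype.ext h)).elim

/-! ### Isotopy -/

theorem continuous_edgePoint (η η' : Δ.Edge → ℝ) (n : Fin 3 → ℤ) (i : Fin 3) :
    Continuous fun q : unitInterval × unitInterval =>
      Δ.edgePoint (AffineMap.lineMap η η' (q.1 : ℝ)) n i q.2 := by
  have hnode : ∀ n, Continuous fun q : unitInterval × unitInterval =>
      Δ.node (AffineMap.lineMap η η' (q.1 : ℝ)) n := by
    intro n
    refine Δ.continuous_recon.comp (continuous_pi fun j => ?_)
    have hline : Continuous fun q : unitInterval × unitInterval =>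
        (AffineMap.lineMap η η' (q.1 : ℝ) : Δ.Edge → ℝ) :=
      AffineMap.lineMap_continuous.comp (continuous_subtype_val.comp continuous_fst)
    refine Continuous.sub ?_ (((continuous_levelSum n).comp hline).div_const 3)
    exact continuous_const.add ((continuous_apply _).comp hline)
  unfold edgePoint
  simp only [AffineMap.lineMap_apply_module]
  have h1 := hnode (raise n i)
  have h2 := hnode n
  simp only [AffineMap.lineMap_apply_module] at h1 h2
  fun_prop

/-- A function on a quotient of a compact space is continuous if it is so on the compact space. -/
theorem continuous_of_comp_surjective {K Z Y : Type*} [TopologicalSpace K] [TopologicalSpace Z]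
    [TopologicalSpace Y] [CompactSpace K] [T2Space Z] {f : K → Z} (hf : Continuous f)
    (hs : Function.Surjective f) {g : Z → Y} (hg : Continuous (g ∘ f)) : Continuous g :=
  (hf.isClosedMap.isQuotientMap hf hs).continuous_iff.2 hg

/-- Keeping the edge and the parameter while interpolating the deviations is well defined and
injective at each time, because the coincidences of points do not depend on the deviations. -/
theorem isotopic_latticeGraph {η' : Δ.Edge → ℝ} (hη : Δ.IsGood η) (hη' : Δ.IsGood η') :
    (Δ.latticeGraph η).Isotopic (Δ.latticeGraph η') := by
  obtain ⟨S, hS, hS0, hSm⟩ := exists_finite_indices Δ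
  have hm : ∀ τ : unitInterval, ∀ i, StrictMono (Δ.level (AffineMap.lineMap η η' (τ : ℝ)) i) :=
    fun τ => (hη.lineMap hη' τ.2).strictMono
  have hrep : ∀ x : (Δ.latticeGraph η).support, ∃ (n : Fin 3 → ℤ) (i : Fin 3) (t : unitInterval),
      n 0 + n 1 + n 2 = 0 ∧ (x : Torus) = proj (Δ.edgePoint η n i t) :=
    fun x => (mem_support_iff η _).1 x.2
  choose n i t hn hx using hrep
  have hF : ∀ (τ : unitInterval) (x : (Δ.latticeGraph η).support) (n' : Fin 3 → ℤ) (i' : Fin 3)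
      (t' : unitInterval), n' 0 + n' 1 + n' 2 = 0 → (x : Torus) = proj (Δ.edgePoint η n' i' t') →
      proj (Δ.edgePoint (AffineMap.lineMap η η' (τ : ℝ)) (n x) (i x) (t x)) =
        proj (Δ.edgePoint (AffineMap.lineMap η η' (τ : ℝ)) n' i' t') := by
    intro τ x n' i' t' hn' hx'
    rw [proj_edgePoint_eq_iff (hm τ) (hn x) hn' (t x).2 t'.2,
      ← proj_edgePoint_eq_iff hη.strictMono (hn x) hn' (t x).2 t'.2, ← hx, ← hx']
  have hmem : ∀ (n : Fin 3 → ℤ) (i : Fin 3) (t : unitInterval), n 0 + n 1 + n 2 = 0 →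
      proj (Δ.edgePoint η n i t) ∈ (Δ.latticeGraph η).support := fun n i t h =>
    (mem_support_iff η _).2 ⟨n, i, t, h, rfl⟩
  have hcont : Continuous fun q : unitInterval × (Δ.latticeGraph η).support =>
      proj (Δ.edgePoint (AffineMap.lineMap η η' (q.1 : ℝ)) (n q.2) (i q.2) (t q.2)) := by
    have : Finite S := hS
    -- The chosen parameters need not be continuous, but the product of interval and support is a
    -- quotient of finitely many squares, on which the deformation is given by an explicit formula.
    obtain ⟨f, hf1, hf2⟩ : ∃ f : (S × Fin 3) × (unitInterval × unitInterval) →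
        unitInterval × (Δ.latticeGraph η).support, (∀ q, (f q).1 = q.2.1) ∧
        ∀ q, ((f q).2 : Torus) = proj (Δ.edgePoint η q.1.1 q.1.2 q.2.2) :=
      ⟨fun q => (q.2.1, ⟨proj (Δ.edgePoint η q.1.1 q.1.2 q.2.2), hmem _ _ _ (hS0 _ q.1.1.2)⟩),
        fun _ => rfl, fun _ => rfl⟩
    have hf : Continuous f := by
      refine continuous_prod_of_discrete_left.2 fun d => ?_
      refine continuous_prodMk.2 ⟨?_, continuous_induced_rng.2 ?_⟩
      · simp only [hf1]
        exact continuous_fst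
      · simp only [Function.comp_def, hf2]
        refine continuous_proj.comp ?_
        exact AffineMap.lineMap_continuous.comp (continuous_subtype_val.comp continuous_snd)
    have hsurj : Function.Surjective f := by
      intro z
      obtain ⟨m, hm'⟩ := hSm (n z.2) (hn z.2)
      refine ⟨((⟨_, hm'⟩, i z.2), (z.1, t z.2)), Prod.ext (hf1 _) (Subtype.ext ?_)⟩
      rw [hf2]
      exact (proj_edgePoint_add η (n z.2) (i z.2) (t z.2) m).trans (hx z.2).symm
    refine continuous_of_comp_surjective hf hsurj (continuous_prod_of_discrete_left.2 fun d => ?_)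
    have heq : ∀ q : unitInterval × unitInterval,
        proj (Δ.edgePoint (AffineMap.lineMap η η' ((f (d, q)).1 : ℝ))
          (n (f (d, q)).2) (i (f (d, q)).2) (t (f (d, q)).2)) =
        proj (Δ.edgePoint (AffineMap.lineMap η η' (q.1 : ℝ)) d.1 d.2 q.2) := fun q => by
      rw [hF _ (f (d, q)).2 d.1 d.2 q.2 (hS0 _ d.1.2) (hf2 _), hf1]
    simp only [Function.comp_apply, heq]
    exact continuous_proj.comp (continuous_edgePoint η η' d.1 d.2)
  have hF1 : ∀ (x : (Δ.latticeGraph η).support) (n' : Fin 3 → ℤ) (i' : Fin 3)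
      (t' : unitInterval), n' 0 + n' 1 + n' 2 = 0 → (x : Torus) = proj (Δ.edgePoint η n' i' t') →
      proj (Δ.edgePoint (AffineMap.lineMap η η' ((1 : unitInterval) : ℝ)) (n x) (i x) (t x)) =
        proj (Δ.edgePoint η' n' i' t') := by
    intro x n' i' t' hn' hx'
    rw [hF 1 x n' i' t' hn' hx', Set.Icc.coe_one, AffineMap.lineMap_apply_one]
  refine ⟨⟨_, hcont⟩, fun x => ?_, fun τ x y hxy => ?_, ?_, ?_, ?_⟩
  · change proj (Δ.edgePoint (AffineMap.lineMap η η' ((0 : unitInterval) : ℝ)) (n x) (i x) (t x)) =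
      (x : Torus)
    rw [Set.Icc.coe_zero, AffineMap.lineMap_apply_zero, ← hx]
  · have hxy' : proj (Δ.edgePoint (AffineMap.lineMap η η' (τ : ℝ)) (n x) (i x) (t x)) =
      proj (Δ.edgePoint (AffineMap.lineMap η η' (τ : ℝ)) (n y) (i y) (t y)) := hxy
    rw [proj_edgePoint_eq_iff (hm τ) (hn x) (hn y) (t x).2 (t y).2,
      ← proj_edgePoint_eq_iff hη.strictMono (hn x) (hn y) (t x).2 (t y).2, ← hx, ← hx] at hxy'
    exact Subtype.ext hxy'
  · ext p
    rw [mem_black_iff]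
    constructor
    · rintro ⟨x, hxb, rfl⟩
      obtain ⟨n', i', hn', hx'⟩ := (mem_black_iff η _).1 hxb
      exact ⟨n', i', hn', hF1 x n' i' 0 hn' hx'⟩
    · rintro ⟨n', i', hn', rfl⟩
      exact ⟨⟨_, hmem n' i' 0 hn'⟩, (mem_black_iff η _).2 ⟨n', i', hn', rfl⟩,
        hF1 _ n' i' 0 hn' rfl⟩
  · ext p
    rw [mem_white_iff]
    constructor
    · rintro ⟨x, hxb, rfl⟩
      obtain ⟨n', i', hn', hx'⟩ := (mem_white_iff η _).1 hxb
      exact ⟨n', i', hn', hF1 x n' i' 1 hn' hx'⟩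
    · rintro ⟨n', i', hn', rfl⟩
      exact ⟨⟨_, hmem n' i' 1 hn'⟩, (mem_white_iff η _).2 ⟨n', i', hn', rfl⟩,
        hF1 _ n' i' 1 hn' rfl⟩
  · have key : ∀ (n' : Fin 3 → ℤ) (i' : Fin 3), n' 0 + n' 1 + n' 2 = 0 →
        {p | ∃ x : (Δ.latticeGraph η).support,
          (x : Torus) ∈ Set.range (segmentPath (Δ.node η (raise n' i')) (Δ.node η n')) ∧
          proj (Δ.edgePoint (AffineMap.lineMap η η' ((1 : unitInterval) : ℝ))
            (n x) (i x) (t x)) = p} =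
        Set.range (segmentPath (Δ.node η' (raise n' i')) (Δ.node η' n')) := by
      intro n' i' hn'
      ext p
      constructor
      · rintro ⟨x, ⟨s, hs⟩, rfl⟩
        exact ⟨s, (hF1 x n' i' s hn' hs.symm).symm⟩
      · rintro ⟨s, rfl⟩
        exact ⟨⟨_, hmem n' i' s hn'⟩, ⟨s, rfl⟩, hF1 _ n' i' s hn' rfl⟩
    ext s
    constructor
    · rintro ⟨_, ⟨n', i', hn', rfl⟩, rfl⟩
      exact ⟨_, ⟨n', i', hn', rfl⟩, key n' i' hn'⟩
    · rintro ⟨_, ⟨n', i', hn', rfl⟩, rfl⟩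
      exact ⟨_, ⟨n', i', hn', rfl⟩, (key n' i' hn').symm⟩

end LatticeTriangle

namespace LatticeTriangle

variable {Δ : LatticeTriangle}

/-! ### The coamoeba -/

variable (Δ) in
/-- The argument of the `i`-th monomial at a point of the torus. -/
def phase (x : ℝ × ℝ) (i : Fin 3) : ℝ :=
  2 * Real.pi * ((Δ.vertex i).1 * x.1 + (Δ.vertex i).2 * x.2)

variable (Δ) in
/-- The logarithm of the absolute value of the `i`-th monomial. -/
def logWeight (a : ℝ × ℝ) (i : Fin 3) : ℝ := (Δ.vertex i).1 * a.1 + (Δ.vertex i).2 * a.2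

theorem W_apply (a x : ℝ × ℝ) (p : ℂˣ × ℂˣ)
    (h1 : (p.1 : ℂ) = Complex.exp (a.1 + (2 * Real.pi * x.1 : ℝ) * Complex.I))
    (h2 : (p.2 : ℂ) = Complex.exp (a.2 + (2 * Real.pi * x.2 : ℝ) * Complex.I)) :
    Δ.W p = ((∑ i, Real.exp (Δ.logWeight a i) * Real.cos (Δ.phase x i) : ℝ) : ℂ) +
      ((∑ i, Real.exp (Δ.logWeight a i) * Real.sin (Δ.phase x i) : ℝ) : ℂ) * Complex.I := by
  unfold W
  push_cast
  rw [Finset.sum_mul, ← Finset.sum_add_distrib]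
  refine Finset.sum_congr rfl fun i _ => ?_
  rw [h1, h2, ← Complex.exp_int_mul, ← Complex.exp_int_mul, ← Complex.exp_add]
  have : ((Δ.vertex i).1 : ℂ) * (a.1 + (2 * Real.pi * x.1 : ℝ) * Complex.I) +
      ((Δ.vertex i).2 : ℂ) * (a.2 + (2 * Real.pi * x.2 : ℝ) * Complex.I) =
      (Δ.logWeight a i : ℂ) + (Δ.phase x i : ℂ) * Complex.I := by
    unfold logWeight phase
    push_cast
    ring
  rw [this, Complex.exp_add, Complex.exp_mul_I]
  ring

theorem exists_eq_exp (z : ℂˣ) :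
    (z : ℂ) = Complex.exp ((Real.log ‖(z : ℂ)‖ : ℝ) +
      (2 * Real.pi * (Complex.arg z / (2 * Real.pi)) : ℝ) * Complex.I) := by
  rw [mul_div_cancel₀ _ Real.two_pi_pos.ne']
  exact (Complex.exp_log z.ne_zero).symm

theorem coe_arg_div_of_eq_exp {z : ℂˣ} {a x : ℝ}
    (h : (z : ℂ) = Complex.exp (a + (2 * Real.pi * x : ℝ) * Complex.I)) :
    ((Complex.arg z / (2 * Real.pi) : ℝ) : UnitAddCircle) = (x : UnitAddCircle) := by
  rw [unitAddCircle_coe_eq_coe_iff]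
  have h' := Complex.exp_log z.ne_zero
  rw [h, Complex.exp_eq_exp_iff_exists_int, ← h] at h'
  obtain ⟨n, hn⟩ := h'
  refine ⟨n, ?_⟩
  have him : Complex.arg z = 2 * Real.pi * x + n * (2 * Real.pi) := by
    rw [← Complex.log_im]
    simpa using congrArg Complex.im hn
  rw [him]
  have := Real.two_pi_pos.ne'
  field_simp

/-- As the triangle is non-degenerate, the two differences of logarithmic weights can be prescribed.
The constant `k` is a common factor of the monomials, harmless for zeros. -/
theorem exists_logWeight (r : Fin 3 → ℝ) :
    ∃ (a : ℝ × ℝ) (k : ℝ), ∀ i, Δ.logWeight a i = r i + k := by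
  have hA : (Δ.signedArea : ℝ) ≠ 0 := by exact_mod_cast Δ.signedArea_ne_zero
  have hA' : (Δ.signedArea : ℝ) = ((Δ.vertex 1).1 - (Δ.vertex 0).1 : ℝ) *
      ((Δ.vertex 2).2 - (Δ.vertex 0).2) -
      ((Δ.vertex 1).2 - (Δ.vertex 0).2) * ((Δ.vertex 2).1 - (Δ.vertex 0).1) := by
    unfold signedArea; push_cast; ring
  obtain ⟨a, ha1, ha2⟩ : ∃ a : ℝ × ℝ,
      ((Δ.vertex 1).1 - (Δ.vertex 0).1 : ℝ) * a.1 + ((Δ.vertex 1).2 - (Δ.vertex 0).2) * a.2 =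
        r 1 - r 0 ∧
      ((Δ.vertex 2).1 - (Δ.vertex 0).1 : ℝ) * a.1 + ((Δ.vertex 2).2 - (Δ.vertex 0).2) * a.2 =
        r 2 - r 0 := by
    refine ⟨(((r 1 - r 0) * ((Δ.vertex 2).2 - (Δ.vertex 0).2) -
        (r 2 - r 0) * ((Δ.vertex 1).2 - (Δ.vertex 0).2)) / Δ.signedArea,
      ((r 2 - r 0) * ((Δ.vertex 1).1 - (Δ.vertex 0).1) -
        (r 1 - r 0) * ((Δ.vertex 2).1 - (Δ.vertex 0).1)) / Δ.signedArea), ?_, ?_⟩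
    · dsimp only
      field_simp
      rw [hA']
      ring
    · dsimp only
      field_simp
      rw [hA']
      ring
  refine ⟨a, Δ.logWeight a 0 - r 0, fun i => ?_⟩
  unfold logWeight
  fin_cases i
  · change (Δ.vertex 0).1 * a.1 + (Δ.vertex 0).2 * a.2 = r 0 + _
    ring
  · change (Δ.vertex 1).1 * a.1 + (Δ.vertex 1).2 * a.2 = r 1 + _
    linear_combination ha1
  · change (Δ.vertex 2).1 * a.1 + (Δ.vertex 2).2 * a.2 = r 2 + _
    linear_combination ha2

theorem proj_mem_coamoeba_iff_exists_weights (x : ℝ × ℝ) :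
    proj x ∈ coamoeba Δ.W ↔ ∃ r : Fin 3 → ℝ, (∀ i, 0 < r i) ∧
      ∑ i, r i * Real.cos (Δ.phase x i) = 0 ∧ ∑ i, r i * Real.sin (Δ.phase x i) = 0 := by
  have hzero : ∀ u v : ℝ, (u : ℂ) + v * Complex.I = 0 ↔ u = 0 ∧ v = 0 := by
    intro u v
    rw [Complex.ext_iff]
    simp
  constructor
  · rintro ⟨p, hp, hpx⟩
    have hx := hpx.symm
    unfold argMap at hx
    rw [proj_eq_proj_iff] at hx
    obtain ⟨m, hm⟩ := hx
    have h1 : (p.1 : ℂ) = Complex.exp ((Real.log ‖(p.1 : ℂ)‖ : ℝ) +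
        (2 * Real.pi * x.1 : ℝ) * Complex.I) := by
      conv_lhs => rw [exists_eq_exp p.1]
      rw [Complex.exp_eq_exp_iff_exists_int]
      refine ⟨-m.1, ?_⟩
      rw [hm]
      simp only [intPoint, Prod.fst_add]
      push_cast
      ring
    have h2 : (p.2 : ℂ) = Complex.exp ((Real.log ‖(p.2 : ℂ)‖ : ℝ) +
        (2 * Real.pi * x.2 : ℝ) * Complex.I) := by
      conv_lhs => rw [exists_eq_exp p.2]
      rw [Complex.exp_eq_exp_iff_exists_int]
      refine ⟨-m.2, ?_⟩
      rw [hm]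
      simp only [intPoint, Prod.snd_add]
      push_cast
      ring
    have hW : Δ.W p = 0 := hp
    rw [W_apply (Real.log ‖(p.1 : ℂ)‖, Real.log ‖(p.2 : ℂ)‖) x p h1 h2, hzero] at hW
    exact ⟨_, fun i => Real.exp_pos _, hW⟩
  · rintro ⟨r, hr, hcos, hsin⟩
    obtain ⟨a, k, ha⟩ := Δ.exists_logWeight fun i => Real.log (r i)
    have hexp : ∀ i, Real.exp (Δ.logWeight a i) = Real.exp k * r i := fun i => by
      rw [ha, Real.exp_add, Real.exp_log (hr i), mul_comm]
    let p : ℂˣ × ℂˣ := (Units.mk0 (Complex.exp (a.1 + (2 * Real.pi * x.1 : ℝ) * Complex.I))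
      (Complex.exp_ne_zero _), Units.mk0 (Complex.exp (a.2 + (2 * Real.pi * x.2 : ℝ) * Complex.I))
      (Complex.exp_ne_zero _))
    refine ⟨p, ?_, ?_⟩
    · change Δ.W p = 0
      rw [W_apply a x p rfl rfl, hzero]
      simp only [hexp, mul_assoc, ← Finset.mul_sum]
      rw [hcos, hsin, mul_zero]
      exact ⟨rfl, rfl⟩
    · exact Prod.ext (coe_arg_div_of_eq_exp rfl) (coe_arg_div_of_eq_exp rfl)

/-- The condition on the arguments of three complex numbers to have a vanishing sum for suitable
absolute values. -/
theorem exists_weights_iff (φ : Fin 3 → ℝ) :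
    (∃ r : Fin 3 → ℝ, (∀ i, 0 < r i) ∧ ∑ i, r i * Real.cos (φ i) = 0 ∧
      ∑ i, r i * Real.sin (φ i) = 0) ↔
    (∀ i, 0 < Real.sin (φ (i + 2) - φ (i + 1))) ∨ (∀ i, Real.sin (φ (i + 2) - φ (i + 1)) < 0) ∨
    ((∀ i, Real.sin (φ (i + 2) - φ (i + 1)) = 0) ∧
      ∃ i, Real.cos (φ (i + 2) - φ (i + 1)) ≠ 1) := by
  have hfin : ∀ P : Fin 3 → Fin 3 → Prop, (∀ i, P (i + 2) (i + 1)) ↔ P 2 1 ∧ P 0 2 ∧ P 1 0 := by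
    intro P
    rw [Fin.forall_fin_succ, Fin.forall_fin_succ, Fin.forall_fin_one]
    rfl
  have hfin' : ∀ P : Fin 3 → Fin 3 → Prop, (∃ i, P (i + 2) (i + 1)) ↔ P 2 1 ∨ P 0 2 ∨ P 1 0 := by
    intro P
    rw [Fin.exists_fin_succ, Fin.exists_fin_succ, Fin.exists_fin_one]
    rfl
  rw [hfin fun i j => 0 < Real.sin (φ i - φ j), hfin fun i j => Real.sin (φ i - φ j) < 0,
    hfin fun i j => Real.sin (φ i - φ j) = 0, hfin' fun i j => Real.cos (φ i - φ j) ≠ 1]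
  simp only [Fin.sum_univ_three]
  have p0 := Real.sin_sq_add_cos_sq (φ 0)
  have p1 := Real.sin_sq_add_cos_sq (φ 1)
  have p2 := Real.sin_sq_add_cos_sq (φ 2)
  constructor
  · rintro ⟨r, hr, hc, hs⟩
    -- Taking the component orthogonal to one of the vectors yields the law of sines, so the three
    -- sines have the same sign or all vanish.
    have e1 : r 1 * Real.sin (φ 1 - φ 0) = r 2 * Real.sin (φ 0 - φ 2) := by
      rw [Real.sin_sub, Real.sin_sub]
      linear_combination Real.cos (φ 0) * hs - Real.sin (φ 0) * hc
    have e2 : r 2 * Real.sin (φ 2 - φ 1) = r 0 * Real.sin (φ 1 - φ 0) := by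
      rw [Real.sin_sub, Real.sin_sub]
      linear_combination Real.cos (φ 1) * hs - Real.sin (φ 1) * hc
    have r0 := hr 0
    have r1 := hr 1
    have r2 := hr 2
    have e3 : r 0 + r 1 * Real.cos (φ 1 - φ 0) + r 2 * Real.cos (φ 0 - φ 2) = 0 := by
      rw [Real.cos_sub, Real.cos_sub]
      linear_combination Real.cos (φ 0) * hc + Real.sin (φ 0) * hs - r 0 * p0
    rcases lt_trichotomy (Real.sin (φ 1 - φ 0)) 0 with h | h | h
    · refine Or.inr (Or.inl ⟨?_, ?_, h⟩)
      · exact neg_of_mul_neg_right (e2.trans_lt (mul_neg_of_pos_of_neg r0 h)) r2.le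
      · exact neg_of_mul_neg_right (e1.symm.trans_lt (mul_neg_of_pos_of_neg r1 h)) r2.le
    · rw [h, mul_zero] at e1 e2
      refine Or.inr (Or.inr ⟨⟨(mul_eq_zero.1 e2).resolve_left r2.ne',
        (mul_eq_zero.1 e1.symm).resolve_left r2.ne', h⟩, ?_⟩)
      by_contra! hcon
      rw [hcon.2.1, hcon.2.2] at e3
      linarith
    · refine Or.inl ⟨?_, ?_, h⟩
      · exact pos_of_mul_pos_right ((mul_pos r0 h).trans_eq e2.symm) r2.le
      · exact pos_of_mul_pos_right ((mul_pos r1 h).trans_eq e1) r2.le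
  · rintro (h | h | ⟨⟨h0, h1, h2⟩, hcos⟩)
    -- By the law of sines the weights must be proportional to the sines of the opposite
    -- differences.
    · refine ⟨![Real.sin (φ 2 - φ 1), Real.sin (φ 0 - φ 2), Real.sin (φ 1 - φ 0)], ?_, ?_, ?_⟩
      · rw [Fin.forall_fin_succ, Fin.forall_fin_succ, Fin.forall_fin_one]
        exact h
      · simp only [Matrix.cons_val, Real.sin_sub]
        ring
      · simp only [Matrix.cons_val, Real.sin_sub]
        ring
    · refine ⟨![-Real.sin (φ 2 - φ 1), -Real.sin (φ 0 - φ 2), -Real.sin (φ 1 - φ 0)], ?_, ?_, ?_⟩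
      · rw [Fin.forall_fin_succ, Fin.forall_fin_succ, Fin.forall_fin_one]
        exact ⟨neg_pos.2 h.1, neg_pos.2 h.2.1, neg_pos.2 h.2.2⟩
      · simp only [Matrix.cons_val, Real.sin_sub]
        ring
      · simp only [Matrix.cons_val, Real.sin_sub]
        ring
    -- Collinear unit vectors that are not all equal: two coincide and the third, opposite one gets
    -- weight 2.
    · have hrot : ∀ a b : ℝ, Real.sin (a - b) = 0 → Real.cos a = Real.cos (a - b) * Real.cos b ∧
          Real.sin a = Real.cos (a - b) * Real.sin b := by
        intro a b hab
        have hc := Real.cos_add (a - b) b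
        have hs := Real.sin_add (a - b) b
        rw [sub_add_cancel, hab] at hc hs
        constructor <;> linarith
      have hpm : ∀ a : ℝ, Real.sin a = 0 → Real.cos a = 1 ∨ Real.cos a = -1 := by
        intro a ha
        exact Real.sin_eq_zero_iff_cos_eq.1 ha
      have hprod : Real.cos (φ 0 - φ 2) = Real.cos (φ 2 - φ 1) * Real.cos (φ 1 - φ 0) := by
        have := Real.cos_add (φ 2 - φ 1) (φ 1 - φ 0)
        rw [h0, zero_mul, sub_zero, sub_add_sub_cancel] at this
        rw [← this, ← Real.cos_neg, neg_sub]
      obtain ⟨a0, b0⟩ := hrot _ _ h0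
      obtain ⟨a1, b1⟩ := hrot _ _ h1
      obtain ⟨a2, b2⟩ := hrot _ _ h2
      rcases hpm _ h0 with q0 | q0 <;> rcases hpm _ h2 with q2 | q2 <;>
        rw [q0, q2] at hprod <;> rw [q0] at a0 b0 <;> rw [q2] at a2 b2 <;> rw [hprod] at a1 b1
      · rw [q0, q2, hprod] at hcos
        norm_num at hcos
      · refine ⟨![2, 1, 1], ?_, ?_, ?_⟩
        · rw [Fin.forall_fin_succ, Fin.forall_fin_succ, Fin.forall_fin_one]
          exact ⟨two_pos, one_pos, one_pos⟩
        · simp only [Matrix.cons_val]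
          linarith
        · simp only [Matrix.cons_val]
          linarith
      · refine ⟨![1, 1, 2], ?_, ?_, ?_⟩
        · rw [Fin.forall_fin_succ, Fin.forall_fin_succ, Fin.forall_fin_one]
          exact ⟨one_pos, one_pos, two_pos⟩
        · simp only [Matrix.cons_val]
          linarith
        · simp only [Matrix.cons_val]
          linarith
      · refine ⟨![1, 2, 1], ?_, ?_, ?_⟩
        · rw [Fin.forall_fin_succ, Fin.forall_fin_succ, Fin.forall_fin_one]
          exact ⟨one_pos, two_pos, one_pos⟩
        · simp only [Matrix.cons_val]
          linarith
        · simp only [Matrix.cons_val]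
          linarith

theorem phase_sub (x : ℝ × ℝ) (i : Fin 3) :
    Δ.phase x (i + 2) - Δ.phase x (i + 1) =
      Δ.signedArea.sign * (2 * Real.pi * Δ.coord x i) := by
  have hs : ∀ i, ((Δ.side i).1 : ℝ) = (Δ.vertex (i + 2)).1 - (Δ.vertex (i + 1)).1 ∧
      ((Δ.side i).2 : ℝ) = (Δ.vertex (i + 2)).2 - (Δ.vertex (i + 1)).2 := by
    intro i
    simp [side]
  rw [coord_apply, (hs i).1, (hs i).2, phase, phase]
  linear_combination (-(2 * Real.pi * (((Δ.vertex (i + 2)).1 - (Δ.vertex (i + 1)).1) * x.1 +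
    ((Δ.vertex (i + 2)).2 - (Δ.vertex (i + 1)).2) * x.2))) * Δ.sign_mul_sign_real

theorem proj_mem_coamoeba_iff (x : ℝ × ℝ) : proj x ∈ coamoeba Δ.W ↔
    (∀ i, 0 < Real.sin (2 * Real.pi * Δ.coord x i)) ∨
    (∀ i, Real.sin (2 * Real.pi * Δ.coord x i) < 0) ∨
    ((∀ i, Real.sin (2 * Real.pi * Δ.coord x i) = 0) ∧
      ∃ i, Real.cos (2 * Real.pi * Δ.coord x i) ≠ 1) := by
  rw [proj_mem_coamoeba_iff_exists_weights, exists_weights_iff]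
  simp only [phase_sub]
  rcases lt_or_gt_of_ne Δ.signedArea_ne_zero with h | h
  · rw [Int.sign_eq_neg_one_of_neg h]
    simp only [Int.cast_neg, Int.cast_one, neg_one_mul, Real.sin_neg, Real.cos_neg, neg_pos,
      neg_lt_zero, neg_eq_zero]
    tauto
  · rw [Int.sign_eq_one_of_pos h]
    simp only [Int.cast_one, one_mul]

end LatticeTriangle

/-! ### Retraction of a triangle to a tripod -/

/-- The excess of a coordinate over the other two, if positive. -/
def excess (u : Fin 3 → ℝ) (j : Fin 3) : ℝ := max 0 (u j - max (u (j + 1)) (u (j + 2)))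

/-- The retraction of the triangle with barycentric coordinates of sum `1 / 2` to the union of the
segments that join the center to the vertices. -/
def toTripod (u : Fin 3 → ℝ) (j : Fin 3) : ℝ :=
  excess u j + (1 / 2 - (excess u 0 + excess u 1 + excess u 2)) / 3

/-- The point at distance `r` from the center in the direction of a vertex. -/
def tripod (i : Fin 3) (r : ℝ) (j : Fin 3) : ℝ := (1 / 2 - r) / 3 + if j = i then r else 0

theorem continuous_toTripod : Continuous toTripod := by
  have h : ∀ j, Continuous fun u : Fin 3 → ℝ => excess u j := by
    intro j
    unfold excess
    fun_prop
  refine continuous_pi fun j => ?_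
  unfold toTripod
  have h0 := h 0
  have h1 := h 1
  have h2 := h 2
  have hj := h j
  fun_prop

theorem toTripod_sum (u : Fin 3 → ℝ) : toTripod u 0 + toTripod u 1 + toTripod u 2 = 1 / 2 := by
  unfold toTripod
  ring

theorem sum_ite_fin_three (i : Fin 3) (r : ℝ) :
    (if (0 : Fin 3) = i then r else 0) + (if (1 : Fin 3) = i then r else 0) +
      (if (2 : Fin 3) = i then r else 0) = r := by
  fin_cases i <;> simp

/-- Only a largest coordinate can have positive excess, so the image lies on the leg towards the
corresponding vertex. -/
theorem toTripod_eq_tripod {u : Fin 3 → ℝ} {i : Fin 3} (hi : ∀ j, u j ≤ u i) :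
    toTripod u = tripod i (u i - max (u (i + 1)) (u (i + 2))) := by
  have h : ∀ j, excess u j =
      if j = i then u i - max (u (i + 1)) (u (i + 2)) else 0 := by
    intro j
    by_cases hj : j = i
    · subst hj
      rw [if_pos rfl, excess, max_eq_right (sub_nonneg.2 (max_le (hi _) (hi _)))]
    · rw [if_neg hj, excess, max_eq_left]
      rw [sub_nonpos]
      have : i = j + 1 ∨ i = j + 2 := by
        revert hj
        fin_cases i <;> fin_cases j <;> decide
      rcases this with rfl | rfl
      · exact (hi j).trans (le_max_left _ _)
      · exact (hi j).trans (le_max_right _ _)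
  funext j
  unfold toTripod tripod
  rw [h, h, h, h, sum_ite_fin_three]
  ring

theorem exists_toTripod_eq {u : Fin 3 → ℝ} (hu : ∀ j, 0 ≤ u j) (hs : u 0 + u 1 + u 2 = 1 / 2) :
    ∃ i, ∃ r ∈ Set.Icc (0 : ℝ) (1 / 2), toTripod u = tripod i r ∧ ((∀ j, 0 < u j) → r < 1 / 2) := by
  obtain ⟨i, hi⟩ := Finite.exists_max u
  have hi2 : u i ≤ 1 / 2 := by
    have h0 := hu 0
    have h1 := hu 1
    have h2 := hu 2
    fin_cases i
    · change u 0 ≤ 1 / 2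
      linarith
    · change u 1 ≤ 1 / 2
      linarith
    · change u 2 ≤ 1 / 2
      linarith
  have h1 := le_max_left (u (i + 1)) (u (i + 2))
  refine ⟨i, _, ⟨sub_nonneg.2 (max_le (hi _) (hi _)), ?_⟩, toTripod_eq_tripod hi, fun hpos => ?_⟩
  · linarith [hu (i + 1)]
  · linarith [hpos (i + 1)]

theorem tripod_nonneg (i : Fin 3) {r : ℝ} (hr : r ∈ Set.Icc (0 : ℝ) (1 / 2)) (j : Fin 3) :
    0 ≤ tripod i r j := by
  unfold tripod
  split_ifs
  · linarith [hr.1, hr.2]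
  · linarith [hr.1, hr.2]

theorem tripod_pos (i : Fin 3) {r : ℝ} (hr : r ∈ Set.Ico (0 : ℝ) (1 / 2)) (j : Fin 3) :
    0 < tripod i r j := by
  unfold tripod
  split_ifs
  · linarith [hr.1, hr.2]
  · linarith [hr.1, hr.2]

theorem toTripod_tripod (i : Fin 3) {r : ℝ} (hr : r ∈ Set.Icc (0 : ℝ) (1 / 2)) :
    toTripod (tripod i r) = tripod i r := by
  rw [toTripod_eq_tripod (i := i)]
  · congr 1
    have h1 : i + 1 ≠ i := by fin_cases i <;> decide
    have h2 : i + 2 ≠ i := by fin_cases i <;> decide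
    simp [tripod, h1, h2]
  · intro j
    unfold tripod
    rw [if_pos rfl]
    split_ifs
    · exact le_rfl
    · linarith [hr.1]

theorem eq_tripod_of_eq_half {u : Fin 3 → ℝ} (hu : ∀ j, 0 ≤ u j) (hs : u 0 + u 1 + u 2 = 1 / 2)
    {i : Fin 3} (hi : u i = 1 / 2) : u = tripod i (1 / 2) := by
  have h0 := hu 0
  have h1 := hu 1
  have h2 := hu 2
  funext j
  unfold tripod
  fin_cases i <;> fin_cases j <;> simp at hi ⊢ <;> linarith

namespace LatticeTriangle

variable {Δ : LatticeTriangle}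

/-! ### The equidistant arrangement -/

/-- The equidistant lines that pass through the boundary of the coamoeba. -/
def shift (i : Fin 3) : ℝ := if i = 0 then -3 / 2 else 1 / 2

variable (Δ) in
/-- The deviations of the equidistant lines. -/
def equidistant (e : Δ.Edge) : ℝ := shift e.1

theorem level_equidistant (i : Fin 3) (n : ℤ) : Δ.level Δ.equidistant i n = n + shift i := rfl

theorem shift_sum : shift 0 + shift 1 + shift 2 = -1 / 2 := by
  rw [shift, shift, shift, if_pos rfl, if_neg (by decide), if_neg (by decide)]
  norm_num

theorem exists_shift_eq (i : Fin 3) : ∃ k : ℤ, shift i = k + 1 / 2 := by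
  unfold shift
  split_ifs
  · exact ⟨-2, by norm_num⟩
  · exact ⟨0, by norm_num⟩

theorem levelSum_equidistant (n : Fin 3 → ℤ) :
    Δ.levelSum Δ.equidistant n = ((n 0 + n 1 + n 2 : ℤ) : ℝ) - 1 / 2 := by
  have := shift_sum
  simp only [levelSum, level_equidistant]
  push_cast
  linarith

variable (Δ) in
theorem isGood_equidistant : Δ.IsGood Δ.equidistant := by
  intro n
  rw [levelSum_equidistant]
  constructor
  · intro h
    rw [h]
    norm_num
  · intro h
    rw [h]
    norm_num

variable (Δ) in
/-- The barycentric coordinates in the triangle at the lines with given indices. The sign is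
positive for white and negative for black triangles. -/
def bary (s : ℝ) (n : Fin 3 → ℤ) (x : ℝ × ℝ) (j : Fin 3) : ℝ :=
  s * (Δ.coord x j - Δ.level Δ.equidistant j (n j))

/-- The sign is that of the triangle at the lines with given indices. -/
def IsSign (s : ℝ) (n : Fin 3 → ℤ) : Prop :=
  (s = 1 ∧ n 0 + n 1 + n 2 = 0) ∨ (s = -1 ∧ n 0 + n 1 + n 2 = 1)

/-- The coordinates belong to an interior point or a vertex of a triangle. -/
def IsInner (u : Fin 3 → ℝ) : Prop := (∀ j, 0 ≤ u j) ∧ ((∀ j, 0 < u j) ∨ ∃ j, u j = 1 / 2)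

theorem bary_sum {s : ℝ} {n : Fin 3 → ℤ} (h : IsSign s n) (x : ℝ × ℝ) :
    Δ.bary s n x 0 + Δ.bary s n x 1 + Δ.bary s n x 2 = 1 / 2 := by
  have hc := Δ.coord_sum x
  have hl := Δ.levelSum_equidistant n
  unfold levelSum at hl
  unfold bary
  rcases h with ⟨rfl, h⟩ | ⟨rfl, h⟩
  · rw [h] at hl
    push_cast at hl
    linarith
  · rw [h] at hl
    push_cast at hl
    linarith

/-- In terms of barycentric coordinates the coordinates are half-integral translates. -/
theorem exists_coord_eq_bary {s : ℝ} {n : Fin 3 → ℤ} (h : IsSign s n) (x : ℝ × ℝ) (j : Fin 3) :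
    ∃ k : ℤ, Δ.coord x j = k + 1 / 2 + s * Δ.bary s n x j := by
  obtain ⟨k, hk⟩ := exists_shift_eq j
  have hss : s * s = 1 := by rcases h with ⟨rfl, -⟩ | ⟨rfl, -⟩ <;> norm_num
  refine ⟨n j + k, ?_⟩
  unfold bary
  rw [level_equidistant, hk]
  push_cast
  linear_combination (k + 1 / 2 + n j - Δ.coord x j) * hss

theorem sin_coord {s : ℝ} {n : Fin 3 → ℤ} (h : IsSign s n) (x : ℝ × ℝ) (j : Fin 3) :
    Real.sin (2 * Real.pi * Δ.coord x j) = -s * Real.sin (2 * Real.pi * Δ.bary s n x j) := by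
  obtain ⟨k, hk⟩ := exists_coord_eq_bary h x j
  rw [hk, show 2 * Real.pi * (k + 1 / 2 + s * Δ.bary s n x j) =
    2 * Real.pi * (s * Δ.bary s n x j) + Real.pi + k * (2 * Real.pi) by ring,
    Real.sin_add_int_mul_two_pi, Real.sin_add_pi]
  rcases h with ⟨rfl, -⟩ | ⟨rfl, -⟩
  · rw [one_mul]; ring
  · rw [neg_one_mul, mul_neg, Real.sin_neg]; ring

theorem cos_coord {s : ℝ} {n : Fin 3 → ℤ} (h : IsSign s n) (x : ℝ × ℝ) (j : Fin 3) :
    Real.cos (2 * Real.pi * Δ.coord x j) = -Real.cos (2 * Real.pi * Δ.bary s n x j) := by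
  obtain ⟨k, hk⟩ := exists_coord_eq_bary h x j
  rw [hk, show 2 * Real.pi * (k + 1 / 2 + s * Δ.bary s n x j) =
    2 * Real.pi * (s * Δ.bary s n x j) + Real.pi + k * (2 * Real.pi) by ring,
    Real.cos_add_int_mul_two_pi, Real.cos_add_pi]
  rcases h with ⟨rfl, -⟩ | ⟨rfl, -⟩
  · rw [one_mul]
  · rw [neg_one_mul, mul_neg, Real.cos_neg]

theorem bary_le_half {s : ℝ} {n : Fin 3 → ℤ} (h : IsSign s n) {x : ℝ × ℝ}
    (hx : ∀ j, 0 ≤ Δ.bary s n x j) (j : Fin 3) : Δ.bary s n x j ≤ 1 / 2 := by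
  have hs := Δ.bary_sum h x
  have h0 := hx 0
  have h1 := hx 1
  have h2 := hx 2
  fin_cases j
  · change Δ.bary s n x 0 ≤ 1 / 2
    linarith
  · change Δ.bary s n x 1 ≤ 1 / 2
    linarith
  · change Δ.bary s n x 2 ≤ 1 / 2
    linarith

/-! ### The coamoeba as the union of open triangles and their vertices -/

theorem proj_mem_coamoeba_of_isInner {s : ℝ} {n : Fin 3 → ℤ} (h : IsSign s n) {x : ℝ × ℝ}
    (hx : IsInner (Δ.bary s n x)) : proj x ∈ coamoeba Δ.W := by
  have hpi := Real.pi_pos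
  rw [proj_mem_coamoeba_iff]
  rcases hx with ⟨hnn, hpos | ⟨j, hj⟩⟩
  · have hsin : ∀ j, 0 < Real.sin (2 * Real.pi * Δ.bary s n x j) := by
      intro j
      have hlt : Δ.bary s n x j < 1 / 2 := by
        have hs := Δ.bary_sum h x
        have h0 := hpos 0
        have h1 := hpos 1
        have h2 := hpos 2
        fin_cases j
        · change Δ.bary s n x 0 < 1 / 2
          linarith
        · change Δ.bary s n x 1 < 1 / 2
          linarith
        · change Δ.bary s n x 2 < 1 / 2
          linarith
      refine Real.sin_pos_of_pos_of_lt_pi (by have := hpos j; positivity) ?_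
      nlinarith
    simp only [sin_coord h]
    rcases h with ⟨rfl, -⟩ | ⟨rfl, -⟩
    · exact Or.inr (Or.inl fun i => by linarith [hsin i])
    · exact Or.inl fun i => by linarith [hsin i]
  · have hu := eq_tripod_of_eq_half hnn (Δ.bary_sum h x) hj
    refine Or.inr (Or.inr ⟨fun i => ?_, j + 1, ?_⟩)
    · rw [sin_coord h, hu, tripod]
      split_ifs
      · rw [show 2 * Real.pi * ((1 / 2 - 1 / 2) / 3 + 1 / 2) = Real.pi by ring, Real.sin_pi,
          mul_zero]
      · rw [show 2 * Real.pi * ((1 / 2 - 1 / 2) / 3 + 0) = 0 by ring, Real.sin_zero, mul_zero]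
    · have hne : j + 1 ≠ j := by fin_cases j <;> decide
      rw [cos_coord h, hu, tripod, if_neg hne,
        show 2 * Real.pi * ((1 / 2 - 1 / 2) / 3 + 0) = 0 by ring, Real.cos_zero]
      norm_num

theorem exists_isInner_of_mem_coamoeba {x : ℝ × ℝ} (hx : proj x ∈ coamoeba Δ.W) :
    ∃ s n, IsSign s n ∧ IsInner (Δ.bary s n x) := by
  rw [proj_mem_coamoeba_iff] at hx
  have hpi := Real.pi_pos
  have hc := Δ.coord_sum x
  -- With this correction the index `⌊Δ.coord x j⌋ + d j` names the line at level `⌊Δ.coord x j⌋ + 1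
  -- / 2`.
  obtain ⟨d, hd⟩ : ∃ d : Fin 3 → ℤ, d = ![2, 0, 0] := ⟨_, rfl⟩
  have hds : ∀ j, shift j = 1 / 2 - d j := by
    intro j
    rw [hd]
    fin_cases j <;> norm_num [shift]
  have hdsum : d 0 + d 1 + d 2 = 2 := by rw [hd]; rfl
  have hsin : ∀ j, Real.sin (2 * Real.pi * Δ.coord x j) =
      Real.sin (2 * Real.pi * Int.fract (Δ.coord x j)) := by
    intro j
    conv_lhs => rw [← Int.floor_add_fract (Δ.coord x j)]
    rw [show 2 * Real.pi * ((⌊Δ.coord x j⌋ : ℝ) + Int.fract (Δ.coord x j)) =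
      2 * Real.pi * Int.fract (Δ.coord x j) + ⌊Δ.coord x j⌋ * (2 * Real.pi) by ring,
      Real.sin_add_int_mul_two_pi]
  have hf0 : ∀ j, 0 ≤ Int.fract (Δ.coord x j) := fun j => Int.fract_nonneg _
  have hf1 : ∀ j, Int.fract (Δ.coord x j) < 1 := fun j => Int.fract_lt_one _
  have hfs : Int.fract (Δ.coord x 0) + Int.fract (Δ.coord x 1) + Int.fract (Δ.coord x 2) =
      ((-(⌊Δ.coord x 0⌋ + ⌊Δ.coord x 1⌋ + ⌊Δ.coord x 2⌋) : ℤ) : ℝ) := by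
    simp only [Int.fract]
    push_cast
    linarith
  have hbary : ∀ (s : ℝ) (p : Fin 3 → ℤ) (j : Fin 3),
      Δ.bary s (fun j => ⌊Δ.coord x j⌋ + d j - p j) x j =
        s * (Int.fract (Δ.coord x j) - 1 / 2 + p j) := by
    intro s p j
    unfold bary
    rw [level_equidistant, hds, Int.fract]
    push_cast
    ring
  have key : ∀ z : ℤ, (0 : ℝ) < z → (z : ℝ) < 2 → z = 1 := by
    intro z h1 h2
    have h1' : 0 < z := by exact_mod_cast h1
    have h2' : z < 2 := by exact_mod_cast h2
    omega
  rcases hx with h | h | ⟨h, j, hj⟩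
  -- Positive sines: the fractional parts lie in `(0, 1/2)` and have integral sum, which must be 1.
  -- This is a black triangle.
  · have hlt : ∀ j, Int.fract (Δ.coord x j) < 1 / 2 := by
      intro j
      by_contra! hge
      have h1 := h j
      rw [hsin, show 2 * Real.pi * Int.fract (Δ.coord x j) =
        (2 * Real.pi * Int.fract (Δ.coord x j) - Real.pi) + Real.pi by ring, Real.sin_add_pi] at h1
      have h2 := Real.sin_nonneg_of_nonneg_of_le_pi
        (x := 2 * Real.pi * Int.fract (Δ.coord x j) - Real.pi) (by nlinarith)
        (by nlinarith [hf1 j])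
      linarith
    have hpos : ∀ j, 0 < Int.fract (Δ.coord x j) := by
      intro j
      refine lt_of_le_of_ne (hf0 j) fun h0 => ?_
      have h1 := h j
      rw [hsin, ← h0, mul_zero, Real.sin_zero] at h1
      exact lt_irrefl _ h1
    have hk := key _ (by rw [← hfs]; linarith [hpos 0, hpos 1, hpos 2])
      (by rw [← hfs]; linarith [hlt 0, hlt 1, hlt 2])
    refine ⟨-1, fun j => ⌊Δ.coord x j⌋ + d j - (0 : Fin 3 → ℤ) j, Or.inr ⟨rfl, ?_⟩, ?_⟩
    · simp only [Pi.zero_apply]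
      omega
    · have : ∀ j, 0 < Δ.bary (-1) (fun j => ⌊Δ.coord x j⌋ + d j - (0 : Fin 3 → ℤ) j) x j := by
        intro j
        rw [hbary, Pi.zero_apply]
        push_cast
        linarith [hlt j]
      exact ⟨fun j => (this j).le, Or.inl this⟩
  -- Negative sines: the fractional parts lie in `(1/2, 1)`, so their sum is 2. This is a white
  -- triangle.
  · have hlt : ∀ j, 1 / 2 < Int.fract (Δ.coord x j) := by
      intro j
      by_contra! hge
      have h1 := h j
      rw [hsin] at h1
      have h2 := Real.sin_nonneg_of_nonneg_of_le_pi
        (x := 2 * Real.pi * Int.fract (Δ.coord x j)) (by have := hf0 j; positivity)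
        (by nlinarith)
      linarith
    have hk := key (3 + (⌊Δ.coord x 0⌋ + ⌊Δ.coord x 1⌋ + ⌊Δ.coord x 2⌋))
      (by push_cast at hfs ⊢; linarith [hf1 0, hf1 1, hf1 2])
      (by push_cast at hfs ⊢; linarith [hlt 0, hlt 1, hlt 2])
    refine ⟨1, fun j => ⌊Δ.coord x j⌋ + d j - (0 : Fin 3 → ℤ) j, Or.inl ⟨rfl, ?_⟩, ?_⟩
    · simp only [Pi.zero_apply]
      omega
    · have : ∀ j, 0 < Δ.bary 1 (fun j => ⌊Δ.coord x j⌋ + d j - (0 : Fin 3 → ℤ) j) x j := by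
        intro j
        rw [hbary, Pi.zero_apply]
        push_cast
        linarith [hlt j]
      exact ⟨fun j => (this j).le, Or.inl this⟩
  · have hval : ∀ j, ∃ p : ℤ, (p = 0 ∨ p = 1) ∧ Int.fract (Δ.coord x j) = (1 - p) / 2 := by
      intro j
      have h1 := h j
      rw [hsin, Real.sin_eq_zero_iff] at h1
      obtain ⟨q, hq⟩ := h1
      have hq' : (q : ℝ) = 2 * Int.fract (Δ.coord x j) := by
        have : (q - 2 * Int.fract (Δ.coord x j)) * Real.pi = 0 := by linear_combination hq
        linarith [(mul_eq_zero.1 this).resolve_right hpi.ne']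
      have h2 : (-1 : ℝ) < q := by linarith [hf0 j]
      have h3 : (q : ℝ) < 2 := by linarith [hf1 j]
      have h2' : -1 < q := by exact_mod_cast h2
      have h3' : q < 2 := by exact_mod_cast h3
      refine ⟨1 - q, by omega, ?_⟩
      push_cast
      linarith
    choose p hp hpf using hval
    have hpj : p j = 0 := by
      refine (hp j).resolve_right fun h1 => hj ?_
      have h2 := hpf j
      rw [h1] at h2
      have h3 : Δ.coord x j = ⌊Δ.coord x j⌋ := by
        have := Int.floor_add_fract (Δ.coord x j)
        rw [h2] at this
        push_cast at this
        linarith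
      rw [h3, mul_comm]
      exact Real.cos_int_mul_two_pi _
    -- The integral sum of the fractional parts makes the sum of `p` odd, and `p j = 0` excludes 3.
    -- So exactly one coordinate is an integer, and the point is a vertex.
    have hsum : p 0 + p 1 + p 2 = 1 ∧ ⌊Δ.coord x 0⌋ + ⌊Δ.coord x 1⌋ + ⌊Δ.coord x 2⌋ = -1 := by
      have h1 := hfs
      rw [hpf, hpf, hpf] at h1
      have h2 : 3 - (p 0 + p 1 + p 2) = 2 * -(⌊Δ.coord x 0⌋ + ⌊Δ.coord x 1⌋ + ⌊Δ.coord x 2⌋) := by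
        have h3 : (3 : ℝ) - (p 0 + p 1 + p 2) =
            2 * -(⌊Δ.coord x 0⌋ + ⌊Δ.coord x 1⌋ + ⌊Δ.coord x 2⌋) := by
          push_cast at h1
          linarith
        exact_mod_cast h3
      have a0 := hp 0
      have a1 := hp 1
      have a2 := hp 2
      have hlt3 : p 0 + p 1 + p 2 < 3 := by
        fin_cases j
        · have : p 0 = 0 := hpj
          omega
        · have : p 1 = 0 := hpj
          omega
        · have : p 2 = 0 := hpj
          omega
      omega
    have hb : ∀ j, Δ.bary 1 (fun j => ⌊Δ.coord x j⌋ + d j - p j) x j = p j / 2 := by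
      intro j
      rw [hbary, hpf]
      ring
    have hone : ∃ i, p i = 1 := by
      by_contra! hcon
      have a0 := (hp 0).resolve_right (hcon 0)
      have a1 := (hp 1).resolve_right (hcon 1)
      have a2 := (hp 2).resolve_right (hcon 2)
      omega
    obtain ⟨i, hi⟩ := hone
    refine ⟨1, fun j => ⌊Δ.coord x j⌋ + d j - p j, Or.inl ⟨rfl, ?_⟩, fun j => ?_, Or.inr ⟨i, ?_⟩⟩
    · dsimp only
      omega
    · rw [hb]
      rcases hp j with h1 | h1 <;> rw [h1] <;> norm_num
    · rw [hb, hi]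
      norm_num

/-- Points of the graph of the equidistant arrangement in barycentric coordinates. -/
theorem mem_support_equidistant_iff (p : Torus) :
    p ∈ (Δ.latticeGraph Δ.equidistant).support ↔ ∃ s n x i, ∃ r ∈ Set.Icc (0 : ℝ) (1 / 2),
      IsSign s n ∧ p = proj x ∧ Δ.bary s n x = tripod i r := by
  have hraise : ∀ (n : Fin 3 → ℤ) (i j : Fin 3),
      ((raise n i j : ℤ) : ℝ) = n j + if j = i then 1 else 0 := by
    intro n i j
    by_cases hj : j = i
    · rw [hj, raise_self]; simp
    · rw [raise_of_ne n hj]; simp [hj]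
  have hcoord : ∀ (n : Fin 3 → ℤ) (i j : Fin 3) (t : ℝ), n 0 + n 1 + n 2 = 0 →
      Δ.coord (Δ.edgePoint Δ.equidistant n i t) j =
        n j + shift j + (if j = i then 1 - t else 0) - (1 / 2 - t) / 3 := by
    intro n i j t hn
    have hs : ∀ j, Δ.stairPoint Δ.equidistant n i t j =
        n j + shift j + (if j = i then 1 - t else 0) := by
      intro j
      rw [stairPoint, level_equidistant, level_equidistant, hraise]
      split_ifs <;> ring
    have hn' : (n 0 : ℝ) + n 1 + n 2 = 0 := by exact_mod_cast hn
    rw [coord_edgePoint, hs, hs, hs, hs]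
    linear_combination -(hn' / 3) - shift_sum / 3 - sum_ite_fin_three i (1 - t) / 3
  rw [mem_support_iff]
  constructor
  · rintro ⟨n, i, t, hn, rfl⟩
    -- The midpoint of an edge is the vertex shared by the two triangles; each half of the edge is a
    -- leg of one tripod.
    rcases le_total (1 / 2 : ℝ) t with ht | ht
    · refine ⟨1, n, _, i, 1 - t, ⟨by linarith [t.2.2], by linarith⟩, Or.inl ⟨rfl, hn⟩, rfl, ?_⟩
      funext j
      rw [bary, hcoord n i j t hn, level_equidistant, tripod]
      ring
    · refine ⟨-1, raise n i, _, i, t, ⟨t.2.1, ht⟩, Or.inr ⟨rfl, ?_⟩, rfl, ?_⟩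
      · rw [raise_sum, hn, zero_add]
      · funext j
        rw [bary, hcoord n i j t hn, level_equidistant, tripod, hraise]
        split_ifs <;> ring
  · rintro ⟨s, n, x, i, r, hr, ⟨rfl, hn⟩ | ⟨rfl, hn⟩, rfl, hx⟩
    · refine ⟨n, i, ⟨1 - r, by constructor <;> linarith [hr.1, hr.2]⟩, hn, ?_⟩
      congr 1
      refine Δ.coord_injective (funext fun j => ?_)
      have hxj := congrFun hx j
      rw [bary, level_equidistant, tripod] at hxj
      rw [hcoord n i j _ hn]
      simp only [sub_sub_cancel]
      linarith
    · obtain ⟨m, hm⟩ : ∃ m : Fin 3 → ℤ, raise m i = n := ⟨n - Pi.single i 1, by simp [raise]⟩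
      subst hm
      have hm0 : m 0 + m 1 + m 2 = 0 := by
        rw [raise_sum] at hn
        omega
      refine ⟨m, i, ⟨r, by constructor <;> linarith [hr.1, hr.2]⟩, hm0, ?_⟩
      congr 1
      refine Δ.coord_injective (funext fun j => ?_)
      have hxj := congrFun hx j
      rw [bary, level_equidistant, tripod, hraise] at hxj
      rw [hcoord m i j _ hm0]
      dsimp only
      split_ifs at hxj ⊢ <;> linarith

/-! ### The deformation retraction -/

variable (Δ) in
/-- The coordinate functions on the torus, with values in the circle. -/
def circleCoord (θ : Torus) (j : Fin 3) : UnitAddCircle :=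
  Δ.signedArea.sign • ((Δ.side j).1 • θ.1 + (Δ.side j).2 • θ.2)

theorem circleCoord_proj (x : ℝ × ℝ) (j : Fin 3) :
    Δ.circleCoord (proj x) j = (Δ.coord x j : UnitAddCircle) := by
  rw [coord_apply, ← zsmul_eq_mul, ← zsmul_eq_mul, ← zsmul_eq_mul]
  rfl

theorem continuous_circleCoord (j : Fin 3) : Continuous fun θ => Δ.circleCoord θ j := by
  unfold circleCoord
  fun_prop

variable (Δ) in
/-- The barycentric coordinates as functions on the torus. -/
def torusBary (θ : Torus) (j : Fin 3) : ℝ := 1 / 2 - ‖Δ.circleCoord θ j‖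

theorem continuous_torusBary : Continuous Δ.torusBary :=
  continuous_pi fun j => continuous_const.sub (continuous_circleCoord j).norm

/-- The lines bounding the triangle have half-odd-integral levels and the barycentric coordinates
are at most `1 / 2`, so the distance of a coordinate from the nearest integer is the complement to
`1 / 2`. The formula no longer mentions the triangle, which yields continuity on the torus. -/
theorem torusBary_proj {s : ℝ} {n : Fin 3 → ℤ} (h : IsSign s n) {x : ℝ × ℝ}
    (hx : ∀ j, 0 ≤ Δ.bary s n x j) : Δ.torusBary (proj x) = Δ.bary s n x := by
  funext j
  have h1 := bary_le_half h hx j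
  have h0 := hx j
  obtain ⟨k, hk⟩ := exists_coord_eq_bary h x j
  have habs : |s * (Δ.bary s n x j - 1 / 2)| = 1 / 2 - Δ.bary s n x j := by
    rw [abs_mul, abs_of_nonpos (a := Δ.bary s n x j - 1 / 2) (by linarith)]
    rcases h with ⟨rfl, -⟩ | ⟨rfl, -⟩
    · rw [abs_one]; ring
    · rw [abs_neg, abs_one]; ring
  have hcoe : (Δ.coord x j : UnitAddCircle) =
      ((s * (Δ.bary s n x j - 1 / 2) : ℝ) : UnitAddCircle) := by
    rw [unitAddCircle_coe_eq_coe_iff]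
    rcases h with ⟨rfl, -⟩ | ⟨rfl, -⟩
    · exact ⟨k + 1, by rw [hk]; push_cast; ring⟩
    · exact ⟨k, by rw [hk]; ring⟩
  rw [torusBary, circleCoord_proj, hcoe, (AddCircle.norm_coe_eq_abs_iff 1 one_ne_zero).2, habs]
  · ring
  · rw [habs, abs_one]
    linarith

variable (Δ) in
/-- The sine of the first coordinate, as a function on the torus. -/
def torusSin (θ : Torus) : ℝ := (AddCircle.toCircle (Δ.circleCoord θ 0) : ℂ).im

theorem continuous_torusSin : Continuous Δ.torusSin :=
  Complex.continuous_im.comp (continuous_subtype_val.comp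
    (AddCircle.continuous_toCircle.comp (continuous_circleCoord 0)))

theorem torusSin_proj (x : ℝ × ℝ) :
    Δ.torusSin (proj x) = Real.sin (2 * Real.pi * Δ.coord x 0) := by
  rw [torusSin, circleCoord_proj, AddCircle.toCircle_apply_mk, Circle.coe_exp, div_one,
    Complex.exp_ofReal_mul_I_im]

variable (Δ) in
/-- The displacement of a point in the plane that moves it to the graph. -/
def displacement (θ : Torus) : ℝ × ℝ :=
  Δ.recon fun j => toTripod (Δ.torusBary θ) j - Δ.torusBary θ j

theorem continuous_displacement : Continuous Δ.displacement :=
  Δ.continuous_recon.comp (continuous_pi fun j =>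
    ((continuous_apply j).comp (continuous_toTripod.comp continuous_torusBary)).sub
      ((continuous_apply j).comp continuous_torusBary))

theorem displacement_proj {s : ℝ} {n : Fin 3 → ℤ} (h : IsSign s n) {x : ℝ × ℝ}
    (hx : ∀ j, 0 ≤ Δ.bary s n x j) (j : Fin 3) : Δ.coord (Δ.displacement (proj x)) j =
      toTripod (Δ.bary s n x) j - Δ.bary s n x j := by
  rw [displacement, coord_recon, torusBary_proj h hx]
  rw [torusBary_proj h hx]
  linarith [toTripod_sum (Δ.bary s n x), Δ.bary_sum h x]

variable (Δ) in
/-- The deformation of the torus that retracts the coamoeba to the graph. -/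
def deformation (t : ℝ) (θ : Torus) : Torus :=
  if Δ.torusSin θ ≤ 0 then θ + proj (t • Δ.displacement θ) else θ + proj (-(t • Δ.displacement θ))

theorem displacement_eq_zero {s : ℝ} {n : Fin 3 → ℤ} (h : IsSign s n) {x : ℝ × ℝ}
    (hx : ∀ j, 0 ≤ Δ.bary s n x j) (hfix : toTripod (Δ.bary s n x) = Δ.bary s n x) :
    Δ.displacement (proj x) = 0 := by
  refine Δ.coord_injective (funext fun j => ?_)
  rw [displacement_proj h hx, hfix, sub_self, map_zero]
  rfl

theorem IsInner.toTripod_eq {u : Fin 3 → ℝ} (hu : IsInner u) (hs : u 0 + u 1 + u 2 = 1 / 2)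
    (hpos : ¬ ∀ j, 0 < u j) : toTripod u = u := by
  obtain ⟨j, hj⟩ := hu.2.resolve_left hpos
  rw [eq_tripod_of_eq_half hu.1 hs hj]
  exact toTripod_tripod j ⟨by norm_num, le_rfl⟩

/-- The sine does not vanish inside a triangle, so such a point of the coamoeba is a vertex, and
vertices are fixed by the retraction. -/
theorem displacement_eq_zero_of_torusSin_eq_zero {θ : Torus} (hθ : θ ∈ coamoeba Δ.W)
    (h0 : Δ.torusSin θ = 0) : Δ.displacement θ = 0 := by
  obtain ⟨x, rfl⟩ := proj_surjective θ
  obtain ⟨s, n, h, hx⟩ := exists_isInner_of_mem_coamoeba hθ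
  refine displacement_eq_zero h hx.1 (hx.toTripod_eq (Δ.bary_sum h x) fun hpos => ?_)
  have hpi := Real.pi_pos
  have hlt : Δ.bary s n x 0 < 1 / 2 := by
    linarith [Δ.bary_sum h x, hpos 1, hpos 2]
  have hsin := Real.sin_pos_of_pos_of_lt_pi (x := 2 * Real.pi * Δ.bary s n x 0)
    (by have := hpos 0; positivity) (by nlinarith)
  rw [torusSin_proj, sin_coord h] at h0
  rcases h with ⟨rfl, -⟩ | ⟨rfl, -⟩ <;> linarith

/-- The deformation in barycentric coordinates. -/
theorem deformation_proj {s : ℝ} {n : Fin 3 → ℤ} (h : IsSign s n) {x : ℝ × ℝ}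
    (hx : IsInner (Δ.bary s n x)) (t : ℝ) : ∃ y, Δ.deformation t (proj x) = proj y ∧
      ∀ j, Δ.bary s n y j =
        Δ.bary s n x j + t * (toTripod (Δ.bary s n x) j - Δ.bary s n x j) := by
  -- The sign of `torusSin` tells white from black triangles, except where it is zero, and there the
  -- displacement vanishes.
  have hdef : Δ.deformation t (proj x) = proj x + proj (s • t • Δ.displacement (proj x)) := by
    have hpi := Real.pi_pos
    have hsin := Real.sin_nonneg_of_nonneg_of_le_pi (x := 2 * Real.pi * Δ.bary s n x 0)
      (by have := hx.1 0; positivity) (by nlinarith [bary_le_half h hx.1 0])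
    have hval : Δ.torusSin (proj x) = _ := (torusSin_proj x).trans (sin_coord h x 0)
    unfold deformation
    by_cases hle : Δ.torusSin (proj x) ≤ 0
    · rw [if_pos hle]
      rcases h with ⟨rfl, hn⟩ | ⟨rfl, hn⟩
      · rw [one_smul]
      · have h0 : Δ.torusSin (proj x) = 0 := by linarith
        rw [displacement_eq_zero_of_torusSin_eq_zero
          (proj_mem_coamoeba_of_isInner (Or.inr ⟨rfl, hn⟩) hx) h0]
        simp only [smul_zero]
    · rw [if_neg hle]
      rcases h with ⟨rfl, hn⟩ | ⟨rfl, hn⟩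
      · linarith
      · rw [neg_one_smul]
  refine ⟨x + s • t • Δ.displacement (proj x), hdef, fun j => ?_⟩
  have hss : s * s = 1 := by rcases h with ⟨rfl, -⟩ | ⟨rfl, -⟩ <;> norm_num
  have hd := displacement_proj h hx.1 j
  rw [bary, map_add, map_smul, map_smul, Pi.add_apply, Pi.smul_apply, Pi.smul_apply, hd,
    smul_eq_mul, smul_eq_mul]
  have hb : Δ.bary s n x j = s * (Δ.coord x j - Δ.level Δ.equidistant j (n j)) := rfl
  linear_combination -hb + t * (toTripod (Δ.bary s n x) j - Δ.bary s n x j) * hss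

/-- An interior point of a triangle moves on a segment towards another interior point, and a vertex
stays fixed. -/
theorem deformation_mem_coamoeba {t : ℝ} (ht : t ∈ Set.Icc (0 : ℝ) 1) {θ : Torus}
    (hθ : θ ∈ coamoeba Δ.W) : Δ.deformation t θ ∈ coamoeba Δ.W := by
  obtain ⟨x, rfl⟩ := proj_surjective θ
  obtain ⟨s, n, h, hx⟩ := exists_isInner_of_mem_coamoeba hθ
  obtain ⟨y, hy, hyb⟩ := deformation_proj h hx t
  rw [hy]
  refine proj_mem_coamoeba_of_isInner h ?_
  by_cases hpos : ∀ j, 0 < Δ.bary s n x j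
  · obtain ⟨i, r, hr, htri, hlt⟩ := exists_toTripod_eq hx.1 (Δ.bary_sum h x)
    have hpos' : ∀ j, 0 < Δ.bary s n y j := by
      intro j
      have h1 : 0 < toTripod (Δ.bary s n x) j := by
        rw [htri]
        exact tripod_pos i ⟨hr.1, hlt hpos⟩ j
      have h2 := hpos j
      rw [hyb]
      rcases ht.1.eq_or_lt with h0 | h0
      · rw [← h0]; linarith
      · nlinarith [ht.2]
    exact ⟨fun j => (hpos' j).le, Or.inl hpos'⟩
  · have : Δ.bary s n y = Δ.bary s n x := by
      funext j
      rw [hyb, hx.toTripod_eq (Δ.bary_sum h x) hpos]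
      ring
    rw [this]
    exact hx

theorem deformation_one_mem_support {θ : Torus} (hθ : θ ∈ coamoeba Δ.W) :
    Δ.deformation 1 θ ∈ (Δ.latticeGraph Δ.equidistant).support := by
  obtain ⟨x, rfl⟩ := proj_surjective θ
  obtain ⟨s, n, h, hx⟩ := exists_isInner_of_mem_coamoeba hθ
  obtain ⟨y, hy, hyb⟩ := deformation_proj h hx 1
  obtain ⟨i, r, hr, htri, -⟩ := exists_toTripod_eq hx.1 (Δ.bary_sum h x)
  refine (mem_support_equidistant_iff _).2 ⟨s, n, y, i, r, hr, h, hy, ?_⟩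
  rw [← htri]
  funext j
  rw [hyb]
  ring

theorem isInner_tripod (i : Fin 3) {r : ℝ} (hr : r ∈ Set.Icc (0 : ℝ) (1 / 2)) :
    IsInner (tripod i r) := by
  refine ⟨tripod_nonneg i hr, ?_⟩
  rcases hr.2.eq_or_lt with h | h
  · refine Or.inr ⟨i, ?_⟩
    rw [h, tripod, if_pos rfl]
    norm_num
  · exact Or.inl (tripod_pos i ⟨hr.1, h⟩)

theorem support_subset_coamoeba :
    (Δ.latticeGraph Δ.equidistant).support ⊆ coamoeba Δ.W := by
  intro p hp
  obtain ⟨s, n, x, i, r, hr, h, rfl, hx⟩ := (mem_support_equidistant_iff p).1 hp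
  refine proj_mem_coamoeba_of_isInner h ?_
  rw [hx]
  exact isInner_tripod i hr

theorem deformation_eq_self {θ : Torus} (hd : Δ.displacement θ = 0) (t : ℝ) :
    Δ.deformation t θ = θ := by
  have h0 : proj 0 = 0 := rfl
  unfold deformation
  rw [hd, smul_zero, neg_zero, h0, add_zero, ite_self]

theorem displacement_eq_zero_of_mem_support {θ : Torus}
    (hθ : θ ∈ (Δ.latticeGraph Δ.equidistant).support) : Δ.displacement θ = 0 := by
  obtain ⟨s, n, x, i, r, hr, h, rfl, hx⟩ := (mem_support_equidistant_iff θ).1 hθ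
  refine displacement_eq_zero h (fun j => ?_) ?_
  · rw [hx]
    exact tripod_nonneg i hr j
  · rw [hx]
    exact toTripod_tripod i hr

theorem deformation_zero (θ : Torus) : Δ.deformation 0 θ = θ := by
  have h0 : proj 0 = 0 := rfl
  unfold deformation
  rw [zero_smul, neg_zero, h0, add_zero, ite_self]

theorem isDeformationRetract_equidistant :
    IsDeformationRetract (Δ.latticeGraph Δ.equidistant).support (coamoeba Δ.W) := by
  have hcont : Continuous fun q : unitInterval × coamoeba Δ.W => Δ.deformation q.1 q.2 := by
    have hθ : Continuous fun q : unitInterval × coamoeba Δ.W => (q.2 : Torus) :=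
      continuous_subtype_val.comp continuous_snd
    have hdisp : Continuous fun q : unitInterval × coamoeba Δ.W =>
        (q.1 : ℝ) • Δ.displacement q.2 :=
      (continuous_subtype_val.comp continuous_fst).smul (continuous_displacement.comp hθ)
    unfold deformation
    -- The two formulas agree on the coamoeba where the sine vanishes, since the displacement is
    -- zero there.
    refine Continuous.if_le (hθ.add (continuous_proj.comp hdisp))
      (hθ.add (continuous_proj.comp hdisp.neg)) (continuous_torusSin.comp hθ) continuous_const ?_
    intro q hq
    rw [displacement_eq_zero_of_torusSin_eq_zero q.2.2 hq, smul_zero, neg_zero]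
  refine ⟨support_subset_coamoeba,
    ⟨fun q => ⟨Δ.deformation q.1 q.2, deformation_mem_coamoeba q.1.2 q.2.2⟩,
      hcont.subtype_mk _⟩, fun x => ?_, fun x => ?_, fun t x hx => ?_⟩
  · exact Subtype.ext (deformation_zero _)
  · exact deformation_one_mem_support x.2
  · exact Subtype.ext (deformation_eq_self (displacement_eq_zero_of_mem_support hx) _)

end LatticeTriangle

end HananyVegh

end

/-! ### Conclusion -/

theorem theorem1p3 (Δ : HananyVegh.LatticeTriangle) :
    -- for a suitable choice of representatives the output is a deformation retract
    ∃ (V₀ : Set (Δ.Edge → UnitAddCircle)) (G₀ : HananyVegh.ColoredGraph),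
      Δ.IsRepresentativeSystem V₀ ∧
      Δ.output V₀ = {G₀} ∧
      G₀.IsBicoloredGraph ∧
      HananyVegh.IsDeformationRetract G₀.support (HananyVegh.coamoeba Δ.W) ∧
      -- for every choice of representatives the output is the same graph up to isotopy
      ∀ V : Set (Δ.Edge → UnitAddCircle), Δ.IsRepresentativeSystem V →
        ∃ G : HananyVegh.ColoredGraph,
          Δ.output V = {G} ∧ G.IsBicoloredGraph ∧ G.Isotopic G₀ := by
  have hgood := Δ.isGood_equidistant
  have hmem : Δ.position Δ.equidistant ∈ Δ.goodArrangements :=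
    ⟨Equiv.refl _, fun _ => rfl, _, hgood, rfl⟩
  have hgraph : ∀ c ∈ Δ.goodArrangements, ∃ η, Δ.IsGood η ∧
      HananyVegh.graphOf (Δ.arrangement c) = Δ.latticeGraph η := by
    rintro c ⟨σ, hσ, η, hη, h⟩
    exact ⟨η, hη, hη.graphOf_eq (Δ.enumerates_of_comp_eq hσ h)⟩
  obtain ⟨V₀, hV₀, hcV₀⟩ := HananyVegh.LatticeTriangle.exists_isRepresentativeSystem hgood.isSimple
  refine ⟨V₀, Δ.latticeGraph Δ.equidistant, hV₀, ?_,
    HananyVegh.LatticeTriangle.isBicoloredGraph_latticeGraph hgood.strictMono,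
    HananyVegh.LatticeTriangle.isDeformationRetract_equidistant, fun V hV => ?_⟩
  · obtain ⟨c, hc, hcg, hout⟩ := HananyVegh.LatticeTriangle.exists_output_eq ⟨_, hmem⟩ hV₀
    -- The representatives were chosen to contain the equidistant arrangement, which is then the
    -- only good one among them.
    have heq : c = Δ.position Δ.equidistant := (hV₀.2 _ hgood.isSimple).unique
      ⟨hc, HananyVegh.LatticeTriangle.sameComponent_of_mem_goodArrangements hmem hcg⟩
      ⟨hcV₀, HananyVegh.LatticeTriangle.SameComponent.refl hgood.isSimple⟩
    rw [hout, heq, hgood.graphOf_eq (Δ.enumerates_of_comp_eq (σ := Equiv.refl _)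
      (fun _ => rfl) rfl)]
  · obtain ⟨c, -, hcg, hout⟩ := HananyVegh.LatticeTriangle.exists_output_eq ⟨_, hmem⟩ hV
    obtain ⟨η, hη, heq⟩ := hgraph c hcg
    refine ⟨_, hout, ?_⟩
    rw [heq]
    exact ⟨HananyVegh.LatticeTriangle.isBicoloredGraph_latticeGraph hη.strictMono,
      HananyVegh.LatticeTriangle.isotopic_latticeGraph hη hgood⟩
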